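/- Let $k$ be a local field of characteristic $\neq 2$ with a continuous involution $\sigma$ (possibly trivial) and fixed field $k_0$, and let $k^s$ be a separable closure of $k$. If $k_0$ is archimedean, $WD(k_0)$ is its Weil group $W(k_0)$; otherwise $WD(k_0)=W(k_0)\times \mathrm{SL}_2(\mathbb C)$. $WD(k)$ denotes the subgroup of $WD(k_0)$ lying over $\mathrm{Gal}(k^s/k)$. A representation of $WD(k)$ is a finite-dimensional complex representation $M$ which is continuous and semisimple (archimedean case), respectively trivial on an open subgroup of inertia, with geometric Frobenius acting semisimply, and algebraic on $\mathrm{SL}_2(\mathbb C)$ (nonarchimedean case). $M$ is orthogonal (symplectic) if it has a non-degenerate $WD(k)$-invariant bilinear form $B$ with $B(n,m)=b\,B(m,n)$, $b=1$ ($b=-1$). If $\sigma\ne1$, fix any $s\in WD(k_0)\setminus WD(k)$; $M$ is conjugate-orthogonal (conjugate-symplectic) if it has a non-degenerate bilinear form $B$ with $B(\tau m,s\tau s^{-1}n)=B(m,n)$ for $\tau\in WD(k)$ and $B(n,m)=b\,B(m,s^2n)$, $b=1$ ($b=-1$). Let $V$ be a finite-dimensional $k$-space with a non-degenerate $\sigma$-sesquilinear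 form, $\epsilon$-symmetric with $\epsilon=\pm1$, and let $G$ be the corresponding connected classical group over $k_0$: $\mathrm{Sp}(V)$ ($\sigma=1$, $\epsilon=-1$), $\mathrm{SO}(V)$ ($\sigma=1$, $\epsilon=1$) or $\mathrm U(V)$ ($\sigma\neq1$). Its $L$-group ${}^LG=\widehat G\rtimes \mathrm{Gal}(K/k_0)$, with pinned Galois action, is: $\mathrm{SO}_{2n+1}(\mathbb C)$ for $\mathrm{Sp}(V)$, $\dim V=2n$; $\mathrm{Sp}_{2n}(\mathbb C)$ for $\mathrm{SO}(V)$, $\dim V=2n+1$; $\mathrm{SO}_{2n}(\mathbb C)\rtimes\mathrm{Gal}(K/k)$, $K=k(\sqrt{\mathrm{disc}\,V})$, $\mathrm{disc}\,V=(-1)^n\det V$, for $\mathrm{SO}(V)$, $\dim V=2n$; $\mathrm{GL}_n(\mathbb C)\rtimes\mathrm{Gal}(k/k_0)$ for $\mathrm U(V)$, $\dim V=n$. A Langlands parameter of $G$ is a homomorphism $\varphi:WD(k_0)\to{}^LG$ inducing the natural map $W(k_0)\to\mathrm{Gal}(K/k_0)$, which is continuous with image consisting of semisimple elements (archimedean case),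 respectively trivial on an open subgroup of inertia, semisimple on geometric Frobenius, and algebraic on $\mathrm{SL}_2(\mathbb C)$ (nonarchimedean case). Parameters are equivalent if they are conjugate under $\widehat G$. $C_\varphi\subset\widehat G$ is the centralizer of the image of $\varphi$. The restriction of $\varphi$ to $WD(k)$, followed by the standard representation of $\mathrm{Sp}_{2n}(\mathbb C)$, $\mathrm{SO}_{2n+1}(\mathbb C)$, $\mathrm{GL}_n(\mathbb C)$, or of $\mathrm O_{2n}(\mathbb C)$ via $\mathrm{SO}_{2n}(\mathbb C)\rtimes\mathrm{Gal}(K/k)\to\mathrm O_{2n}(\mathbb C)$, is denoted $M_\varphi$. Theorem. (i) A finite-dimensional complex linear representation $M$ of the group $WD(k)$ is isomorphic to $M_\varphi$ for some Langlands parameter $\varphi$ of $G$ if and only if it is a representation of $WD(k)$ in the above sense with the following structure: - $G=\mathrm{Sp}(V)$, $\dim V=2n$: $M$ is orthogonal, $\dim M=2n+1$, $\det M=1$; - $G=\mathrm{SO}(V)$, $\dim V=2n+1$: $M$ is symplectic, $\dim M=2n$; - $G=\mathrm{SO}(V)$, $\dim V=2n$: $M$ is orthogonal, $\dim M=2n$,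 and $\det M=\mathrm{disc}\,V$, i.e. $\det M$ is the quadratic character $w\mapsto w(\sqrt d)/\sqrt d$ with $d=\mathrm{disc}\,V$; - $G=\mathrm U(V)$, $\dim V=n$ odd: $M$ is conjugate-orthogonal, $\dim M=n$; - $G=\mathrm U(V)$, $\dim V=n$ even: $M$ is conjugate-symplectic, $\dim M=n$. (ii) Equivalent parameters $\varphi,\varphi'$ have $M_\varphi\cong M_{\varphi'}$. Conversely $M_\varphi\cong M_{\varphi'}$ implies that $\varphi$ and $\varphi'$ are equivalent, except when $G=\mathrm{SO}(V)$ with $\dim V>0$ even and every irreducible orthogonal summand of $M_\varphi$ has even dimension. In this exceptional case there are exactly two equivalence classes of parameters of $G$ giving rise to $M_\varphi$. For $G=\mathrm{Sp}(V)$, $M_\varphi$ always has an irreducible orthogonal summand of odd dimension. (iii) Let $M\cong M_\varphi$, let $B$ be any form on $M$ as in (i) (orthogonal, symplectic, conjugate-orthogonal or conjugate-symplectic, according to the case), and let $C$ be the group of elements of $\mathrm{Aut}(M,B)$ commuting with $WD(k)$. In the unitary case $C_\varphi\cong C$; in the orthogonal and symplectic cases $C_\varphi\cong C^+=\{a\in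 C:\det(a|M)=1\}$. The isomorphism is induced by a linear isomorphism of the space of $M_\varphi$ with $M$. -/

import Mathlib

open scoped Matrix Topology

noncomputable section

namespace ClassicalPar

/-! ### Local fields with involution, and Galois groups -/

/-- The two kinds of local fields. -/
inductive LocalKind
  | archimedean
  | nonarchimedean

/-- `k` is a local field of kind `κ`: either `k` is isomorphic, as a topological field,
to `ℝ` or `ℂ`, or `k` is a locally compact nonarchimedean field (nontrivially normed). -/
def IsLocalField : LocalKind → (k : Type*) → [NontriviallyNormedField k] → Prop
  | .archimedean, k, _ =>
      (∃ e : k ≃+* ℝ, Continuous e ∧ Continuous e.symm) ∨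
      (∃ e : k ≃+* ℂ, Continuous e ∧ Continuous e.symm)
  | .nonarchimedean, k, _ => IsUltrametricDist k ∧ LocallyCompactSpace k

section Galois

universe u v

variable {k : Type u} [Field k]

/-- The fixed field `k₀` of `σ`. -/
def fixedField (σ : k ≃+* k) : Subfield k :=
  RingHom.eqLocusField (σ : k →+* k) (RingHom.id k)

theorem mem_fixedField {σ : k ≃+* k} {x : k} : x ∈ fixedField σ ↔ σ x = x := Iff.rfl

variable (σ : k ≃+* k) (Ω : Type v) [Field Ω] [Algebra k Ω]

/-- The absolute Galois group `Gal(Ω/k₀)`. -/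
abbrev AbsGal : Type v := Ω ≃ₐ[fixedField σ] Ω

variable {σ Ω} in
/-- An automorphism of `Ω` over `k₀` acts on each element of `k` as `1` or `σ`. -/
theorem gal_apply (hσ : ∀ x, σ (σ x) = x) (g : AbsGal σ Ω) (x : k) :
    g (algebraMap k Ω x) = algebraMap k Ω x ∨ g (algebraMap k Ω x) = algebraMap k Ω (σ x) := by
  have hfix : ∀ y : k, σ y = y → g (algebraMap k Ω y) = algebraMap k Ω y := fun y hy =>
    g.commutes ⟨y, hy⟩
  have h1 := hfix (x + σ x) (by rw [map_add, hσ, add_comm])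
  have h2 := hfix (x * σ x) (by rw [map_mul, hσ, mul_comm])
  simp only [map_add, map_mul] at h1 h2
  set X := algebraMap k Ω x
  set Y := algebraMap k Ω (σ x)
  have h3 : (g X - X) * (g X - Y) = 0 := by
    linear_combination g X * h1 - h2
  rcases mul_eq_zero.mp h3 with h | h
  · exact Or.inl (sub_eq_zero.mp h)
  · exact Or.inr (sub_eq_zero.mp h)

/-- The subgroup `Gal(Ω/k)` of `Gal(Ω/k₀)`. -/
def galOver : Subgroup (AbsGal σ Ω) where
  carrier := {g | ∀ x : k, g (algebraMap k Ω x) = algebraMap k Ω x}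
  mul_mem' {a b} ha hb x := by
    show a (b _) = _
    rw [hb x, ha x]
  one_mem' _ := rfl
  inv_mem' {a} ha x := by
    show a.symm _ = _
    rw [AlgEquiv.symm_apply_eq, ha x]

variable {σ}

theorem galOver_normal (hσ : ∀ x, σ (σ x) = x) : (galOver σ Ω).Normal where
  conj_mem n hn g x := by
    show g (n (g.symm (algebraMap k Ω x))) = _
    have h : n (g.symm (algebraMap k Ω x)) = g.symm (algebraMap k Ω x) := by
      rcases gal_apply hσ g.symm x with h | h
      · rw [h, hn x]
      · rw [h, hn (σ x)]
    rw [h, g.apply_symm_apply]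

theorem sq_mem_galOver (hσ : ∀ x, σ (σ x) = x) (g : AbsGal σ Ω) : g * g ∈ galOver σ Ω := by
  intro x
  show g (g _) = _
  rcases gal_apply hσ g x with h | h
  · rw [h, h]
  · have h1 : g (algebraMap k Ω (x + σ x)) = algebraMap k Ω (x + σ x) :=
      g.commutes ⟨x + σ x, by rw [mem_fixedField, map_add, hσ, add_comm]⟩
    rw [map_add, map_add, h] at h1
    rw [h]
    linear_combination h1

end Galois

/-! ### Weil groups of archimedean fields -/

section ArchWeil

universe u v

variable (F : Type u) (Ω : Type v) [Field F] [Field Ω] [Algebra F Ω]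

/-- For `F` archimedean with algebraic closure `Ω`, the underlying set `Ωˣ × Gal(Ω/F)` of the
Weil group of `F`. -/
@[ext] structure ArchWeil : Type v where
  unit : Ωˣ
  gal : Ω ≃ₐ[F] Ω

variable {F Ω}

/-- `g` moves a square root of `-1` (for `F = ℝ`, `Ω = ℂ` : `g` is complex conjugation). -/
def MovesI (g : Ω ≃ₐ[F] Ω) : Prop := ∃ i : Ω, i ^ 2 = -1 ∧ g i ≠ i

theorem movesI_iff {i : Ω} (hi : i ^ 2 = -1) (g : Ω ≃ₐ[F] Ω) : MovesI g ↔ g i = -i ∧ i ≠ -i := by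
  have hgi : g i = i ∨ g i = -i := by
    have h : (g i) ^ 2 = i ^ 2 := by rw [← map_pow, hi, map_neg, map_one]
    exact sq_eq_sq_iff_eq_or_eq_neg.mp h
  constructor
  · rintro ⟨j, hj, hgj⟩
    have hji : j = i ∨ j = -i := sq_eq_sq_iff_eq_or_eq_neg.mp (hj.trans hi.symm)
    have hne : g i ≠ i := by
      rcases hji with rfl | rfl
      · exact hgj
      · intro h
        exact hgj (by rw [map_neg, h])
    rcases hgi with h | h
    · exact absurd h hne
    · exact ⟨h, fun h' => hne (h.trans h'.symm)⟩
  · rintro ⟨h, h'⟩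
    exact ⟨i, hi, fun h'' => h' (h''.symm.trans h)⟩

theorem movesI_mul (g h : Ω ≃ₐ[F] Ω) : MovesI (g * h) ↔ (MovesI g ↔ ¬ MovesI h) := by
  by_cases hex : ∃ i : Ω, i ^ 2 = -1
  · obtain ⟨i, hi⟩ := hex
    have key : ∀ g : Ω ≃ₐ[F] Ω, g i = i ∨ g i = -i := fun g => by
      have h : (g i) ^ 2 = i ^ 2 := by rw [← map_pow, hi, map_neg, map_one]
      exact sq_eq_sq_iff_eq_or_eq_neg.mp h
    rw [movesI_iff hi, movesI_iff hi, movesI_iff hi, AlgEquiv.mul_apply]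
    by_cases hii : i = -i
    · simp [hii.symm]
    · have hii' : -i ≠ i := fun h => hii h.symm
      rcases key g with hg | hg <;> rcases key h with hh | hh <;>
        simp [hg, hh, hii]
  · have : ∀ g : Ω ≃ₐ[F] Ω, ¬ MovesI g := fun g ⟨i, hi, _⟩ => hex ⟨i, hi⟩
    simp [this]

open Classical in
/-- The 2-cocycle defining the Weil group of `ℝ`: it is `-1` if both arguments are complex
conjugation, and `1` otherwise. -/
def weilCocycle (g h : Ω ≃ₐ[F] Ω) : Ωˣ := if MovesI g ∧ MovesI h then -1 else 1

theorem map_weilCocycle (g a b : Ω ≃ₐ[F] Ω) :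
    Units.map (g : Ω →* Ω) (weilCocycle a b) = weilCocycle a b := by
  unfold weilCocycle
  split_ifs
  · ext
    show g (-1) = -1
    rw [map_neg, map_one]
  · exact map_one _

theorem weilCocycle_cocycle (a b c : Ω ≃ₐ[F] Ω) :
    weilCocycle a b * weilCocycle (a * b) c = weilCocycle b c * weilCocycle a (b * c) := by
  have h1 := movesI_mul a b
  have h2 := movesI_mul b c
  unfold weilCocycle
  by_cases ha : MovesI a <;> by_cases hb : MovesI b <;> by_cases hc : MovesI c <;>
    simp [ha, hb, hc] at h1 h2 <;> simp [ha, hb, hc, h1, h2]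

/-- The group law of the Weil group: `(z, g) (w, h) = (z ⬝ g(w) ⬝ c(g, h), g h)`. For
`Ω/F = ℂ/ℝ` this is `ℂˣ ∪ ℂˣ j` with `j ^ 2 = -1` and `j z j⁻¹ = conj z`; for `F = Ω = ℂ` it is
`ℂˣ`. -/
instance : Group (ArchWeil F Ω) :=
  letI m : Mul (ArchWeil F Ω) :=
    ⟨fun x y => ⟨x.unit * Units.map (x.gal : Ω →* Ω) y.unit * weilCocycle x.gal y.gal,
      x.gal * y.gal⟩⟩
  letI o : One (ArchWeil F Ω) := ⟨⟨1, 1⟩⟩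
  letI i : Inv (ArchWeil F Ω) :=
    ⟨fun x => ⟨(Units.map (x.gal⁻¹ : Ω ≃ₐ[F] Ω) x.unit)⁻¹ * weilCocycle x.gal⁻¹ x.gal,
      x.gal⁻¹⟩⟩
  Group.ofLeftAxioms
    (fun a b c => by
      have hc := weilCocycle_cocycle a.gal b.gal c.gal
      refine ArchWeil.ext ?_ (mul_assoc _ _ _)
      show (a.unit * Units.map (a.gal : Ω →* Ω) b.unit * weilCocycle a.gal b.gal) *
          Units.map ((a.gal * b.gal : Ω ≃ₐ[F] Ω) : Ω →* Ω) c.unit *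
          weilCocycle (a.gal * b.gal) c.gal =
        a.unit * Units.map (a.gal : Ω →* Ω)
          (b.unit * Units.map (b.gal : Ω →* Ω) c.unit * weilCocycle b.gal c.gal) *
          weilCocycle a.gal (b.gal * c.gal)
      rw [map_mul, map_mul, map_weilCocycle]
      have hm : Units.map ((a.gal * b.gal : Ω ≃ₐ[F] Ω) : Ω →* Ω) c.unit =
          Units.map (a.gal : Ω →* Ω) (Units.map (b.gal : Ω →* Ω) c.unit) := by
        ext; rfl
      rw [hm]
      calc _ = a.unit * Units.map (a.gal : Ω →* Ω) b.unit *
            Units.map (a.gal : Ω →* Ω) (Units.map (b.gal : Ω →* Ω) c.unit) *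
            (weilCocycle a.gal b.gal * weilCocycle (a.gal * b.gal) c.gal) := by
              simp only [mul_assoc, mul_left_comm, mul_comm]
        _ = _ := by
              rw [hc]; simp only [mul_assoc])
    (fun a => by
      refine ArchWeil.ext ?_ (one_mul _)
      show 1 * Units.map ((1 : Ω ≃ₐ[F] Ω) : Ω →* Ω) a.unit * weilCocycle 1 a.gal = a.unit
      have h1 : weilCocycle (1 : Ω ≃ₐ[F] Ω) a.gal = 1 := by
        unfold weilCocycle
        rw [if_neg]
        rintro ⟨⟨i, _, hi⟩, _⟩
        exact hi rfl
      rw [h1, one_mul, mul_one]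
      ext; rfl)
    (fun a => by
      refine ArchWeil.ext ?_ (inv_mul_cancel a.gal)
      show (Units.map ((a.gal⁻¹ : Ω ≃ₐ[F] Ω) : Ω →* Ω) a.unit)⁻¹ * weilCocycle a.gal⁻¹ a.gal *
        Units.map ((a.gal⁻¹ : Ω ≃ₐ[F] Ω) : Ω →* Ω) a.unit * weilCocycle a.gal⁻¹ a.gal = 1
      have h2 : weilCocycle a.gal⁻¹ a.gal * weilCocycle a.gal⁻¹ a.gal = 1 := by
        unfold weilCocycle
        split_ifs <;> simp
      rw [mul_right_comm _ (weilCocycle a.gal⁻¹ a.gal), inv_mul_cancel, one_mul, h2])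

/-- The projection of the archimedean Weil group to the Galois group. -/
def ArchWeil.toGal : ArchWeil F Ω →* (Ω ≃ₐ[F] Ω) where
  toFun := ArchWeil.gal
  map_one' := rfl
  map_mul' _ _ := rfl

end ArchWeil

/-! ### Weil groups of nonarchimedean fields -/

section NonarchWeil

universe u v

variable {k : Type u} [NormedField k]

/-- The cardinality of the residue field of a subfield `L` of a nonarchimedean field: the number
of residue classes of integral elements of `L` modulo the relation `‖x - y‖ < 1`. -/
def residueCard (L : Subfield k) : ℕ :=
  Nat.card (Quot fun x y : {x : k // x ∈ L ∧ ‖x‖ ≤ 1} => ‖x.1 - y.1‖ < 1)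

variable (σ : k ≃+* k) (Ω : Type v) [Field Ω] [Algebra k Ω]

variable {Ω} in
/-- `g ∈ Gal(Ω/k₀)` acts on the residue field of `Ω` as `x ↦ x ^ m`. Here the spectral norm is the
extension to `Ω` of the absolute value of `k`. -/
def ActsOnResidueAsPow (g : AbsGal σ Ω) (m : ℕ) : Prop :=
  ∀ x : Ω, spectralNorm k Ω x ≤ 1 → spectralNorm k Ω (g x - x ^ m) < 1

/-- The inertia group of `Gal(Ω/k₀)`. -/
def inertia : Set (AbsGal σ Ω) := {g | ActsOnResidueAsPow σ g 1}

/-- The geometric Frobenius elements of `k₀`. -/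
def geomFrob₀ : Set (AbsGal σ Ω) :=
  {g | ActsOnResidueAsPow σ g⁻¹ (residueCard (fixedField σ))}

/-- The geometric Frobenius elements of `k`. -/
def geomFrob : Set (AbsGal σ Ω) :=
  {g | g ∈ galOver σ Ω ∧ ActsOnResidueAsPow σ g⁻¹ (residueCard (⊤ : Subfield k))}

/-- The Weil group of `k₀`: the subgroup of `Gal(Ω/k₀)` generated by the inertia group and the
geometric Frobenius elements. -/
def nonarchWeil : Subgroup (AbsGal σ Ω) :=
  Subgroup.closure (inertia σ Ω ∪ geomFrob₀ σ Ω)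

end NonarchWeil

/-! ### Weil-Deligne groups and their representations -/

section WeilDeligne

universe u v w

variable {k : Type u} [NontriviallyNormedField k] (κ : LocalKind) (σ : k ≃+* k)
  (Ω : Type v) [Field Ω] [Algebra k Ω]

/-- The Weil-Deligne group `WD(k₀)` of the fixed field `k₀` of `σ`. -/
def WD₀ : LocalKind → Type v
  | .archimedean => ArchWeil (fixedField σ) Ω
  | .nonarchimedean => nonarchWeil σ Ω × Matrix.SpecialLinearGroup (Fin 2) ℂ

instance : (κ : LocalKind) → Group (WD₀ σ Ω κ)
  | .archimedean => inferInstanceAs (Group (ArchWeil (fixedField σ) Ω))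
  | .nonarchimedean =>
      inferInstanceAs (Group (nonarchWeil σ Ω × Matrix.SpecialLinearGroup (Fin 2) ℂ))

/-- The natural map `WD(k₀) → Gal(Ω/k₀)`. -/
def WD₀.toGal : (κ : LocalKind) → WD₀ σ Ω κ →* AbsGal σ Ω
  | .archimedean => ArchWeil.toGal
  | .nonarchimedean => (nonarchWeil σ Ω).subtype.comp (MonoidHom.fst _ _)

/-- The Weil-Deligne group `WD(k)`, as the subgroup of `WD(k₀)` lying over `Gal(Ω/k)`. -/
def WD : Subgroup (WD₀ σ Ω κ) := (galOver σ Ω).comap (WD₀.toGal σ Ω κ)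

/-- The element `z ∈ Ωˣ` of the archimedean Weil group. -/
def ofUnit (z : Ωˣ) : WD₀ σ Ω .archimedean := (⟨z, 1⟩ : ArchWeil (fixedField σ) Ω)

theorem ofUnit_mem (z : Ωˣ) : ofUnit σ Ω z ∈ WD .archimedean σ Ω := fun _ => rfl

/-- The element `w` of the nonarchimedean Weil group, as an element of the Weil-Deligne group. -/
def ofWeil (w : nonarchWeil σ Ω) : WD₀ σ Ω .nonarchimedean :=
  ((w, 1) : nonarchWeil σ Ω × Matrix.SpecialLinearGroup (Fin 2) ℂ)

theorem ofWeil_mem (w : nonarchWeil σ Ω) (hw : (w : AbsGal σ Ω) ∈ galOver σ Ω) :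
    ofWeil σ Ω w ∈ WD .nonarchimedean σ Ω := hw

/-- The element `g ∈ SL₂(ℂ)` of the nonarchimedean Weil-Deligne group. -/
def ofSL₂ (g : Matrix.SpecialLinearGroup (Fin 2) ℂ) : WD₀ σ Ω .nonarchimedean :=
  ((1, g) : nonarchWeil σ Ω × Matrix.SpecialLinearGroup (Fin 2) ℂ)

theorem ofSL₂_mem (g : Matrix.SpecialLinearGroup (Fin 2) ℂ) :
    ofSL₂ σ Ω g ∈ WD .nonarchimedean σ Ω := (galOver σ Ω).one_mem

/-- The usual topology of `Ωˣ`, for `Ω` of finite dimension over the topological field `k`. -/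
abbrev unitsTopology (k : Type u) [NontriviallyNormedField k] (Ω : Type v) [Field Ω] [Algebra k Ω] :
    TopologicalSpace Ωˣ :=
  letI : TopologicalSpace Ω := moduleTopology k Ω
  inferInstance

/-- A function on `SL₂(ℂ)` is algebraic if it is a polynomial in the matrix entries. -/
def IsAlgebraicFun (f : Matrix.SpecialLinearGroup (Fin 2) ℂ → ℂ) : Prop :=
  ∃ P : MvPolynomial (Fin 2 × Fin 2) ℂ, ∀ g, f g = MvPolynomial.eval (fun ij => g.1 ij.1 ij.2) P

variable {σ Ω}

/-- Representations of `WD(k)`.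

In the archimedean case: continuous (equivalently, continuous on the open subgroup `Ωˣ`) and
semisimple.  In the nonarchimedean case: trivial on an open subgroup of the inertia group of `k`,
with semisimple Frobenius, and algebraic on `SL₂(ℂ)`. -/
def IsWDRep : (κ : LocalKind) → {M : Type w} → [AddCommGroup M] → [Module ℂ M] →
    Representation ℂ (WD κ σ Ω) M → Prop
  | .archimedean, M, _, _, ρ =>
      (∀ (m : M) (l : M →ₗ[ℂ] ℂ), @Continuous Ωˣ ℂ (unitsTopology k Ω) _
        fun z => l (ρ ⟨ofUnit σ Ω z, ofUnit_mem σ Ω z⟩ m)) ∧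
      ρ.IsSemisimpleRepresentation
  | .nonarchimedean, M, _, _, ρ =>
      (∃ U : Subgroup (AbsGal σ Ω), IsOpen (U : Set (AbsGal σ Ω)) ∧
        ∀ (w : nonarchWeil σ Ω) (hw : (w : AbsGal σ Ω) ∈ galOver σ Ω),
          (w : AbsGal σ Ω) ∈ inertia σ Ω → (w : AbsGal σ Ω) ∈ U →
            ρ ⟨ofWeil σ Ω w, ofWeil_mem σ Ω w hw⟩ = 1) ∧
      (∀ (w : nonarchWeil σ Ω) (hw : (w : AbsGal σ Ω) ∈ galOver σ Ω),
        (w : AbsGal σ Ω) ∈ geomFrob σ Ω →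
          Module.End.IsSemisimple (ρ ⟨ofWeil σ Ω w, ofWeil_mem σ Ω w hw⟩)) ∧
      (∀ (m : M) (l : M →ₗ[ℂ] ℂ),
        IsAlgebraicFun fun g => l (ρ ⟨ofSL₂ σ Ω g, ofSL₂_mem σ Ω g⟩ m))

end WeilDeligne

/-! ### Self-dual and conjugate-dual representations -/

section Dual

variable {G : Type*} [Group G] {M : Type*} [AddCommGroup M] [Module ℂ M]

/-- `B` is a non-degenerate `ρ`-invariant bilinear form on `M` of sign `b`. -/
def IsSelfDualForm (ρ : Representation ℂ G M) (b : ℂ) (B : M →ₗ[ℂ] M →ₗ[ℂ] ℂ) : Prop :=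
  B.Nondegenerate ∧ (∀ τ m n, B (ρ τ m) (ρ τ n) = B m n) ∧ ∀ m n, B n m = b * B m n

/-- Orthogonal representations. -/
def IsOrthogonal (ρ : Representation ℂ G M) : Prop := ∃ B, IsSelfDualForm ρ 1 B

/-- Symplectic representations. -/
def IsSymplectic (ρ : Representation ℂ G M) : Prop := ∃ B, IsSelfDualForm ρ (-1) B

/-- Every irreducible orthogonal summand has even dimension. (For semisimple `ρ`, every
subrepresentation is a direct summand.) -/
def OrthogonalSummandsEven (ρ : Representation ℂ G M) : Prop :=
  ∀ W : Subrepresentation ρ, W.toRepresentation.IsIrreducible →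
    IsOrthogonal W.toRepresentation → Even (Module.finrank ℂ W.toSubmodule)

/-- The group `Aut(M, B)` inside `GL(M)`. -/
def autForm (B : M →ₗ[ℂ] M →ₗ[ℂ] ℂ) : Subgroup (M ≃ₗ[ℂ] M) where
  carrier := {a | ∀ m n, B (a m) (a n) = B m n}
  mul_mem' {a b} ha hb m n := by
    show B (a (b m)) (a (b n)) = _
    rw [ha, hb]
  one_mem' _ _ := rfl
  inv_mem' {a} ha m n := by
    show B (a.symm m) (a.symm n) = _
    rw [← ha, a.apply_symm_apply, a.apply_symm_apply]

/-- The group `C` of elements of `Aut(M, B)` which commute with the representation `ρ`. -/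
def centralizerC (ρ : Representation ℂ G M) (B : M →ₗ[ℂ] M →ₗ[ℂ] ℂ) : Subgroup (M ≃ₗ[ℂ] M) where
  carrier := {a | a ∈ autForm B ∧ ∀ τ m, a (ρ τ m) = ρ τ (a m)}
  mul_mem' {a b} ha hb := ⟨mul_mem ha.1 hb.1, fun τ m => by
    show a (b _) = ρ τ (a (b m))
    rw [hb.2, ha.2]⟩
  one_mem' := ⟨one_mem _, fun _ _ => rfl⟩
  inv_mem' {a} ha := ⟨inv_mem ha.1, fun τ m => by
    show a.symm _ = ρ τ (a.symm m)
    rw [LinearEquiv.symm_apply_eq, ha.2, a.apply_symm_apply]⟩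

/-- The subgroup `C⁺` of elements of `C` of determinant `1`. -/
def centralizerCPlus (ρ : Representation ℂ G M) (B : M →ₗ[ℂ] M →ₗ[ℂ] ℂ) :
    Subgroup (M ≃ₗ[ℂ] M) :=
  centralizerC ρ B ⊓ (LinearEquiv.det : (M ≃ₗ[ℂ] M) →* ℂˣ).ker

end Dual

section ConjDual

universe u v

variable {k : Type u} [NontriviallyNormedField k] {κ : LocalKind} {σ : k ≃+* k}
  {Ω : Type v} [Field Ω] [Algebra k Ω]

theorem conj_mem_WD (hσ : ∀ x, σ (σ x) = x) (s : WD₀ σ Ω κ) (τ : WD κ σ Ω) :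
    s * τ * s⁻¹ ∈ WD κ σ Ω :=
  ((galOver_normal Ω hσ).comap (WD₀.toGal σ Ω κ)).conj_mem τ τ.2 s

theorem sq_mem_WD (hσ : ∀ x, σ (σ x) = x) (s : WD₀ σ Ω κ) : s * s ∈ WD κ σ Ω := by
  show WD₀.toGal σ Ω κ (s * s) ∈ galOver σ Ω
  rw [map_mul]
  exact sq_mem_galOver Ω hσ _

variable {M : Type*} [AddCommGroup M] [Module ℂ M]

/-- `B` is a conjugate-duality of sign `b` on the representation `ρ` of `WD(k)`, relative to the
element `s` of `WD(k₀)`: a non-degenerate bilinear form with `B(τ m, s τ s⁻¹ n) = B(m, n)` and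
`B(n, m) = b ⬝ B(m, s² n)`. -/
def IsConjDualForm (hσ : ∀ x, σ (σ x) = x) (s : WD₀ σ Ω κ)
    (ρ : Representation ℂ (WD κ σ Ω) M) (b : ℂ) (B : M →ₗ[ℂ] M →ₗ[ℂ] ℂ) : Prop :=
  B.Nondegenerate ∧
  (∀ (τ : WD κ σ Ω) (m n : M), B (ρ τ m) (ρ ⟨s * τ * s⁻¹, conj_mem_WD hσ s τ⟩ n) = B m n) ∧
  ∀ m n, B n m = b * B m (ρ ⟨s * s, sq_mem_WD hσ s⟩ n)

/-- Conjugate-orthogonal representations. -/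
def IsConjOrthogonal (hσ : ∀ x, σ (σ x) = x) (s : WD₀ σ Ω κ)
    (ρ : Representation ℂ (WD κ σ Ω) M) : Prop :=
  ∃ B, IsConjDualForm hσ s ρ 1 B

/-- Conjugate-symplectic representations. -/
def IsConjSymplectic (hσ : ∀ x, σ (σ x) = x) (s : WD₀ σ Ω κ)
    (ρ : Representation ℂ (WD κ σ Ω) M) : Prop :=
  ∃ B, IsConjDualForm hσ s ρ (-1) B

end ConjDual

/-! ### Matrix groups -/

section MatrixGroups

variable {N : ℕ}

/-- The antidiagonal matrix with all entries `1`. -/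
def antidiag (N : ℕ) : Matrix (Fin N) (Fin N) ℂ :=
  Matrix.of fun i j => if j = i.rev then 1 else 0

/-- The antidiagonal matrix with alternating entries `1, -1, 1, …`. It is symmetric for `N` odd and
skew-symmetric for `N` even. -/
def altAntidiag (N : ℕ) : Matrix (Fin N) (Fin N) ℂ :=
  Matrix.of fun i j => if j = i.rev then (-1) ^ (i : ℕ) else 0

/-- The special isometry group of the bilinear form with Gram matrix `J`. -/
def specialIsometryGroup (J : Matrix (Fin N) (Fin N) ℂ) : Subgroup (GL (Fin N) ℂ) where
  carrier := {g | (g : Matrix (Fin N) (Fin N) ℂ)ᵀ * J * g = J ∧ Matrix.GeneralLinearGroup.det g = 1}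
  mul_mem' {a b} ha hb := by
    refine ⟨?_, by rw [map_mul, ha.2, hb.2, one_mul]⟩
    calc ((a * b : GL (Fin N) ℂ) : Matrix (Fin N) (Fin N) ℂ)ᵀ * J * (a * b : GL (Fin N) ℂ)
        = (b : Matrix (Fin N) (Fin N) ℂ)ᵀ * ((a : Matrix (Fin N) (Fin N) ℂ)ᵀ * J * a) * b := by
          simp only [Units.val_mul, Matrix.transpose_mul, mul_assoc]
      _ = J := by rw [ha.1, hb.1]
  one_mem' := by constructor <;> simp
  inv_mem' {a} ha := by
    refine ⟨?_, by rw [map_inv, ha.2, inv_one]⟩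
    have h1 : (a : Matrix (Fin N) (Fin N) ℂ) * (a⁻¹ : GL (Fin N) ℂ) = 1 := by
      rw [← Units.val_mul, mul_inv_cancel, Units.val_one]
    have h2 : ((a⁻¹ : GL (Fin N) ℂ) : Matrix (Fin N) (Fin N) ℂ)ᵀ *
        (a : Matrix (Fin N) (Fin N) ℂ)ᵀ = 1 := by
      rw [← Matrix.transpose_mul, h1, Matrix.transpose_one]
    calc ((a⁻¹ : GL (Fin N) ℂ) : Matrix (Fin N) (Fin N) ℂ)ᵀ * J * (a⁻¹ : GL (Fin N) ℂ)
        = ((a⁻¹ : GL (Fin N) ℂ) : Matrix (Fin N) (Fin N) ℂ)ᵀ *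
            ((a : Matrix (Fin N) (Fin N) ℂ)ᵀ * J * a) * (a⁻¹ : GL (Fin N) ℂ) := by rw [ha.1]
      _ = (((a⁻¹ : GL (Fin N) ℂ) : Matrix (Fin N) (Fin N) ℂ)ᵀ *
            (a : Matrix (Fin N) (Fin N) ℂ)ᵀ) * J *
            ((a : Matrix (Fin N) (Fin N) ℂ) * (a⁻¹ : GL (Fin N) ℂ)) := by
          simp only [mul_assoc]
      _ = J := by rw [h1, h2, one_mul, mul_one]

/-- The symplectic group `Sp_{2n}(ℂ)` (its elements automatically have determinant `1`). -/
abbrev SpGroup (n : ℕ) : Subgroup (GL (Fin (2 * n)) ℂ) := specialIsometryGroup (altAntidiag (2 * n))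

/-- The special orthogonal group `SO_{2n+1}(ℂ)`. -/
abbrev SOOddGroup (n : ℕ) : Subgroup (GL (Fin (2 * n + 1)) ℂ) :=
  specialIsometryGroup (altAntidiag (2 * n + 1))

/-- The special orthogonal group `SO_{2n}(ℂ)`. -/
abbrev SOEvenGroup (n : ℕ) : Subgroup (GL (Fin (2 * n)) ℂ) := specialIsometryGroup (antidiag (2 * n))

/-- The permutation of the `2n` basis vectors which exchanges the two middle ones. -/
def middleSwap (n : ℕ) (i : Fin (2 * n)) : Fin (2 * n) :=
  if (i : ℕ) + 1 = n ∨ (i : ℕ) = n then i.rev else i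

theorem middleSwap_involutive (n : ℕ) : Function.Involutive (middleSwap n) := by
  intro i
  unfold middleSwap
  ext
  have := i.2
  split_ifs <;> simp [Fin.val_rev] at * <;> omega

theorem middleSwap_rev (n : ℕ) (i : Fin (2 * n)) : middleSwap n i.rev = (middleSwap n i).rev := by
  unfold middleSwap
  have := i.2
  ext
  split_ifs <;> simp [Fin.val_rev] at * <;> omega

/-- The permutation matrix of `middleSwap`. It lies in `O_{2n}(ℂ)`, and (for `n ≥ 1`) not in
`SO_{2n}(ℂ)`; conjugation by it is the involution of `SO_{2n}(ℂ)` that preserves the standard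
pinning and exchanges the last two simple roots. -/
def reflMatrix (n : ℕ) : Matrix (Fin (2 * n)) (Fin (2 * n)) ℂ :=
  Matrix.of fun i j => if j = middleSwap n i then 1 else 0

theorem reflMatrix_mul_self (n : ℕ) : reflMatrix n * reflMatrix n = 1 := by
  ext i j
  rw [Matrix.mul_apply, Finset.sum_eq_single (middleSwap n i)]
  · simp [reflMatrix, Matrix.one_apply, middleSwap_involutive n i, eq_comm]
  · intro l _ hl
    simp [reflMatrix, hl]
  · simp

theorem reflMatrix_transpose (n : ℕ) : (reflMatrix n)ᵀ = reflMatrix n := by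
  ext i j
  have : i = middleSwap n j ↔ j = middleSwap n i :=
    ⟨fun h => by rw [h, middleSwap_involutive], fun h => by rw [h, middleSwap_involutive]⟩
  simp [reflMatrix, this]

theorem reflMatrix_antidiag (n : ℕ) :
    reflMatrix n * antidiag (2 * n) = antidiag (2 * n) * reflMatrix n := by
  ext i j
  rw [Matrix.mul_apply, Finset.sum_eq_single (middleSwap n i), Matrix.mul_apply,
    Finset.sum_eq_single i.rev]
  · simp [reflMatrix, antidiag, middleSwap_rev]
  · intro l _ hl
    simp [antidiag, hl]
  · simp
  · intro l _ hl
    simp [reflMatrix, hl]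
  · simp

/-- `reflMatrix` as an element of `GL_{2n}(ℂ)`. -/
def refl (n : ℕ) : GL (Fin (2 * n)) ℂ :=
  ⟨reflMatrix n, reflMatrix n, reflMatrix_mul_self n, reflMatrix_mul_self n⟩

theorem refl_mul_self (n : ℕ) : refl n * refl n = 1 := Units.ext (reflMatrix_mul_self n)

theorem refl_conj_mem (n : ℕ) {g : GL (Fin (2 * n)) ℂ} (hg : g ∈ SOEvenGroup n) :
    refl n * g * refl n ∈ SOEvenGroup n := by
  refine ⟨?_, ?_⟩
  · show (reflMatrix n * (g : Matrix _ _ ℂ) * reflMatrix n)ᵀ * antidiag (2 * n) *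
      (reflMatrix n * (g : Matrix _ _ ℂ) * reflMatrix n) = antidiag (2 * n)
    have h1 : reflMatrix n * antidiag (2 * n) * reflMatrix n = antidiag (2 * n) := by
      rw [reflMatrix_antidiag, mul_assoc, reflMatrix_mul_self, mul_one]
    calc _ = reflMatrix n * ((g : Matrix _ _ ℂ)ᵀ *
          (reflMatrix n * antidiag (2 * n) * reflMatrix n) * (g : Matrix _ _ ℂ)) *
          reflMatrix n := by
          simp only [Matrix.transpose_mul, reflMatrix_transpose, mul_assoc]
      _ = _ := by rw [h1, hg.1, h1]
  · have h := congrArg Matrix.GeneralLinearGroup.det (refl_mul_self n)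
    rw [map_mul, map_one] at h
    rw [map_mul, map_mul, hg.2, mul_one, h]

/-- The pinned outer involution of `SO_{2n}(ℂ)`: conjugation by `refl n`. -/
def soInvolution (n : ℕ) : MulAut (SOEvenGroup n) where
  toFun g := ⟨refl n * g * refl n, refl_conj_mem n g.2⟩
  invFun g := ⟨refl n * g * refl n, refl_conj_mem n g.2⟩
  left_inv g := by
    ext1
    show refl n * (refl n * g * refl n) * refl n = _
    calc _ = (refl n * refl n) * g * (refl n * refl n) := by simp only [mul_assoc]
      _ = _ := by rw [refl_mul_self, one_mul, mul_one]
  right_inv g := by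
    ext1
    show refl n * (refl n * g * refl n) * refl n = _
    calc _ = (refl n * refl n) * g * (refl n * refl n) := by simp only [mul_assoc]
      _ = _ := by rw [refl_mul_self, one_mul, mul_one]
  map_mul' a b := by
    ext1
    show refl n * (a * b) * refl n = (refl n * a * refl n) * (refl n * b * refl n)
    calc _ = refl n * a * 1 * b * refl n := by simp only [mul_assoc, one_mul]
      _ = _ := by rw [← refl_mul_self n]; simp only [mul_assoc]

theorem soInvolution_mul_self (n : ℕ) : soInvolution n * soInvolution n = 1 := by
  ext1 g
  exact (soInvolution n).left_inv g

theorem altAntidiag_mul_transpose (N : ℕ) : altAntidiag N * (altAntidiag N)ᵀ = 1 := by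
  ext i j
  simp only [altAntidiag, Matrix.mul_apply, Matrix.transpose_apply, Matrix.of_apply,
    Matrix.one_apply, ite_mul, zero_mul, Finset.sum_ite_eq', Finset.mem_univ, if_true,
    Fin.rev_inj, mul_ite, mul_zero]
  by_cases h : i = j
  · subst h
    simp [← mul_pow]
  · have h' : j ≠ i := fun e => h e.symm
    simp [h, h']

theorem altAntidiag_mul_self (N : ℕ) :
    altAntidiag N * altAntidiag N = ((-1 : ℂ) ^ (N - 1)) • (1 : Matrix (Fin N) (Fin N) ℂ) := by
  ext i j
  rw [Matrix.mul_apply, Finset.sum_eq_single i.rev]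
  · by_cases h : i = j
    · subst h
      simp only [altAntidiag, Matrix.of_apply, if_true, Fin.rev_rev, ← pow_add, Matrix.smul_apply,
        Matrix.one_apply, smul_eq_mul, mul_one]
      congr 1
      have := i.2
      rw [Fin.val_rev]
      omega
    · have h' : j ≠ i := fun e => h e.symm
      simp [altAntidiag, h, h']
  · intro l _ hl
    simp [altAntidiag, hl]
  · simp

/-- `altAntidiag` as an element of `GL_N(ℂ)`. -/
def altGL (N : ℕ) : GL (Fin N) ℂ :=
  ⟨altAntidiag N, (altAntidiag N)ᵀ, altAntidiag_mul_transpose N,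
    mul_eq_one_comm.mp (altAntidiag_mul_transpose N)⟩

/-- The inverse transpose. -/
def invTranspose (N : ℕ) (g : GL (Fin N) ℂ) : GL (Fin N) ℂ :=
  ⟨((g⁻¹ : GL (Fin N) ℂ) : Matrix (Fin N) (Fin N) ℂ)ᵀ, (g : Matrix (Fin N) (Fin N) ℂ)ᵀ,
    by rw [← Matrix.transpose_mul, ← Units.val_mul, mul_inv_cancel, Units.val_one,
      Matrix.transpose_one],
    by rw [← Matrix.transpose_mul, ← Units.val_mul, inv_mul_cancel, Units.val_one,
      Matrix.transpose_one]⟩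

theorem invTranspose_mul (N : ℕ) (g h : GL (Fin N) ℂ) :
    invTranspose N (g * h) = invTranspose N g * invTranspose N h := by
  ext1
  show (((g * h)⁻¹ : GL (Fin N) ℂ) : Matrix (Fin N) (Fin N) ℂ)ᵀ = _ * _
  rw [mul_inv_rev, Units.val_mul, Matrix.transpose_mul]
  rfl

theorem invTranspose_invTranspose (N : ℕ) (g : GL (Fin N) ℂ) :
    invTranspose N (invTranspose N g) = g := by
  ext1
  show (((invTranspose N g)⁻¹ : GL (Fin N) ℂ) : Matrix (Fin N) (Fin N) ℂ)ᵀ = _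
  exact Matrix.transpose_transpose _

theorem invTranspose_altGL (N : ℕ) : invTranspose N (altGL N) = altGL N := by
  ext1
  exact Matrix.transpose_transpose _

/-- The involution `g ↦ J ᵗg⁻¹ J⁻¹` of `GL_N(ℂ)`. -/
def glInvolutionFun (N : ℕ) (g : GL (Fin N) ℂ) : GL (Fin N) ℂ :=
  altGL N * invTranspose N g * (altGL N)⁻¹

theorem invTranspose_inv (N : ℕ) (g : GL (Fin N) ℂ) :
    invTranspose N g⁻¹ = (invTranspose N g)⁻¹ := by
  rw [eq_inv_iff_mul_eq_one, ← invTranspose_mul, inv_mul_cancel]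
  ext1
  show (((1 : GL (Fin N) ℂ)⁻¹ : GL (Fin N) ℂ) : Matrix (Fin N) (Fin N) ℂ)ᵀ = 1
  simp

theorem glInvolutionFun_involutive (N : ℕ) : Function.Involutive (glInvolutionFun N) := by
  intro g
  unfold glInvolutionFun
  rw [invTranspose_mul, invTranspose_mul, invTranspose_invTranspose, invTranspose_inv,
    invTranspose_altGL]
  have hc : ∀ h : GL (Fin N) ℂ, altGL N * altGL N * h = h * (altGL N * altGL N) := by
    intro h
    ext1
    show altAntidiag N * altAntidiag N * (h : Matrix (Fin N) (Fin N) ℂ) =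
      (h : Matrix (Fin N) (Fin N) ℂ) * (altAntidiag N * altAntidiag N)
    rw [altAntidiag_mul_self]
    simp
  calc _ = (altGL N * altGL N * g) * (altGL N * altGL N)⁻¹ := by
        rw [mul_inv_rev]; simp only [mul_assoc]
    _ = g := by rw [hc, mul_inv_cancel_right]

/-- The involution `g ↦ J ᵗg⁻¹ J⁻¹` of `GL_N(ℂ)`, where `J = altAntidiag N`. It preserves the
standard pinning, and acts nontrivially on the root system. -/
def glInvolution (N : ℕ) : MulAut (GL (Fin N) ℂ) where
  toFun := glInvolutionFun N
  invFun := glInvolutionFun N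
  left_inv := glInvolutionFun_involutive N
  right_inv := glInvolutionFun_involutive N
  map_mul' a b := by
    simp only [glInvolutionFun, invTranspose_mul]
    group

theorem glInvolution_mul_self (N : ℕ) : glInvolution N * glInvolution N = 1 := by
  ext1 g
  exact (glInvolution N).left_inv g

end MatrixGroups

/-! ### L-groups of the connected classical groups -/

section LGroups

universe u v

/-- If any two nontrivial elements of `G` have product `1` (so `G` has order at most `2`), an
involution `θ` defines a homomorphism sending every nontrivial element to `θ`. -/
def homOfInvolution {G A : Type*} [Group G] [Group A]
    (hG : ∀ a b : G, a ≠ 1 → b ≠ 1 → a * b = 1) (θ : A) (hθ : θ * θ = 1) : G →* A :=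
  open Classical in
  { toFun := fun g => if g = 1 then 1 else θ
    map_one' := if_pos rfl
    map_mul' := fun a b => by
      by_cases ha : a = 1
      · rw [if_pos ha, one_mul]
        subst ha
        rw [one_mul]
      · by_cases hb : b = 1
        · rw [if_pos hb, mul_one]
          subst hb
          rw [mul_one]
        · rw [if_neg ha, if_neg hb, if_pos (hG a b ha hb), hθ] }

theorem homOfInvolution_of_ne {G A : Type*} [Group G] [Group A]
    (hG : ∀ a b : G, a ≠ 1 → b ≠ 1 → a * b = 1) (θ : A) (hθ : θ * θ = 1) {g : G} (hg : g ≠ 1) :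
    homOfInvolution hG θ hθ g = θ := if_neg hg

variable {k : Type u} [Field k] (σ : k ≃+* k) (Ω : Type v) [Field Ω] [Algebra k Ω]

/-- For a semi-direct product `D ⋊ Gal(K/k₀)`, the subgroup `D ⋊ Gal(K/K ∩ k)`. -/
def overBase {σ : k ≃+* k} {Ω : Type v} [Field Ω] [Algebra k Ω] {D : Type} [Group D]
    (K : IntermediateField (fixedField σ) Ω) (act : (K ≃ₐ[fixedField σ] K) →* MulAut D) :
    Subgroup (D ⋊[act] (K ≃ₐ[fixedField σ] K)) where
  carrier := {x | ∀ y : K, (y : Ω) ∈ (algebraMap k Ω).range → x.right y = y}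
  mul_mem' {a b} ha hb y hy := by
    show a.right (b.right y) = y
    rw [hb y hy, ha y hy]
  one_mem' _ _ := rfl
  inv_mem' {a} ha y hy := by
    show a.right.symm y = y
    rw [AlgEquiv.symm_apply_eq, ha y hy]

/-- The L-group `dual ⋊ Gal(K/k₀)` of a classical group over `k₀`, together with the inclusion
of the complex dual group `dual` in `GL_N(ℂ)` and the standard representation `std`, on
`M = ℂ^N`, of the inverse image of the Galois group over `k`. -/
structure LGroupData where
  N : ℕ
  dual : Type
  [grp : Group dual]
  incl : dual →* GL (Fin N) ℂ
  K : IntermediateField (fixedField σ) Ω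
  [normal : Normal (fixedField σ) K]
  act : (K ≃ₐ[fixedField σ] K) →* MulAut dual
  std : overBase K act →* GL (Fin N) ℂ

attribute [instance] LGroupData.grp LGroupData.normal

/-- The L-group itself. -/
abbrev LGroupData.LG {σ : k ≃+* k} {Ω : Type v} [Field Ω] [Algebra k Ω]
    (L : LGroupData σ Ω) : Type v :=
  L.dual ⋊[L.act] (L.K ≃ₐ[fixedField σ] L.K)

/-- The L-group of a split group whose dual group is the subgroup `D` of `GL_N(ℂ)`: here `K = k₀`,
so the L-group is `D`. -/
def splitLGroup {N : ℕ} (D : Subgroup (GL (Fin N) ℂ)) : LGroupData σ Ω where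
  N := N
  dual := D
  incl := D.subtype
  K := ⊥
  act := 1
  std :=
    { toFun := fun x => x.1.left
      map_one' := rfl
      map_mul' := fun _ _ => rfl }

/-- The L-group of `SO(V)`, `dim V = 2n + 1`. -/
abbrev lgroupSOOdd (n : ℕ) : LGroupData σ Ω := splitLGroup σ Ω (SpGroup n)

/-- The L-group of `Sp(V)`, `dim V = 2n`. -/
abbrev lgroupSp (n : ℕ) : LGroupData σ Ω := splitLGroup σ Ω (SOOddGroup n)

variable {σ}

/-- The field `k₀(√d)`. -/
def sqrtField (d : fixedField σ) : IntermediateField (fixedField σ) Ω :=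
  IntermediateField.adjoin (fixedField σ) {x : Ω | x ^ 2 = algebraMap k Ω d}

open Polynomial in
instance sqrtField_normal (d : fixedField σ) : Normal (fixedField σ) (sqrtField Ω d) := by
  by_cases hex : ∃ x : Ω, x ^ 2 = algebraMap k Ω d
  · obtain ⟨x, hx⟩ := hex
    have hd : algebraMap (fixedField σ) Ω d = x ^ 2 := hx.symm
    have hfac : ((X ^ 2 - C d : (fixedField σ)[X]).map (algebraMap (fixedField σ) Ω)) =
        (X - C x) * (X - C (-x)) := by
      simp only [Polynomial.map_sub, Polynomial.map_pow, map_X, map_C, hd, map_neg, map_pow]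
      ring
    have hsplit : ((X ^ 2 - C d : (fixedField σ)[X]).map (algebraMap (fixedField σ) Ω)).Splits := by
      rw [hfac]
      exact (Splits.X_sub_C _).mul (Splits.X_sub_C _)
    have hne : (X ^ 2 - C d : (fixedField σ)[X]) ≠ 0 := X_pow_sub_C_ne_zero (by norm_num) d
    have hset : {x : Ω | x ^ 2 = algebraMap k Ω d} =
        (X ^ 2 - C d : (fixedField σ)[X]).rootSet Ω := by
      ext y
      rw [mem_rootSet_of_ne hne]
      simp only [Set.mem_ofPred_eq, map_sub, map_pow, aeval_X, aeval_C, sub_eq_zero]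
      rfl
    have := IntermediateField.adjoin_rootSet_isSplittingField hsplit
    unfold sqrtField
    rw [hset]
    exact Normal.of_isSplittingField (X ^ 2 - C d : (fixedField σ)[X])
  · have hset : {x : Ω | x ^ 2 = algebraMap k Ω d} = ∅ :=
      Set.eq_empty_of_forall_notMem fun x hx => hex ⟨x, hx⟩
    unfold sqrtField
    rw [hset, IntermediateField.adjoin_empty]
    infer_instance

theorem sqrtField_ext (d : fixedField σ) (a : sqrtField Ω d ≃ₐ[fixedField σ] sqrtField Ω d)
    (ha : ∀ r : sqrtField Ω d, (r : Ω) ^ 2 = algebraMap k Ω d → a r = r) : a = 1 := by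
  have h : (a : sqrtField Ω d →ₐ[fixedField σ] sqrtField Ω d) = AlgHom.id _ _ :=
    IntermediateField.algHom_ext_of_eq_adjoin _ (S := sqrtField Ω d)
      (s := {x : Ω | x ^ 2 = algebraMap k Ω d}) rfl fun x hx => ha _ hx
  ext1 x
  exact DFunLike.congr_fun h x

theorem sqrtField_gal (d : fixedField σ)
    (a b : sqrtField Ω d ≃ₐ[fixedField σ] sqrtField Ω d) (ha : a ≠ 1) (hb : b ≠ 1) :
    a * b = 1 := by
  have hd : ∀ r : sqrtField Ω d, (r : Ω) ^ 2 = algebraMap k Ω d ↔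
      r ^ 2 = algebraMap (fixedField σ) (sqrtField Ω d) d := fun r => by
    rw [← SetLike.coe_eq_coe]
    rfl
  have key : ∀ a : sqrtField Ω d ≃ₐ[fixedField σ] sqrtField Ω d, a ≠ 1 →
      ∀ r : sqrtField Ω d, (r : Ω) ^ 2 = algebraMap k Ω d → a r = -r := by
    intro a ha r hr
    have hsq : (a r) ^ 2 = r ^ 2 := by
      rw [← map_pow, (hd r).mp hr, a.commutes]
    rcases sq_eq_sq_iff_eq_or_eq_neg.mp hsq with h | h
    · exfalso
      apply ha
      refine sqrtField_ext Ω d a fun t ht => ?_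
      have hrt : t ^ 2 = r ^ 2 := by rw [(hd r).mp hr, (hd t).mp ht]
      rcases sq_eq_sq_iff_eq_or_eq_neg.mp hrt with rfl | rfl
      · exact h
      · rw [map_neg, h]
    · exact h
  refine sqrtField_ext Ω d _ fun r hr => ?_
  rw [AlgEquiv.mul_apply, key b hb r hr, map_neg, key a ha r hr, neg_neg]

/-- The L-group of `SO(V)`, `dim V = 2n`, `disc V = d`: the semi-direct product of `SO_{2n}(ℂ)` and
`Gal(K/k₀)`, `K = k₀(√d)`. It maps to `O_{2n}(ℂ)` by sending the nontrivial element of `Gal(K/k₀)`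
to `refl n`; this is an isomorphism if `d` is not a square and `n ≥ 1`. -/
def lgroupSOEven (n : ℕ) (d : fixedField σ) : LGroupData σ Ω where
  N := 2 * n
  dual := SOEvenGroup n
  incl := (SOEvenGroup n).subtype
  K := sqrtField Ω d
  act := homOfInvolution (sqrtField_gal Ω d) (soInvolution n) (soInvolution_mul_self n)
  std :=
    { toFun := fun x =>
        x.1.left * homOfInvolution (sqrtField_gal Ω d) (refl n) (refl_mul_self n) x.1.right
      map_one' := by simp
      map_mul' := fun x y => by
        show ((x.1.left * (homOfInvolution (sqrtField_gal Ω d) (soInvolution n)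
            (soInvolution_mul_self n) x.1.right) y.1.left : SOEvenGroup n) : GL (Fin (2 * n)) ℂ) *
          homOfInvolution (sqrtField_gal Ω d) (refl n) (refl_mul_self n)
            (x.1.right * y.1.right) = _
        rw [map_mul]
        by_cases h : x.1.right = 1
        · rw [h, map_one, map_one]
          simp [mul_assoc]
        · rw [homOfInvolution_of_ne _ _ _ h, homOfInvolution_of_ne _ _ _ h]
          show (x.1.left : GL (Fin (2 * n)) ℂ) * (refl n * y.1.left * refl n) * (refl n * _) = _
          calc _ = (x.1.left : GL (Fin (2 * n)) ℂ) * refl n * y.1.left * (refl n * refl n) *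
                homOfInvolution (sqrtField_gal Ω d) (refl n) (refl_mul_self n) y.1.right := by
                simp only [mul_assoc]
            _ = _ := by rw [refl_mul_self]; simp only [mul_assoc, one_mul] }

variable (σ) in
/-- The field `k`, as an extension of `k₀` inside `Ω`. -/
def baseField : IntermediateField (fixedField σ) Ω :=
  (IsScalarTower.toAlgHom (fixedField σ) k Ω).fieldRange

open Polynomial in
theorem baseField_normal (hσ : ∀ x, σ (σ x) = x) : Normal (fixedField σ) (baseField σ Ω) := by
  have hk : Normal (fixedField σ) k := by
    rw [normal_iff]
    intro x
    let t : fixedField σ := ⟨x + σ x, by rw [mem_fixedField, map_add, hσ, add_comm]⟩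
    let m : fixedField σ := ⟨x * σ x, by rw [mem_fixedField, map_mul, hσ, mul_comm]⟩
    let p : (fixedField σ)[X] := X ^ 2 - C t * X + C m
    have hp : p.Monic := by
      show (X ^ 2 - C t * X + C m).Monic
      monicity!
    have hfac : p.map (algebraMap (fixedField σ) k) = (X - C x) * (X - C (σ x)) := by
      have ht : algebraMap (fixedField σ) k t = x + σ x := rfl
      have hm : algebraMap (fixedField σ) k m = x * σ x := rfl
      simp only [p, Polynomial.map_sub, Polynomial.map_add, Polynomial.map_mul,
        Polynomial.map_pow, map_X, map_C, ht, hm, map_add, map_mul]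
      ring
    have hroot : aeval x p = 0 := by
      rw [aeval_def, ← eval_map, hfac]
      simp
    refine ⟨⟨p, hp, hroot⟩, ?_⟩
    have hsplit : (p.map (algebraMap (fixedField σ) k)).Splits := by
      rw [hfac]
      exact (Splits.X_sub_C _).mul (Splits.X_sub_C _)
    refine hsplit.of_dvd (hp.map _).ne_zero ?_
    exact Polynomial.map_dvd _ (minpoly.dvd _ _ hroot)
  exact Normal.of_algEquiv
    (AlgEquiv.ofInjectiveField (IsScalarTower.toAlgHom (fixedField σ) k Ω))

theorem baseField_gal (hσ : ∀ x, σ (σ x) = x)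
    (a b : baseField σ Ω ≃ₐ[fixedField σ] baseField σ Ω) (ha : a ≠ 1) (hb : b ≠ 1) :
    a * b = 1 := by
  let f : k → baseField σ Ω := fun x => ⟨algebraMap k Ω x, x, rfl⟩
  have hf : ∀ z : baseField σ Ω, ∃ x, f x = z := fun z => by
    obtain ⟨x, hx⟩ := z.2
    exact ⟨x, Subtype.ext hx⟩
  have fadd : ∀ x y, f (x + y) = f x + f y := fun x y => Subtype.ext (map_add _ _ _)
  have fmul : ∀ x y, f (x * y) = f x * f y := fun x y => Subtype.ext (map_mul _ _ _)
  have hfix : ∀ (c : baseField σ Ω ≃ₐ[fixedField σ] baseField σ Ω) (y : k), σ y = y →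
      c (f y) = f y := fun c y hy => c.commutes ⟨y, hy⟩
  have hor : ∀ (c : baseField σ Ω ≃ₐ[fixedField σ] baseField σ Ω) (x : k),
      c (f x) = f x ∨ c (f x) = f (σ x) := by
    intro c x
    have h1 := hfix c (x + σ x) (by rw [map_add, hσ, add_comm])
    have h2 := hfix c (x * σ x) (by rw [map_mul, hσ, mul_comm])
    rw [fadd, map_add] at h1
    rw [fmul, map_mul] at h2
    have h3 : (c (f x) - f x) * (c (f x) - f (σ x)) = 0 := by
      linear_combination c (f x) * h1 - h2
    rcases mul_eq_zero.mp h3 with h | h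
    · exact Or.inl (sub_eq_zero.mp h)
    · exact Or.inr (sub_eq_zero.mp h)
  have key : ∀ c : baseField σ Ω ≃ₐ[fixedField σ] baseField σ Ω, c ≠ 1 →
      ∀ x, c (f x) = f (σ x) := by
    intro c hc x
    by_contra hx
    apply hc
    have hx1 : c (f x) = f x := (hor c x).resolve_right hx
    ext1 z
    obtain ⟨y, rfl⟩ := hf z
    rcases hor c y with hy | hy
    · exact hy
    · rcases hor c (x + y) with hxy | hxy
      · rw [fadd, map_add, hx1] at hxy
        exact add_left_cancel hxy
      · rw [map_add, fadd, fadd, map_add, hx1, hy] at hxy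
        exact absurd (hx1.trans (add_right_cancel hxy)) hx
  ext1 z
  obtain ⟨x, rfl⟩ := hf z
  rw [AlgEquiv.mul_apply, key b hb, key a ha, hσ]
  rfl

/-- The L-group `GL_n(ℂ) ⋊ Gal(k/k₀)` of `U(V)`, `dim V = n`. -/
def lgroupU (hσ : ∀ x, σ (σ x) = x) (n : ℕ) : LGroupData σ Ω where
  N := n
  dual := GL (Fin n) ℂ
  incl := MonoidHom.id _
  K := baseField σ Ω
  normal := baseField_normal Ω hσ
  act := homOfInvolution (baseField_gal Ω hσ) (glInvolution n) (glInvolution_mul_self n)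
  std :=
    { toFun := fun x => x.1.left
      map_one' := rfl
      map_mul' := fun x y => by
        have h : x.1.right = 1 := by
          ext1 z
          obtain ⟨t, ht⟩ := z.2
          exact x.2 z ⟨t, ht⟩
        show x.1.left * _ = _
        rw [h, map_one]
        rfl }

end LGroups

/-! ### Langlands parameters -/

section Parameters

universe u v

variable {k : Type u} [NontriviallyNormedField k] {κ : LocalKind} {σ : k ≃+* k}
  {Ω : Type v} [Field Ω] [Algebra k Ω]

/-- An element of the L-group is semisimple if one of its powers is a semisimple element of the
dual group. (In characteristic `0` an element of a linear algebraic group is semisimple as soon as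
one of its nontrivial powers is, and the Galois group is finite.) -/
def LGroupData.IsSemisimple (L : LGroupData σ Ω) (x : L.LG) : Prop :=
  ∃ m : ℕ, 0 < m ∧ (x ^ m).right = 1 ∧
    Module.End.IsSemisimple
      (Matrix.toLin' (L.incl (x ^ m).left : Matrix (Fin L.N) (Fin L.N) ℂ))

/-- The conditions on a homomorphism `WD(k₀) → LG` to be a Langlands parameter, apart from its
compatibility with the projections to the Galois group.

In the archimedean case: continuous (equivalently, continuous on the open subgroup `Ωˣ`), with
semisimple image. In the nonarchimedean case: trivial on an open subgroup of the inertia group,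
with semisimple Frobenius, and algebraic on `SL₂(ℂ)`. -/
def IsAdmissible (L : LGroupData σ Ω) : (κ : LocalKind) → (WD₀ σ Ω κ →* L.LG) → Prop
  | .archimedean, φ =>
      (∀ i j, @Continuous Ωˣ ℂ (unitsTopology k Ω) _
        fun z => (L.incl (φ (ofUnit σ Ω z)).left : Matrix (Fin L.N) (Fin L.N) ℂ) i j) ∧
      ∀ w, L.IsSemisimple (φ w)
  | .nonarchimedean, φ =>
      (∃ U : Subgroup (AbsGal σ Ω), IsOpen (U : Set (AbsGal σ Ω)) ∧
        ∀ w : nonarchWeil σ Ω, (w : AbsGal σ Ω) ∈ inertia σ Ω → (w : AbsGal σ Ω) ∈ U →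
          φ (ofWeil σ Ω w) = 1) ∧
      (∀ w : nonarchWeil σ Ω, (w : AbsGal σ Ω) ∈ geomFrob₀ σ Ω →
        L.IsSemisimple (φ (ofWeil σ Ω w))) ∧
      (∀ i j, IsAlgebraicFun fun g =>
        (L.incl (φ (ofSL₂ σ Ω g)).left : Matrix (Fin L.N) (Fin L.N) ℂ) i j)

variable (κ) in
/-- Langlands parameters `φ : WD(k₀) → LG`. -/
structure LParam (L : LGroupData σ Ω) where
  toHom : WD₀ σ Ω κ →* L.LG
  admissible : IsAdmissible L κ toHom
  right_eq : ∀ w, (toHom w).right = AlgEquiv.restrictNormalHom L.K (WD₀.toGal σ Ω κ w)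

variable {L : LGroupData σ Ω}

/-- Equivalence of parameters: conjugacy under the dual group. -/
def LParam.Equivalent (φ φ' : LParam κ L) : Prop :=
  ∃ g : L.dual, ∀ w, φ'.toHom w = SemidirectProduct.inl g * φ.toHom w * (SemidirectProduct.inl g)⁻¹

/-- The group `C_φ`: the centralizer in the dual group of the image of `φ`. -/
def LParam.centralizer (φ : LParam κ L) : Subgroup L.dual :=
  (Subgroup.centralizer (Set.range φ.toHom)).comap SemidirectProduct.inl

theorem LParam.mem_overBase (φ : LParam κ L) (w : WD κ σ Ω) :
    φ.toHom w ∈ overBase L.K L.act := by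
  rintro y ⟨x, hx⟩
  apply Subtype.ext
  rw [φ.right_eq, AlgEquiv.restrictNormalHom_apply, ← hx]
  exact w.2 x

/-- The representation `M` of `WD(k)` determined by the parameter `φ`: the restriction of `φ` to
`WD(k)`, composed with the standard representation on `ℂ^N`. -/
def LParam.rep (φ : LParam κ L) : Representation ℂ (WD κ σ Ω) (Fin L.N → ℂ) :=
  ((Matrix.toLinAlgEquiv' : Matrix (Fin L.N) (Fin L.N) ℂ ≃ₐ[ℂ] _) :
      Matrix (Fin L.N) (Fin L.N) ℂ →* ((Fin L.N → ℂ) →ₗ[ℂ] (Fin L.N → ℂ))).comp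
    ((Units.coeHom _).comp
      (L.std.comp ((φ.toHom.comp (WD κ σ Ω).subtype).codRestrict _ φ.mem_overBase)))

/-- The group `C_φ` is identified with the subgroup `C` of `GL(M)` by an isomorphism which is
induced by a linear isomorphism of `ℂ^N` with `M` (in particular, it is an isomorphism of
algebraic groups). -/
def CentralizerIso {M : Type*} [AddCommGroup M] [Module ℂ M] (φ : LParam κ L)
    (C : Subgroup (M ≃ₗ[ℂ] M)) : Prop :=
  ∃ (T : (Fin L.N → ℂ) ≃ₗ[ℂ] M) (e : φ.centralizer ≃* C), ∀ (c : φ.centralizer) (x : Fin L.N → ℂ),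
    (e c : M ≃ₗ[ℂ] M) (T x) = T ((L.incl c : Matrix (Fin L.N) (Fin L.N) ℂ) *ᵥ x)

end Parameters

/-! ### Discriminants -/

section Discriminant

variable {k : Type*} [Field k] {σ : k ≃+* k} {V : Type*} [AddCommGroup V] [Module k V]

/-- `d` represents the discriminant `(-1)^n det V` in `kˣ/kˣ²` of the form `h` on the space `V` of
dimension `2n`. -/
def IsDiscriminant (h : V →ₗ[k] V →ₛₗ[(σ : k →+* k)] k) (n : ℕ) (d : k) : Prop :=
  ∃ b : Module.Basis (Fin (2 * n)) k V, d = (-1) ^ n * (Matrix.of fun i j => h (b i) (b j)).det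

variable (Ω : Type*) [Field Ω] [Algebra k Ω]

open Classical in
/-- The quadratic character of `Gal(Ω/k₀)` attached to `d`: the value at `g` is `g(√d)/√d = ±1`. -/
def discChar (d : k) (g : AbsGal σ Ω) : ℂ :=
  if ∀ x : Ω, x ^ 2 = algebraMap k Ω d → g x = x then 1 else -1

end Discriminant

end ClassicalPar

end

namespace ClassicalPar

open Module Polynomial

/-! ### Forms, their isometries, and determinants of isometries over ℂ -/

section LinearAlgebra

variable {M : Type*} [AddCommGroup M] [Module ℂ M]

/-! A parameter is turned into linear algebra by realising the dual group inside GL_N(ℂ) together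
with the structure that it preserves. For `Sp(V)` and `SO(V)` the involution is trivial, `WD(k) =
WD(k₀)`, and the L-group maps to the isometries of a standard form `J`. A parameter is then a
representation by isometries of `J` whose determinant is prescribed by the Galois component. For
`U(V)` write `φ(s) = (g_s, γ)` with `γ ≠ 1`. As `γ` acts by `g ↦ J ᵗg⁻¹ J⁻¹`, the matrix `(g_s J)⁻¹`
is the Gram matrix of a conjugate-duality: multiplicativity of `φ` at `s τ s⁻¹` is its invariance,
and multiplicativity at `s²` is its symmetry, with the sign coming from the scalar `J²`. Conversely,
a conjugate-duality prescribes the value at `s` by which the representation extends from the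
index-two subgroup `WD(k)` to `WD(k₀)`.

The pivot is `exists_isometry`. Two invariant non-degenerate forms of the same type differ by an
invertible operator `S`, self-adjoint and commuting with the action. Since `S` has a square root
that is a polynomial in `S` (`exists_aeval_mul_self`), this root is an equivariant isometry. Hence
an isomorphism of representations can always be chosen isometric, the centralizer can be computed
with any form, and isomorphism of the representations means conjugacy of the parameters under the
whole isometry group of `J`, respectively under GL_N(ℂ) in the unitary case.

What remains is the gap between isometries and isometries of determinant 1. It is empty for
symplectic forms; in odd dimension `-1` closes it. In even orthogonal dimension everything depends
on whether some isometry of determinant -1 commutes with the representation. By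
`exists_det_isometry` the determinant of an isometry is `(-1) ^ dim E`, where `E` is its generalized
eigenspace for -1, on which the form is non-degenerate. An equivariant isometry of determinant -1
therefore produces a stable non-degenerate subspace of odd dimension, inside which an
odd-dimensional irreducible orthogonal summand is found by splitting off even pieces. Conversely
such a summand gives a reflection. This is `not_orthogonalSummandsEven_iff`; it requires complete
reducibility.

The analytic conditions on `φ` and on its representation must also be matched, although one concerns
`WD(k₀)` and the other `WD(k)`. The comparison rests on the fact that an invertible operator over ℂ
is semisimple as soon as a positive power is. In the archimedean case `Ωˣ` is a commutative normal
subgroup of finite index. In the nonarchimedean case inertia has finite image, so Weil elements that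
agree modulo inertia have a common power in the image, and a Frobenius of `k` agrees modulo inertia
with a power of a Frobenius of `k₀`. Complete reducibility for σ = 1 comes from semisimplicity of
Frobenius, Weyl's unitary trick for SL₂(ℂ), and averaging over a finite quotient. -/

theorem dvd_pow_of_roots {p f : ℂ[X]} (hp : p.Monic) (h : ∀ z ∈ p.roots, f.eval z = 0) :
    p ∣ f ^ (Multiset.card p.roots) := by
  have hs : p = (p.roots.map fun a => X - C a).prod := by
    have := (IsAlgClosed.splits p).eq_prod_roots
    rwa [hp.leadingCoeff, map_one, one_mul] at this
  conv_lhs => rw [hs]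
  rw [← Multiset.prod_replicate, ← Multiset.map_const']
  exact Multiset.prod_dvd_prod_of_dvd _ _ fun z hz => dvd_iff_isRoot.mpr (h z hz)

/-- An invertible endomorphism has a square root that is a polynomial in it. -/
theorem exists_aeval_mul_self [FiniteDimensional ℂ M] (S : End ℂ M) (hS : IsUnit S) :
    ∃ p : ℂ[X], aeval S p * aeval S p = S := by
  classical
  set μ := minpoly ℂ S with hμdef
  have hint : IsIntegral ℂ S := Algebra.IsIntegral.isIntegral S
  have hμ : μ.Monic := minpoly.monic hint
  have hμ0 : ¬ μ.IsRoot 0 := by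
    intro h
    have hev := Module.End.hasEigenvalue_of_isRoot h
    obtain ⟨v, hv, hv0⟩ := hev.exists_hasEigenvector
    rw [Module.End.mem_eigenspace_iff, zero_smul] at hv
    exact hv0 (((Module.End.isUnit_iff S).mp hS).injective (by rw [hv, map_zero]))
  choose r hr using fun z : ℂ => IsAlgClosed.exists_pow_nat_eq z (n := 2) two_pos
  -- First approximation to the root: `q` takes at each eigenvalue a square root of it, so `q² - X`
  -- vanishes at the roots of `μ` and is nilpotent modulo `μ`.
  let q : ℂ[X] := Lagrange.interpolate μ.roots.toFinset id r
  have hq : ∀ z ∈ μ.roots, (q ^ 2 - X).eval z = 0 := by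
    intro z hz
    have : q.eval z = r z :=
      Lagrange.eval_interpolate_at_node (v := id) r (Set.injOn_id _) (Multiset.mem_toFinset.mpr hz)
    rw [eval_sub, eval_pow, this, eval_X, hr, sub_self]
  let R := AdjoinRoot μ
  have hnil : IsNilpotent (AdjoinRoot.mk μ (q ^ 2 - X)) :=
    ⟨_, by rw [← map_pow, AdjoinRoot.mk_eq_zero]; exact dvd_pow_of_roots hμ hq⟩
  have hX : IsUnit (AdjoinRoot.mk μ X) := by
    have hcop : IsCoprime μ X :=
      ((irreducible_X (R := ℂ)).coprime_iff_not_dvd.mpr fun h => hμ0 (by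
        rw [← dvd_iff_isRoot, C_0, sub_zero]; exact h)).symm
    obtain ⟨a, b, hab⟩ := hcop
    have := congrArg (AdjoinRoot.mk μ) hab
    rw [map_add, map_mul, map_mul, AdjoinRoot.mk_self, mul_zero, zero_add, map_one] at this
    exact IsUnit.of_mul_eq_one_right _ this
  have hx : IsUnit (AdjoinRoot.mk μ q) := by
    have h1 : AdjoinRoot.mk μ q ^ 2 = AdjoinRoot.mk μ X + AdjoinRoot.mk μ (q ^ 2 - X) := by
      rw [← map_pow, ← map_add]; congr 1; ring
    have h2 : IsUnit (AdjoinRoot.mk μ q ^ 2) := by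
      rw [h1, add_comm]
      exact IsNilpotent.isUnit_add_right_of_commute hnil hX (Commute.all _ _)
    exact (isUnit_pow_iff two_ne_zero).mp h2
  -- Newton's method for `Y² - X` in ℂ[X]/(μ), started at `q`: the error is nilpotent and the
  -- derivative `2q` is a unit, because `q²` differs from the unit `X` by a nilpotent.
  let P : (AdjoinRoot μ)[X] := X ^ 2 - C (AdjoinRoot.mk μ X)
  have hP : aeval (AdjoinRoot.mk μ q) P = AdjoinRoot.mk μ (q ^ 2 - X) := by
    simp [P]
  obtain ⟨y, ⟨-, hy⟩, -⟩ := existsUnique_nilpotent_sub_and_aeval_eq_zero (P := P)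
    (x := AdjoinRoot.mk μ q) (by rw [hP]; exact hnil) (by
      have h2 : IsUnit (2 : AdjoinRoot μ) := by
        rw [← map_ofNat (algebraMap ℂ (AdjoinRoot μ)) 2]
        exact (IsUnit.mk0 (2 : ℂ) two_ne_zero).map _
      simpa [P, derivative_X_pow, one_add_one_eq_two] using h2.mul hx)
  obtain ⟨p, rfl⟩ := AdjoinRoot.mk_surjective y
  refine ⟨p, ?_⟩
  have hd : μ ∣ p * p - X := by
    rw [← AdjoinRoot.mk_eq_zero, map_sub, map_mul, ← pow_two]
    simpa [P] using hy
  obtain ⟨c, hc⟩ := hd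
  have := congrArg (aeval S) hc
  rw [map_sub, map_mul, map_mul, aeval_X, hμdef, minpoly.aeval, zero_mul] at this
  exact sub_eq_zero.mp this

/-- A non-degenerate form identifies another bilinear form with an endomorphism. -/
theorem exists_end_of_form [FiniteDimensional ℂ M] (B B' : M →ₗ[ℂ] M →ₗ[ℂ] ℂ)
    (hB : B.Nondegenerate) : ∃ S : End ℂ M, ∀ m n, B' m n = B (S m) n := by
  have hinj : Function.Injective B := by
    rw [injective_iff_map_eq_zero]
    exact fun x hx => hB.1 x fun y => by rw [hx]; rfl
  let e : M ≃ₗ[ℂ] Dual ℂ M :=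
    LinearMap.linearEquivOfInjective B hinj Subspace.dual_finrank_eq.symm
  refine ⟨e.symm.toLinearMap ∘ₗ B', fun m n => ?_⟩
  have : e (e.symm (B' m)) = B' m := e.apply_symm_apply _
  exact (LinearMap.congr_fun this n).symm

/-- Two non-degenerate forms of the same sign, invariant under the same operators, are
isometric by an isometry commuting with these operators. -/
theorem exists_isometry [FiniteDimensional ℂ M] {ι : Type*} (B B' : M →ₗ[ℂ] M →ₗ[ℂ] ℂ)
    (hB : B.Nondegenerate) (hB' : B'.Nondegenerate) (f f' : ι → End ℂ M)
    (hf' : ∀ i, Function.Surjective (f' i)) (h : ∀ i m n, B (f i m) (f' i n) = B m n)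
    (h' : ∀ i m n, B' (f i m) (f' i n) = B' m n) (b : ℂ) (i₀ : ι)
    (hs : ∀ m n, B n m = b * B m (f i₀ n)) (hs' : ∀ m n, B' n m = b * B' m (f i₀ n)) :
    ∃ T : M ≃ₗ[ℂ] M, (∀ m n, B' m n = B (T m) (T n)) ∧ ∀ i m, T (f i m) = f i (T m) := by
  obtain ⟨S, hS⟩ := exists_end_of_form B B' hB
  -- Paired with `f' i n`, both `S (f i m)` and `f i (S m)` give `B' m n`; such vectors exhaust the
  -- space.
  have hcomm : ∀ i, Commute S (f i) := by
    intro i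
    refine LinearMap.ext fun m => sub_eq_zero.mp (hB.1 _ fun y => ?_)
    obtain ⟨n, rfl⟩ := hf' i y
    show B (S (f i m) - f i (S m)) _ = 0
    rw [map_sub, LinearMap.sub_apply, ← hS, h', h, hS, sub_self]
  -- Both forms are swapped by the same rule, with sign `b` and twist `f i₀`, which makes `S`
  -- self-adjoint.
  have hself : ∀ m n, B (S m) n = B m (S n) := by
    intro m n
    have hc : ∀ x, S (f i₀ x) = f i₀ (S x) := fun x => LinearMap.congr_fun (hcomm i₀) x
    calc B (S m) n = B' m n := (hS m n).symm
      _ = b * B' n (f i₀ m) := hs' n m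
      _ = b * B (S n) (f i₀ m) := by rw [hS]
      _ = B m (S n) := (hs _ _).symm
  have hSinj : Function.Injective S := by
    rw [injective_iff_map_eq_zero]
    exact fun x hx => hB'.1 x fun y => by rw [hS, hx, map_zero, LinearMap.zero_apply]
  have hSu : IsUnit S := (Module.End.isUnit_iff S).mpr
    ⟨hSinj, LinearMap.surjective_of_injective hSinj⟩
  -- As a polynomial in `S`, the root `T` is again self-adjoint and commutes with the `f i`; thus
  -- `B(Tm, Tn) = B(T²m, n) = B(Sm, n) = B'(m, n)`.
  obtain ⟨p, hp⟩ := exists_aeval_mul_self S hSu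
  have hadj : ∀ (p : ℂ[X]) m n, B (aeval S p m) n = B m (aeval S p n) := by
    intro p
    induction p using Polynomial.induction_on' with
    | add p q hp hq => intro m n; simp [hp, hq]
    | monomial k a =>
      intro m n
      have : ∀ m n, B ((S ^ k) m) n = B m ((S ^ k) n) := by
        induction k with
        | zero => intro m n; rfl
        | succ k ih =>
          intro m n
          rw [pow_succ, Module.End.mul_apply, ih, hself, ← Module.End.mul_apply, ← pow_succ', pow_succ]
      simp [aeval_monomial, this]
  have hT : ∀ m, aeval S p (aeval S p m) = S m := fun m => LinearMap.congr_fun hp m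
  have hTinj : Function.Injective (aeval S p) := by
    rw [injective_iff_map_eq_zero]
    intro x hx
    exact (injective_iff_map_eq_zero S).mp hSinj x (by rw [← hT, hx, map_zero])
  refine ⟨LinearEquiv.ofInjectiveEndo _ hTinj, fun m n => ?_, fun i m => ?_⟩
  · show _ = B (aeval S p m) (aeval S p n)
    rw [hadj, hT, ← hself, hS]
  · have : Commute (aeval S p) (f i) :=
      ((Algebra.commute_of_mem_adjoin_of_forall_mem_commute (R := ℂ) (s := {S})
        (aeval_mem_adjoin_singleton ℂ S) (by rintro _ rfl; exact (hcomm i).symm))).symm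
    exact LinearMap.congr_fun this m

theorem det_eq_mul_of_isCompl [FiniteDimensional ℂ M] {p q : Submodule ℂ M} (h : IsCompl p q)
    (a : End ℂ M) (hp : ∀ x ∈ p, a x ∈ p) (hq : ∀ x ∈ q, a x ∈ q) :
    LinearMap.det a = LinearMap.det (a.restrict hp) * LinearMap.det (a.restrict hq) := by
  rw [← LinearMap.det_prodMap, ← LinearMap.det_conj _ (Submodule.prodEquivOfIsCompl p q h)]
  congr 1
  ext x
  obtain ⟨⟨y, z⟩, rfl⟩ := (Submodule.prodEquivOfIsCompl p q h).surjective x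
  simp

/-- Here `a = -(1 - (a + 1))`, and the unipotent factor has determinant 1: it is the characteristic
polynomial `X ^ finrank` of a nilpotent operator, evaluated at 1. -/
theorem det_eq_of_isNilpotent_add_one [FiniteDimensional ℂ M] {a : End ℂ M}
    (h : IsNilpotent (a + 1)) : LinearMap.det a = (-1) ^ finrank ℂ M := by
  have h1 : LinearMap.det (1 - (a + 1)) = 1 := by
    have := LinearMap.eval_charpoly (a + 1) 1
    rw [h.charpoly_eq_X_pow_finrank] at this
    simpa using this.symm
  have h2 : a = (-1 : ℂ) • (1 - (a + 1)) := by simp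
  rw [h2, LinearMap.det_smul, h1, mul_one]

/-- An isometry without eigenvalue `-1` has determinant `1`. -/
theorem det_isometry_eq_one [FiniteDimensional ℂ M] {B : M →ₗ[ℂ] M →ₗ[ℂ] ℂ} (hB : B.SeparatingLeft)
    {a : End ℂ M} (ha : ∀ m n, B (a m) (a n) = B m n) (h1 : Function.Injective (a + 1 : End ℂ M)) :
    LinearMap.det a = 1 := by
  have hinj : Function.Injective B := by
    rw [injective_iff_map_eq_zero]
    exact fun x hx => hB x fun y => by rw [hx]; rfl
  let e : M ≃ₗ[ℂ] Dual ℂ M :=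
    LinearMap.linearEquivOfInjective B hinj Subspace.dual_finrank_eq.symm
  have he : ∀ x y, e x y = B x y := fun _ _ => rfl
  -- The identity `B((a+1)x, ay) = B(x, (a+1)y)` in terms of the dual space. Taking determinants
  -- gives `det a · det(a+1) = det(a+1)`, and the last factor is nonzero.
  have h2 : a.dualMap ∘ₗ (e.toLinearMap ∘ₗ (a + 1) ∘ₗ e.symm.toLinearMap) = (a + 1).dualMap := by
    ext x y
    obtain ⟨x, rfl⟩ := e.surjective x
    simp [he, ha]
    abel
  have h3 := congrArg LinearMap.det h2
  rw [LinearMap.det_comp, LinearMap.det_dualMap, LinearMap.det_dualMap, LinearMap.det_conj] at h3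
  have h4 : LinearMap.det (a + 1) ≠ 0 := fun h0 => by
    have := LinearMap.bot_lt_ker_of_det_eq_zero h0
    rw [LinearMap.ker_eq_bot.mpr h1] at this
    exact lt_irrefl _ this
  exact mul_right_cancel₀ h4 (h3.trans (one_mul _).symm)

/-- The determinant of an isometry is governed by its generalized eigenspace for `-1`, on which
the form is non-degenerate. -/
theorem exists_det_isometry [FiniteDimensional ℂ M] {B : M →ₗ[ℂ] M →ₗ[ℂ] ℂ} (hB : B.Nondegenerate)
    {b : ℂ} (hs : ∀ m n, B n m = b * B m n)
    {a : End ℂ M} (ha : ∀ m n, B (a m) (a n) = B m n) :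
    ∃ E : Submodule ℂ M, (∀ f : End ℂ M, Commute a f → ∀ x ∈ E, f x ∈ E) ∧
      (∀ x ∈ E, (∀ y ∈ E, B x y = 0) → x = 0) ∧ LinearMap.det a = (-1) ^ finrank ℂ E := by
  -- Fitting decomposition of `a + 1`. The requirement `N ≥ 1` ensures that the kernel of `a + 1`
  -- lies in that of its `N`-th power.
  obtain ⟨N, hN⟩ := ((a + 1).eventually_isCompl_ker_pow_range_pow.and
    (Filter.eventually_ge_atTop 1)).exists
  obtain ⟨hN, hN1⟩ := hN
  have hainj : Function.Injective a := by
    rw [injective_iff_map_eq_zero]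
    exact fun x hx => hB.1 x fun y => by rw [← ha, hx, map_zero, LinearMap.zero_apply]
  have hasurj := LinearMap.surjective_of_injective hainj
  have hstab : ∀ f : End ℂ M, Commute a f → Commute ((a + 1) ^ N) f := fun f hf =>
    (hf.add_left (Commute.one_left f)).pow_left N
  have hker : ∀ f : End ℂ M, Commute a f → ∀ x ∈ LinearMap.ker ((a + 1) ^ N),
      f x ∈ LinearMap.ker ((a + 1) ^ N) := by
    intro f hf x hx
    rw [LinearMap.mem_ker] at hx ⊢
    have := LinearMap.congr_fun (hstab f hf) x
    rw [Module.End.mul_apply, Module.End.mul_apply, hx, map_zero] at this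
    exact this
  have hran : ∀ x ∈ LinearMap.range ((a + 1) ^ N), a x ∈ LinearMap.range ((a + 1) ^ N) := by
    rintro _ ⟨y, rfl⟩
    exact ⟨a y, LinearMap.congr_fun (hstab a (Commute.refl a)) y⟩
  -- The two Fitting components are orthogonal: `B(ax, (a+1)z) = B((a+1)x, z)` moves one factor
  -- across the form, and `a` is bijective.
  have horth : ∀ (k : ℕ) (x y : M), ((a + 1) ^ k : End ℂ M) x = 0 → B x (((a + 1) ^ k : End ℂ M) y) = 0 := by
    intro k
    induction k with
    | zero => intro x y hx; rw [show x = 0 from hx, map_zero, LinearMap.zero_apply]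
    | succ k ih =>
      intro x y hx
      obtain ⟨x, rfl⟩ := hasurj x
      have hx' : ((a + 1) ^ k : End ℂ M) ((a + 1 : End ℂ M) x) = 0 := by
        apply hainj
        have hc : Commute ((a + 1) ^ (k + 1)) a :=
          ((Commute.refl a).add_left (Commute.one_left a)).pow_left _
        have := LinearMap.congr_fun hc x
        rw [Module.End.mul_apply, Module.End.mul_apply, hx] at this
        rw [map_zero, this, pow_succ, Module.End.mul_apply]
      have h1 := ih _ y hx'
      rw [pow_succ', Module.End.mul_apply]
      set z := ((a + 1) ^ k : End ℂ M) y
      show B (a x) (a z + z) = 0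
      have h2 : B (a x + x) z = 0 := h1
      rw [map_add, ha, ← add_comm, ← LinearMap.add_apply, ← map_add]
      exact h2
  have hcompl := hN
  refine ⟨LinearMap.ker ((a + 1) ^ N), hker, fun x hx hxy => hB.1 x fun y => ?_, ?_⟩
  · have hy : y ∈ LinearMap.ker ((a + 1) ^ N) ⊔ LinearMap.range ((a + 1) ^ N) := by
      rw [hcompl.sup_eq_top]; trivial
    obtain ⟨y₁, hy₁, _, ⟨y₂, rfl⟩, rfl⟩ := Submodule.mem_sup.mp hy
    rw [map_add, hxy y₁ hy₁, horth N x y₂ hx, add_zero]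
  · rw [det_eq_mul_of_isCompl hcompl a (hker a (Commute.refl a)) hran]
    have hd1 := det_eq_of_isNilpotent_add_one (a := a.restrict (hker a (Commute.refl a))) ⟨N, by
      ext ⟨x, hx⟩
      have hk : ∀ (k : ℕ), (((a.restrict (hker a (Commute.refl a)) + 1) ^ k)
          ⟨x, hx⟩ : M) = ((a + 1) ^ k) x := by
        intro k
        induction k with
        | zero => rfl
        | succ k ih =>
          rw [pow_succ', pow_succ', Module.End.mul_apply, Module.End.mul_apply, ← ih]
          rfl
      rw [hk N]
      exact hx⟩
    rw [hd1]
    -- On the range component the form is non-degenerate by orthogonality and `a + 1` is injective,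
    -- so this component contributes determinant 1.
    have hd2 := det_isometry_eq_one (B := B.domRestrict₁₂ (LinearMap.range ((a + 1) ^ N))
      (LinearMap.range ((a + 1) ^ N))) (a := a.restrict hran) (by
        rintro ⟨x, hx⟩ hxy
        apply Subtype.ext
        refine hB.1 x fun y => ?_
        have hy : y ∈ LinearMap.ker ((a + 1) ^ N) ⊔ LinearMap.range ((a + 1) ^ N) := by
          rw [hcompl.sup_eq_top]; trivial
        obtain ⟨y₁, hy₁, y₂, hy₂, rfl⟩ := Submodule.mem_sup.mp hy
        obtain ⟨x, rfl⟩ := hx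
        have h2 : B (((a + 1) ^ N : End ℂ M) x) y₂ = 0 := hxy ⟨y₂, hy₂⟩
        rw [map_add, h2, add_zero, hs, horth N y₁ x hy₁, mul_zero])
      (fun m n => ha m n) (by
        rw [injective_iff_map_eq_zero]
        rintro ⟨x, hx⟩ h0
        apply Subtype.ext
        have h0' : (a + 1 : End ℂ M) x = 0 := congrArg Subtype.val h0
        have hx' : x ∈ LinearMap.ker ((a + 1) ^ N) := by
          rw [LinearMap.mem_ker]
          obtain ⟨k, rfl⟩ : ∃ k, N = k + 1 := ⟨N - 1, by omega⟩
          rw [pow_succ, Module.End.mul_apply, h0', map_zero]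
        exact (Submodule.disjoint_def.mp hcompl.disjoint) x hx' hx)
    rw [hd2, mul_one]

/-- A space with a non-degenerate skew-symmetric form has even dimension. -/
theorem even_finrank_of_skew [FiniteDimensional ℂ M] {B : M →ₗ[ℂ] M →ₗ[ℂ] ℂ} (hB : B.SeparatingLeft)
    (hs : ∀ m n, B n m = -B m n) : Even (finrank ℂ M) := by
  by_contra hodd
  rw [Nat.not_even_iff_odd] at hodd
  let v := finBasis ℂ M
  let A : Matrix (Fin (finrank ℂ M)) (Fin (finrank ℂ M)) ℂ := Matrix.of fun i j => B (v i) (v j)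
  -- In odd size a skew-symmetric Gram matrix is singular, and a null vector of it lies in the
  -- radical.
  have hA : Aᵀ = -A := by ext i j; exact hs _ _
  have hdet : A.det = 0 := by
    have := congrArg Matrix.det hA
    rw [Matrix.det_transpose, Matrix.det_neg, Fintype.card_fin, hodd.neg_one_pow] at this
    have h2 : (2 : ℂ) * A.det = 0 := by linear_combination this
    simpa using h2
  obtain ⟨c, hc0, hc⟩ := Matrix.exists_vecMul_eq_zero_iff.mpr hdet
  have hx : ∑ i, c i • v i = 0 := by
    refine hB _ fun y => ?_
    have : B (∑ i, c i • v i) = 0 := by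
      refine v.ext fun j => ?_
      have := congrFun hc j
      simpa [Matrix.vecMul, dotProduct, A] using this
    rw [this]; rfl
  exact hc0 (funext fun i => by
    have := Fintype.linearIndependent_iff.mp v.linearIndependent c hx i
    exact this)

/-- Symplectic isometries have determinant `1`. -/
theorem det_symplectic [FiniteDimensional ℂ M] {B : M →ₗ[ℂ] M →ₗ[ℂ] ℂ} (hB : B.Nondegenerate)
    (hs : ∀ m n, B n m = -B m n) {a : End ℂ M} (ha : ∀ m n, B (a m) (a n) = B m n) :
    LinearMap.det a = 1 := by
  obtain ⟨E, -, hE, hdet⟩ := exists_det_isometry hB (b := -1)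
    (fun m n => by rw [hs, neg_one_mul]) ha
  rw [hdet]
  refine (even_finrank_of_skew (B := B.domRestrict₁₂ E E) ?_ fun m n => hs m n).neg_one_pow
  rintro ⟨x, hx⟩ hxy
  exact Subtype.ext (hE x hx fun y hy => hxy ⟨y, hy⟩)

end LinearAlgebra
end ClassicalPar

namespace ClassicalPar

open Module Polynomial

/-! ### Criteria for semisimplicity of operators and of representations -/

section Semisimple

variable {M : Type*} [AddCommGroup M] [Module ℂ M]

/-- A representation is semisimple if every stable subspace is the image of an equivariant
projection. -/
theorem isSemisimple_iff_exists_proj {G : Type*} [Group G] (ρ : Representation ℂ G M) :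
    ρ.IsSemisimpleRepresentation ↔ ∀ W : Submodule ℂ M, (∀ g, ∀ x ∈ W, ρ g x ∈ W) →
      ∃ P : End ℂ M, LinearMap.IsProj W P ∧ ∀ g, Commute P (ρ g) := by
  constructor
  · intro h W hW
    obtain ⟨W', hW'⟩ := h.exists_isCompl ⟨W, fun g x hx => hW g x hx⟩
    have hc : IsCompl W W'.toSubmodule := by
      constructor
      · rw [disjoint_iff]
        exact congrArg Subrepresentation.toSubmodule (disjoint_iff.mp hW'.disjoint)
      · rw [codisjoint_iff]
        exact congrArg Subrepresentation.toSubmodule (codisjoint_iff.mp hW'.codisjoint)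
    refine ⟨W.projection _ hc, ⟨Submodule.projection_apply_mem hc,
      fun x hx => Submodule.projection_apply_of_mem_left hc hx⟩, fun g => LinearMap.ext fun x => ?_⟩
    rw [Module.End.mul_apply, Module.End.mul_apply]
    set y := W.projection _ hc x with hy
    have hz : x - y ∈ W'.toSubmodule := Submodule.sub_projection_mem hc x
    have hyW : y ∈ W := Submodule.projection_apply_mem hc x
    have hx : ρ g x = ρ g y + ρ g (x - y) := by rw [← map_add, add_sub_cancel]
    rw [hx, map_add, Submodule.projection_apply_of_mem_left hc (hW g y hyW),
      (Submodule.projection_apply_eq_zero_iff hc).mpr (W'.apply_mem_toSubmodule g hz), add_zero]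
  · intro h
    refine ⟨fun W => ?_⟩
    obtain ⟨P, hP, hc⟩ := h W.toSubmodule W.apply_mem_toSubmodule
    refine ⟨⟨LinearMap.ker P, fun g x hx => ?_⟩, ?_⟩
    · rw [LinearMap.mem_ker] at hx ⊢
      have := LinearMap.congr_fun (hc g) x
      rw [Module.End.mul_apply, Module.End.mul_apply, hx, map_zero] at this
      exact this
    · constructor
      · rw [disjoint_iff]
        exact Subrepresentation.toSubmodule_injective (disjoint_iff.mp hP.isCompl.disjoint)
      · rw [codisjoint_iff]
        exact Subrepresentation.toSubmodule_injective (codisjoint_iff.mp hP.isCompl.codisjoint)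

/-- Averaging a projection over a finite quotient. -/
theorem exists_proj_of_finiteIndex {G : Type*} [Group G] (ρ : Representation ℂ G M)
    (H : Subgroup G) [H.FiniteIndex] {W : Submodule ℂ M} (hW : ∀ g, ∀ x ∈ W, ρ g x ∈ W)
    {P : End ℂ M} (hP : LinearMap.IsProj W P) (hc : ∀ h ∈ H, Commute P (ρ h)) :
    ∃ P' : End ℂ M, LinearMap.IsProj W P' ∧ ∀ g, Commute P' (ρ g) := by
  classical
  have : Fintype (G ⧸ H) := H.fintypeQuotientOfFiniteIndex
  -- A conjugate of `P` depends only on the coset, since `P` commutes with `H`; each one is again a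
  -- projection onto the stable space `W`.
  let F : G ⧸ H → End ℂ M := Quotient.lift (fun g => ρ g * P * ρ g⁻¹) (by
    intro a b hab
    have hab' : a⁻¹ * b ∈ H := QuotientGroup.leftRel_apply.mp hab
    show ρ a * P * ρ a⁻¹ = ρ b * P * ρ b⁻¹
    have h1 : ρ b = ρ a * ρ (a⁻¹ * b) := by rw [← map_mul, mul_inv_cancel_left]
    have h2 : ρ a⁻¹ = ρ (a⁻¹ * b) * ρ b⁻¹ := by rw [← map_mul, mul_inv_cancel_right]
    rw [h1, h2, mul_assoc, mul_assoc, mul_assoc, ← mul_assoc P, (hc _ hab').eq]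
    simp only [mul_assoc])
  have hF : ∀ g : G, F (QuotientGroup.mk g) = ρ g * P * ρ g⁻¹ := fun g => rfl
  have hconj : ∀ (g : G) (q : G ⧸ H), ρ g * F q = F (g • q) * ρ g := by
    intro g q
    obtain ⟨a, rfl⟩ := QuotientGroup.mk_surjective q
    rw [MulAction.Quotient.smul_mk, hF, hF, smul_eq_mul, mul_inv_rev, map_mul, map_mul]
    rw [mul_assoc _ _ (ρ g), mul_assoc (ρ a⁻¹), ← map_mul ρ g⁻¹, inv_mul_cancel, map_one, mul_one]
    simp only [mul_assoc]
  have hcard : (Fintype.card (G ⧸ H) : ℂ) ≠ 0 := Nat.cast_ne_zero.mpr Fintype.card_ne_zero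
  refine ⟨(Fintype.card (G ⧸ H) : ℂ)⁻¹ • ∑ q, F q, ⟨fun x => ?_, fun x hx => ?_⟩, fun g => ?_⟩
  · rw [LinearMap.smul_apply, LinearMap.sum_apply]
    refine W.smul_mem _ (W.sum_mem fun q _ => ?_)
    obtain ⟨a, rfl⟩ := QuotientGroup.mk_surjective q
    exact hW a _ (hP.map_mem _)
  · have : ∀ q, F q x = x := by
      intro q
      obtain ⟨a, rfl⟩ := QuotientGroup.mk_surjective q
      rw [hF, Module.End.mul_apply, Module.End.mul_apply, hP.map_id _ (hW _ x hx),
        ← Module.End.mul_apply, ← map_mul, mul_inv_cancel, map_one, Module.End.one_apply]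
    rw [LinearMap.smul_apply, LinearMap.sum_apply, Finset.sum_congr rfl fun q _ => this q,
      Finset.sum_const, Finset.card_univ, ← Nat.cast_smul_eq_nsmul ℂ, smul_smul,
      inv_mul_cancel₀ hcard, one_smul]
  · refine Commute.smul_left ?_ _
    show (∑ q, F q) * ρ g = ρ g * ∑ q, F q
    rw [Finset.sum_mul, Finset.mul_sum, Finset.sum_congr rfl fun q _ => hconj g q]
    exact (Equiv.sum_comp (MulAction.toPerm g) fun q => F q * ρ g).symm

open scoped IsMulCommutative in
/-- Commuting semisimple operators act semisimply. -/
theorem exists_proj_of_commute [FiniteDimensional ℂ M] {ι : Type*} (f : ι → End ℂ M)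
    (hcomm : ∀ i j, Commute (f i) (f j)) (hss : ∀ i, (f i).IsSemisimple) {W : Submodule ℂ M}
    (hW : ∀ i, ∀ x ∈ W, f i x ∈ W) :
    ∃ P : End ℂ M, LinearMap.IsProj W P ∧ ∀ i, Commute P (f i) := by
  let A := Algebra.adjoin ℂ (Set.range f)
  have : IsMulCommutative A := Algebra.isMulCommutative_adjoin ℂ (by
    rintro _ ⟨i, rfl⟩ _ ⟨j, rfl⟩
    exact hcomm i j)
  -- Over ℂ sums and products of commuting semisimple operators are semisimple. Nilpotent elements
  -- of `A` therefore vanish, and a reduced commutative artinian ring is semisimple, so `W` has an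
  -- `A`-stable complement.
  have hAss : ∀ a ∈ A, End.IsSemisimple a := by
    intro a ha
    induction ha using Algebra.adjoin_induction with
    | mem x hx => obtain ⟨i, rfl⟩ := hx; exact hss i
    | algebraMap r =>
      rw [Algebra.algebraMap_eq_smul_one]
      exact Module.End.IsSemisimple_smul r (Module.End.isSemisimple_id (R := ℂ) (M := M))
    | add x y hx hy ihx ihy =>
      exact Module.End.IsSemisimple.add_of_commute
        (congrArg Subtype.val (mul_comm (⟨x, hx⟩ : A) ⟨y, hy⟩)) ihx ihy
    | mul x y hx hy ihx ihy =>
      exact Module.End.IsSemisimple.mul_of_commute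
        (congrArg Subtype.val (mul_comm (⟨x, hx⟩ : A) ⟨y, hy⟩)) ihx ihy
  have : IsReduced A := ⟨fun a ⟨n, hn⟩ => Subtype.ext
    (Module.End.eq_zero_of_isNilpotent_isSemisimple ⟨n, congrArg Subtype.val hn⟩ (hAss a a.2))⟩
  have : IsArtinianRing A := IsArtinianRing.of_finite ℂ A
  have : IsSemisimpleRing A := IsArtinianRing.isSemisimpleRing_of_isReduced A
  have hWA : ∀ a ∈ A, ∀ x ∈ W, a x ∈ W := by
    intro a ha
    induction ha using Algebra.adjoin_induction with
    | mem y hy => obtain ⟨i, rfl⟩ := hy; exact hW i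
    | algebraMap r => exact fun x hx => W.smul_mem r hx
    | add y z _ _ ihy ihz => exact fun x hx => W.add_mem (ihy x hx) (ihz x hx)
    | mul y z _ _ ihy ihz => exact fun x hx => ihy _ (ihz x hx)
  let W' : Submodule A M := { W with smul_mem' := fun a _ hx => hWA a a.2 _ hx }
  obtain ⟨V, hV⟩ := exists_isCompl W'
  let P := W'.projection V hV
  refine ⟨P.restrictScalars ℂ, ⟨fun x => Submodule.projection_apply_mem hV x,
    fun x hx => Submodule.projection_apply_of_mem_left hV hx⟩, fun i => LinearMap.ext fun x => ?_⟩
  exact P.map_smul (⟨f i, Algebra.subset_adjoin ⟨i, rfl⟩⟩ : A) x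

/-- Eigenvectors spanning the space make an endomorphism semisimple. -/
theorem isSemisimple_of_span_eigenvectors [FiniteDimensional ℂ M] (f : End ℂ M)
    (h : Submodule.span ℂ {v : M | ∃ c : ℂ, f v = c • v} = ⊤) : f.IsSemisimple := by
  classical
  -- Product over the distinct eigenvalues: squarefree, and it annihilates every eigenvector.
  let p : ℂ[X] := ∏ z ∈ (minpoly ℂ f).roots.toFinset, (X - C z)
  have hsep : p.Separable := (separable_prod_X_sub_C_iff' (ι := ℂ) (f := id)).mpr
    fun x _ y _ h => h
  refine Module.End.isSemisimple_of_squarefree_aeval_eq_zero hsep.squarefree (LinearMap.ext fun v => ?_)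
  have hv : v ∈ Submodule.span ℂ {v : M | ∃ c : ℂ, f v = c • v} := by rw [h]; trivial
  induction hv using Submodule.span_induction with
  | zero => simp
  | add x y _ _ hx hy => rw [map_add, hx, hy, map_add]
  | smul a x _ hx => rw [map_smul, hx, map_smul]
  | mem x hx =>
    obtain ⟨c, hc⟩ := hx
    by_cases hx0 : x = 0
    · simp [hx0]
    have hev : f.HasEigenvector c x := ⟨Module.End.mem_eigenspace_iff.mpr hc, hx0⟩
    rw [Module.End.aeval_apply_of_hasEigenvector hev]
    have hroot : c ∈ (minpoly ℂ f).roots.toFinset := by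
      rw [Multiset.mem_toFinset, mem_roots (minpoly.ne_zero (Algebra.IsIntegral.isIntegral f))]
      exact Module.End.isRoot_of_hasEigenvalue (Module.End.hasEigenvalue_of_hasEigenvector hev)
    rw [eval_prod, Finset.prod_eq_zero hroot (by simp), zero_smul, LinearMap.zero_apply]

/-- A nonzero stable subspace contains a minimal one. -/
theorem exists_minimal_stable [FiniteDimensional ℂ M] {ι : Type*} (f : ι → End ℂ M)
    {U : Submodule ℂ M} (hU0 : U ≠ ⊥) (hU : ∀ i, ∀ x ∈ U, f i x ∈ U) :
    ∃ W ≤ U, W ≠ ⊥ ∧ (∀ i, ∀ x ∈ W, f i x ∈ W) ∧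
      ∀ W' ≤ W, (∀ i, ∀ x ∈ W', f i x ∈ W') → W' = ⊥ ∨ W' = W := by
  obtain ⟨W, ⟨hWU, hW0, hW⟩, hmin⟩ := WellFounded.has_min
    (wellFounded_lt (α := Submodule ℂ M))
    {W | W ≤ U ∧ W ≠ ⊥ ∧ ∀ i, ∀ x ∈ W, f i x ∈ W} ⟨U, le_rfl, hU0, hU⟩
  refine ⟨W, hWU, hW0, hW, fun W' hle hst => ?_⟩
  by_contra hne
  rw [not_or] at hne
  exact hmin W' ⟨hle.trans hWU, hne.1, hst⟩ (lt_of_le_of_ne hle hne.2)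

/-- Commuting operators have a common eigenvector in every nonzero stable subspace. -/
theorem exists_common_eigenvector [FiniteDimensional ℂ M] {ι : Type*} (f : ι → End ℂ M)
    (hcomm : ∀ i j, Commute (f i) (f j)) {U : Submodule ℂ M} (hU0 : U ≠ ⊥)
    (hU : ∀ i, ∀ x ∈ U, f i x ∈ U) : ∃ v ∈ U, v ≠ 0 ∧ ∀ i, ∃ c : ℂ, f i v = c • v := by
  obtain ⟨W, hWU, hW0, hW, hmin⟩ := exists_minimal_stable f hU0 hU
  obtain ⟨v, hvW, hv0⟩ := W.exists_mem_ne_zero_of_ne_bot hW0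
  refine ⟨v, hWU hvW, hv0, fun i => ?_⟩
  have : Nontrivial W := ⟨⟨⟨v, hvW⟩, 0, fun h => hv0 (congrArg Subtype.val h)⟩⟩
  obtain ⟨c, hc⟩ := Module.End.exists_eigenvalue ((f i).restrict (hW i))
  obtain ⟨w, hw, hw0⟩ := hc.exists_hasEigenvector
  have hw' : f i w = c • (w : M) := congrArg Subtype.val (Module.End.mem_eigenspace_iff.mp hw)
  refine ⟨c, ?_⟩
  -- Commuting operators preserve eigenspaces, so minimality forces the whole of `W` into one
  -- eigenspace of each `f i`.
  rcases hmin (W ⊓ End.eigenspace (f i) c) inf_le_left (fun j x hx => ⟨hW j x hx.1, by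
    have hx2 := Module.End.mem_eigenspace_iff.mp hx.2
    show f j x ∈ End.eigenspace (f i) c
    rw [Module.End.mem_eigenspace_iff, ← Module.End.mul_apply, (hcomm i j).eq,
      Module.End.mul_apply, hx2, map_smul]⟩) with h | h
  · exfalso
    apply hw0
    have : (w : M) ∈ W ⊓ End.eigenspace (f i) c := ⟨w.2, Module.End.mem_eigenspace_iff.mpr hw'⟩
    rw [h] at this
    exact Subtype.ext this
  · have : v ∈ W ⊓ End.eigenspace (f i) c := by rw [h]; exact hvW
    exact Module.End.mem_eigenspace_iff.mp this.2

/-- In a semisimple representation, a commutative normal subgroup acts by semisimple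
operators. -/
theorem isSemisimple_of_normal_commutative [FiniteDimensional ℂ M] {G : Type*} [Group G]
    {ρ : Representation ℂ G M} (hρ : ρ.IsSemisimpleRepresentation) (N : Subgroup G) [N.Normal]
    (hN : ∀ a ∈ N, ∀ b ∈ N, a * b = b * a) {a : G} (ha : a ∈ N) : Module.End.IsSemisimple (ρ a) := by
  -- The common eigenvectors of `N`. Normality of `N` lets `G` permute them, so their span is a
  -- subrepresentation.
  let s : Set M := {v | ∀ b ∈ N, ∃ c : ℂ, ρ b v = c • v}
  have hs : ∀ g, ∀ v ∈ s, ρ g v ∈ s := by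
    intro g v hv b hb
    obtain ⟨c, hc⟩ := hv (g⁻¹ * b * g) (by simpa using (inferInstance : N.Normal).conj_mem b hb g⁻¹)
    refine ⟨c, ?_⟩
    rw [← map_smul, ← hc, ← Module.End.mul_apply, ← Module.End.mul_apply, ← map_mul, ← map_mul]
    congr 2
    group
  let E := Submodule.span ℂ s
  have hE : ∀ g, ∀ x ∈ E, ρ g x ∈ E := by
    intro g x hx
    have : E ≤ E.comap (ρ g) := Submodule.span_le.mpr fun v hv => Submodule.subset_span (hs g v hv)
    exact this hx
  obtain ⟨P, hP, hPc⟩ := (isSemisimple_iff_exists_proj ρ).mp hρ E hE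
  -- An invariant complement of the span, if nonzero, would contain a common eigenvector of the
  -- commuting operators from `N`.
  have htop : E = ⊤ := by
    by_contra hne
    have hker : LinearMap.ker P ≠ ⊥ := fun h => hne (by
      have := hP.isCompl.sup_eq_top
      rwa [h, sup_bot_eq] at this)
    obtain ⟨v, hv, hv0, hvc⟩ := exists_common_eigenvector (fun b : N => ρ b)
      (fun i j => by
        show ρ i * ρ j = ρ j * ρ i
        rw [← map_mul, ← map_mul, hN i i.2 j j.2]) hker (fun i x hx => by
        rw [LinearMap.mem_ker] at hx ⊢
        have := LinearMap.congr_fun (hPc i) x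
        rw [Module.End.mul_apply, Module.End.mul_apply, hx, map_zero] at this
        exact this)
    have hvE : v ∈ E := Submodule.subset_span fun b hb => hvc ⟨b, hb⟩
    exact hv0 ((Submodule.disjoint_def.mp hP.isCompl.disjoint) v hvE hv)
  refine isSemisimple_of_span_eigenvectors _ (top_unique (htop ▸ ?_))
  exact Submodule.span_mono fun v hv => hv a ha

/-- An invertible operator with a semisimple power is semisimple. -/
theorem isSemisimple_of_pow [FiniteDimensional ℂ M] {f : End ℂ M} (hf : IsUnit f) {m : ℕ}
    (hm : 0 < m) (h : (f ^ m).IsSemisimple) : f.IsSemisimple := by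
  have hfm : IsUnit (f ^ m) := hf.pow m
  set μ := minpoly ℂ (f ^ m)
  have hμ0 : ¬ μ.IsRoot 0 := by
    intro hr
    obtain ⟨v, hv, hv0⟩ := (Module.End.hasEigenvalue_of_isRoot hr).exists_hasEigenvector
    rw [Module.End.mem_eigenspace_iff, zero_smul] at hv
    exact hv0 (((Module.End.isUnit_iff _).mp hfm).injective (by rw [hv, map_zero]))
  have hsep : μ.Separable := PerfectField.separable_iff_squarefree.mpr h.minpoly_squarefree
  have hX : IsCoprime (expand ℂ m μ) X := by
    refine ((irreducible_X (R := ℂ)).coprime_iff_not_dvd.mpr fun hd => hμ0 ?_).symm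
    have h0 : (expand ℂ m μ).eval 0 = 0 := by
      exact dvd_iff_isRoot.mp (by rwa [C_0, sub_zero])
    rwa [expand_eval, zero_pow hm.ne'] at h0
  -- The derivative of `μ(X^m)` is `m X^(m-1) μ'(X^m)`. It is coprime to `μ(X^m)` because `μ` is
  -- separable and `μ(0) ≠ 0`; this is where invertibility of `f` enters.
  have hsep' : (expand ℂ m μ).Separable := by
    rw [separable_def, derivative_expand]
    refine IsCoprime.mul_right ?_ (IsCoprime.mul_right ?_ ?_)
    · exact IsCoprime.map hsep (expand ℂ m : ℂ[X] →ₐ[ℂ] ℂ[X]).toRingHom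
    · exact isCoprime_one_right.of_isCoprime_of_dvd_right (IsUnit.dvd ((IsUnit.mk0 (m : ℂ) (by exact_mod_cast hm.ne')).map C))
    · exact hX.pow_right
  refine Module.End.isSemisimple_of_squarefree_aeval_eq_zero hsep'.squarefree ?_
  rw [expand_aeval]
  exact minpoly.aeval _ _

/-- An operator and its inverse have the same eigenvectors, and these span. -/
theorem isSemisimple_inv [FiniteDimensional ℂ M] {f g : End ℂ M} (hfg : f * g = 1)
    (h : f.IsSemisimple) : g.IsSemisimple := by
  have hgf : g * f = 1 := mul_eq_one_comm.mp hfg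
  refine isSemisimple_of_span_eigenvectors g (top_unique ?_)
  rw [← h.iSup_eigenspace_eq_top]
  refine iSup_le fun c v hv => Submodule.subset_span ⟨c⁻¹, ?_⟩
  rw [Module.End.mem_eigenspace_iff] at hv
  have h1 : v = c • g v := by
    rw [← map_smul, ← hv, ← Module.End.mul_apply, hgf, Module.End.one_apply]
  by_cases hc : c = 0
  · rw [hc, zero_smul] at h1
    simp [h1]
  · conv_rhs => rw [h1]
    rw [smul_smul, inv_mul_cancel₀ hc, one_smul]

end Semisimple
end ClassicalPar

namespace ClassicalPar

open Module Polynomial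

/-! ### Odd-dimensional orthogonal summands and isometries of determinant -1 -/

section OrthogonalSummands

variable {M : Type*} [AddCommGroup M] [Module ℂ M]

/-- The form `B` is non-degenerate on the subspace `W`. -/
def NondegenerateOn (B : M →ₗ[ℂ] M →ₗ[ℂ] ℂ) (W : Submodule ℂ M) : Prop :=
  ∀ x ∈ W, (∀ y ∈ W, B x y = 0) → x = 0

/-- The orthogonal complement of `W`. -/
def orthoCompl (B : M →ₗ[ℂ] M →ₗ[ℂ] ℂ) (W : Submodule ℂ M) : Submodule ℂ M where
  carrier := {x | ∀ y ∈ W, B x y = 0}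
  add_mem' {a b} ha hb y hy := by rw [map_add, LinearMap.add_apply, ha y hy, hb y hy, add_zero]
  zero_mem' y _ := by rw [map_zero, LinearMap.zero_apply]
  smul_mem' c a ha y hy := by rw [map_smul, LinearMap.smul_apply, ha y hy, smul_zero]

/-- The functional `B x` restricted to `W` is represented by some `w ∈ W`, and then `x - w` is
orthogonal to `W`. No non-degeneracy of `B` on the whole space is needed. -/
theorem isCompl_orthoCompl [FiniteDimensional ℂ M] {B : M →ₗ[ℂ] M →ₗ[ℂ] ℂ}
    {W : Submodule ℂ M} (hW : NondegenerateOn B W) : IsCompl W (orthoCompl B W) := by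
  have hinj : Function.Injective (B.domRestrict₁₂ W W) := by
    rw [injective_iff_map_eq_zero]
    rintro ⟨x, hx⟩ h0
    exact Subtype.ext (hW x hx fun y hy => LinearMap.congr_fun h0 ⟨y, hy⟩)
  let e : W ≃ₗ[ℂ] Dual ℂ W :=
    LinearMap.linearEquivOfInjective _ hinj Subspace.dual_finrank_eq.symm
  constructor
  · rw [Submodule.disjoint_def]
    exact fun x hx hx' => hW x hx hx'
  · rw [codisjoint_iff, eq_top_iff]
    intro x _
    let w : W := e.symm ((B x).comp W.subtype)
    have hw : ∀ y ∈ W, B w y = B x y := fun y hy =>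
      LinearMap.congr_fun (e.apply_symm_apply ((B x).comp W.subtype)) ⟨y, hy⟩
    refine Submodule.mem_sup.mpr ⟨w, w.2, x - w, fun y hy => ?_, add_sub_cancel _ _⟩
    rw [map_sub, LinearMap.sub_apply, hw y hy, sub_self]

/-- The pairing embeds `W` in the dual of `W'`. -/
theorem finrank_le_of_pairing [FiniteDimensional ℂ M] {B : M →ₗ[ℂ] M →ₗ[ℂ] ℂ}
    {W W' : Submodule ℂ M} (h : ∀ x ∈ W, (∀ y ∈ W', B x y = 0) → x = 0) :
    finrank ℂ W ≤ finrank ℂ W' := by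
  rw [← Subspace.dual_finrank_eq (K := ℂ) (V := W')]
  refine LinearMap.finrank_le_finrank_of_injective (f := B.domRestrict₁₂ W W') ?_
  rw [injective_iff_map_eq_zero]
  rintro ⟨x, hx⟩ h0
  exact Subtype.ext (h x hx fun y hy => LinearMap.congr_fun h0 ⟨y, hy⟩)

variable {G : Type*} [Group G] {ρ : Representation ℂ G M}

theorem isIrreducible_of_minimal (W : Subrepresentation ρ) (h0 : W.toSubmodule ≠ ⊥)
    (h : ∀ W' ≤ W.toSubmodule, (∀ g, ∀ x ∈ W', ρ g x ∈ W') → W' = ⊥ ∨ W' = W.toSubmodule) :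
    W.toRepresentation.IsIrreducible := by
  have key : ∀ V : Subrepresentation W.toRepresentation,
      V.toSubmodule.map W.toSubmodule.subtype = ⊥ ∨
        V.toSubmodule.map W.toSubmodule.subtype = W.toSubmodule := by
    intro V
    refine h _ (Submodule.map_subtype_le _ _) ?_
    rintro g _ ⟨x, hx, rfl⟩
    exact ⟨_, V.apply_mem_toSubmodule g hx, rfl⟩
  have : Nontrivial (Subrepresentation W.toRepresentation) := ⟨⟨⊥, ⊤, fun heq => h0 (by
    have h1 : (⊥ : Submodule ℂ W.toSubmodule) = ⊤ := congrArg Subrepresentation.toSubmodule heq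
    rw [Submodule.eq_bot_iff]
    intro x hx
    have : (⟨x, hx⟩ : W.toSubmodule) ∈ (⊥ : Submodule ℂ W.toSubmodule) := by rw [h1]; trivial
    exact congrArg Subtype.val ((Submodule.mem_bot ℂ).mp this))⟩⟩
  refine ⟨fun V => ?_⟩
  rcases key V with hV | hV
  · left
    apply Subrepresentation.toSubmodule_injective
    exact Submodule.map_injective_of_injective W.toSubmodule.injective_subtype
      (hV.trans (Submodule.map_bot _).symm)
  · right
    apply Subrepresentation.toSubmodule_injective
    show V.toSubmodule = ⊤
    rw [eq_top_iff]
    intro x _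
    have : (x : M) ∈ V.toSubmodule.map W.toSubmodule.subtype := by rw [hV]; exact x.2
    obtain ⟨y, hy, hyx⟩ := this
    rwa [← Subtype.ext hyx]

theorem minimal_of_isIrreducible {W : Subrepresentation ρ} (h : W.toRepresentation.IsIrreducible)
    {W' : Submodule ℂ W.toSubmodule} (hW' : ∀ g, ∀ x ∈ W', W.toRepresentation g x ∈ W') :
    W' = ⊥ ∨ W' = ⊤ := by
  rcases h.eq_bot_or_eq_top ⟨W', hW'⟩ with h | h
  · exact Or.inl (congrArg Subrepresentation.toSubmodule h)
  · exact Or.inr (congrArg Subrepresentation.toSubmodule h)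

theorem orthoCompl_stable {B : M →ₗ[ℂ] M →ₗ[ℂ] ℂ} (hB : ∀ g m n, B (ρ g m) (ρ g n) = B m n)
    {W : Submodule ℂ M} (hW : ∀ g, ∀ x ∈ W, ρ g x ∈ W) :
    ∀ g, ∀ x ∈ orthoCompl B W, ρ g x ∈ orthoCompl B W := by
  intro g x hx y hy
  have : y = ρ g (ρ g⁻¹ y) := by
    rw [← Module.End.mul_apply, ← map_mul, mul_inv_cancel, map_one, Module.End.one_apply]
  rw [this, hB]
  exact hx _ (hW _ _ hy)

/-- The reflection in a non-degenerate odd-dimensional stable subspace. -/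
theorem exists_centralizer_det_neg_one [FiniteDimensional ℂ M] {B : M →ₗ[ℂ] M →ₗ[ℂ] ℂ}
    (hB : IsSelfDualForm ρ 1 B) {W : Submodule ℂ M} (hst : ∀ g, ∀ x ∈ W, ρ g x ∈ W)
    (hW : NondegenerateOn B W) (hodd : Odd (finrank ℂ W)) :
    ∃ a ∈ centralizerC ρ B, LinearMap.det (a : End ℂ M) = -1 := by
  have hc := isCompl_orthoCompl hW
  have hsymm : ∀ m n, B n m = B m n := fun m n => by rw [hB.2.2, one_mul]
  set P := W.projection _ hc with hPdef
  have hPW : ∀ x, P x ∈ W := Submodule.projection_apply_mem hc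
  have hPO : ∀ x, x - P x ∈ orthoCompl B W := Submodule.sub_projection_mem hc
  have hP1 : ∀ x ∈ W, P x = x := fun x hx => Submodule.projection_apply_of_mem_left hc hx
  have hP0 : ∀ x ∈ orthoCompl B W, P x = 0 := fun x hx =>
    (Submodule.projection_apply_eq_zero_iff hc).mpr hx
  -- Equal to -1 on `W` and to 1 on its orthogonal complement; its determinant is -1 because `W` has
  -- odd dimension.
  let a₀ : End ℂ M := 1 - (2 : ℂ) • P
  have ha₀ : ∀ x, a₀ x = (x - P x) - P x := fun x => by
    show x - (2 : ℂ) • P x = _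
    rw [two_smul]; abel
  have hinv : Function.Involutive a₀ := by
    intro x
    rw [ha₀ (a₀ x), ha₀ x, map_sub, hP0 _ (hPO x), hP1 _ (hPW x)]
    abel
  refine ⟨LinearEquiv.ofInvolutive a₀ hinv, ⟨fun m n => ?_, fun g m => ?_⟩, ?_⟩
  · show B (a₀ m) (a₀ n) = B m n
    have h1 : ∀ m n, B (m - P m) (P n) = 0 := fun m n => hPO m _ (hPW n)
    have h2 : ∀ m n, B (P n) (m - P m) = 0 := fun m n => by rw [hsymm, h1]
    have h3 : B m n = B ((m - P m) + P m) ((n - P n) + P n) := by simp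
    rw [h3, ha₀, ha₀]
    generalize hu : m - P m = u at *
    generalize hv : n - P n = v at *
    have e1 : B u (P n) = 0 := by rw [← hu]; exact h1 m n
    have e2 : B (P m) v = 0 := by rw [← hv]; exact h2 n m
    simp only [map_sub, map_add, LinearMap.sub_apply, LinearMap.add_apply, e1, e2]
    ring
  · show a₀ (ρ g m) = ρ g (a₀ m)
    have h1 : ρ g m = ρ g (m - P m) + ρ g (P m) := by rw [← map_add, sub_add_cancel]
    have h2 : P (ρ g m) = ρ g (P m) := by
      rw [h1, map_add, hP0 _ (orthoCompl_stable hB.2.1 hst g _ (hPO m)), hP1 _ (hst g _ (hPW m)),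
        zero_add]
    rw [ha₀, ha₀, h2, map_sub, map_sub]
  · show LinearMap.det a₀ = -1
    rw [det_eq_mul_of_isCompl hc a₀
      (fun x hx => by rw [ha₀]; exact W.sub_mem (W.sub_mem hx (hPW x)) (hPW x))
      (fun x hx => by rw [ha₀, hP0 x hx, sub_zero, sub_zero]; exact hx)]
    have h1 : a₀.restrict (p := W) (q := W)
        (fun x hx => by rw [ha₀]; exact W.sub_mem (W.sub_mem hx (hPW x)) (hPW x)) =
        (-1 : ℂ) • LinearMap.id := by
      ext x
      show a₀ x = (-1 : ℂ) • (x : M)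
      rw [ha₀, hP1 _ x.2]
      simp
    have h2 : a₀.restrict (p := orthoCompl B W) (q := orthoCompl B W)
        (fun x hx => by rw [ha₀, hP0 x hx, sub_zero, sub_zero]; exact hx) = LinearMap.id := by
      ext x
      show a₀ x = (x : M)
      rw [ha₀, hP0 _ x.2, sub_zero, sub_zero]
    rw [h1, h2, LinearMap.det_smul, LinearMap.det_id, LinearMap.det_id, hodd.neg_one_pow]
    ring

/-- The modular law splits `N` off inside `E`; this is the descent step in the search for an odd
summand. -/
theorem finrank_inf_orthoCompl [FiniteDimensional ℂ M] {B : M →ₗ[ℂ] M →ₗ[ℂ] ℂ}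
    {E N : Submodule ℂ M} (hNE : N ≤ E) (hN : NondegenerateOn B N) :
    finrank ℂ E = finrank ℂ N + finrank ℂ (E ⊓ orthoCompl B N : Submodule ℂ M) ∧
      N ⊔ (E ⊓ orthoCompl B N) = E := by
  have hc := isCompl_orthoCompl hN
  have hsup : N ⊔ (E ⊓ orthoCompl B N) = E := by
    rw [inf_comm, ← sup_inf_assoc_of_le _ hNE, hc.sup_eq_top, top_inf_eq]
  have hinf : N ⊓ (E ⊓ orthoCompl B N) = ⊥ :=
    le_bot_iff.mp ((inf_le_inf_left N inf_le_right).trans hc.inf_eq_bot.le)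
  have := Submodule.finrank_sup_add_finrank_inf_eq N (E ⊓ orthoCompl B N)
  rw [hsup, hinf, finrank_bot, add_zero] at this
  exact ⟨this, hsup⟩

/-- A non-degenerate stable subspace of odd dimension contains an irreducible orthogonal
subrepresentation of odd dimension. -/
theorem exists_irreducible_odd [FiniteDimensional ℂ M] {B : M →ₗ[ℂ] M →ₗ[ℂ] ℂ}
    (hρ : ρ.IsSemisimpleRepresentation) (hB : ∀ g m n, B (ρ g m) (ρ g n) = B m n)
    (hsymm : ∀ m n, B n m = B m n) (d : ℕ) :
    ∀ E : Submodule ℂ M, (∀ g, ∀ x ∈ E, ρ g x ∈ E) → NondegenerateOn B E →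
      finrank ℂ E = d → Odd d → ∃ W : Subrepresentation ρ, W.toRepresentation.IsIrreducible ∧
        IsOrthogonal W.toRepresentation ∧ Odd (finrank ℂ W.toSubmodule) := by
  induction d using Nat.strong_induction_on with
  | _ d ih =>
    intro E hE hnd hd hodd
    -- Splitting off a nonzero non-degenerate stable subspace of even dimension leaves a smaller
    -- non-degenerate stable space that is still of odd dimension.
    have reduce : ∀ N ≤ E, N ≠ ⊥ → (∀ g, ∀ x ∈ N, ρ g x ∈ N) → NondegenerateOn B N →
        Even (finrank ℂ N) → ∃ W : Subrepresentation ρ, W.toRepresentation.IsIrreducible ∧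
        IsOrthogonal W.toRepresentation ∧ Odd (finrank ℂ W.toSubmodule) := by
      intro N hNE hN0 hNst hNnd hNeven
      obtain ⟨hfin, hsup⟩ := finrank_inf_orthoCompl hNE hNnd
      have hpos : 0 < finrank ℂ N := Nat.pos_of_ne_zero fun h =>
        hN0 (Submodule.finrank_eq_zero.mp h)
      refine ih (finrank ℂ (E ⊓ orthoCompl B N : Submodule ℂ M)) (by omega) (E ⊓ orthoCompl B N)
        (fun g x hx => ⟨hE g x hx.1, orthoCompl_stable hB hNst g x hx.2⟩) (fun x hx hxy => ?_) rfl ?_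
      · refine hnd x hx.1 fun y hy => ?_
        rw [← hsup] at hy
        obtain ⟨y₁, hy₁, y₂, hy₂, rfl⟩ := Submodule.mem_sup.mp hy
        rw [map_add, hx.2 y₁ hy₁, hxy y₂ hy₂, add_zero]
      · rw [← hd, hfin, Nat.odd_add] at hodd
        by_contra hcon
        exact (Nat.not_odd_iff_even.mpr hNeven) (hodd.mpr (Nat.not_odd_iff_even.mp hcon))
    have hE0 : E ≠ ⊥ := by
      rintro rfl
      rw [finrank_bot] at hd
      rw [← hd] at hodd
      exact absurd hodd (by decide)
    obtain ⟨W, hWE, hW0, hW, hmin⟩ := exists_minimal_stable ρ hE0 hE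
    -- The radical of a minimal stable subspace is stable, so the form on `W` is either
    -- non-degenerate or zero.
    rcases hmin (W ⊓ orthoCompl B W) inf_le_left
      (fun g x hx => ⟨hW g x hx.1, orthoCompl_stable hB hW g x hx.2⟩) with hrad | hrad
    · have hWnd : NondegenerateOn B W := fun x hx hxy => by
        have : x ∈ W ⊓ orthoCompl B W := ⟨hx, hxy⟩
        rw [hrad] at this
        exact this
      by_cases hWodd : Odd (finrank ℂ W)
      · refine ⟨⟨W, hW⟩, isIrreducible_of_minimal _ hW0 hmin, ⟨B.domRestrict₁₂ W W, ⟨?_, ?_⟩,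
          fun g m n => hB g m n, fun m n => (hsymm m n).trans (one_mul _).symm⟩, hWodd⟩
        · rintro ⟨x, hx⟩ hxy
          exact Subtype.ext (hWnd x hx fun y hy => hxy ⟨y, hy⟩)
        · rintro ⟨x, hx⟩ hxy
          exact Subtype.ext (hWnd x hx fun y hy => (hsymm _ _).trans (hxy ⟨y, hy⟩))
      · exact reduce W hWE hW0 hW hWnd (Nat.not_odd_iff_even.mp hWodd)
    · have hiso : ∀ x ∈ W, ∀ y ∈ W, B x y = 0 := fun x hx => by
        rw [← hrad] at hx
        exact hx.2
      have hFst : ∀ g, ∀ x ∈ E ⊓ orthoCompl B W, ρ g x ∈ E ⊓ orthoCompl B W := fun g x hx =>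
        ⟨hE g x hx.1, orthoCompl_stable hB hW g x hx.2⟩
      obtain ⟨P, hP, hPc⟩ := (isSemisimple_iff_exists_proj ρ).mp hρ _ hFst
      -- For isotropic `W`, a stable complement of `E ∩ W^⊥` in `E` is in perfect duality with `W`.
      -- Hence `W ⊕ W'` is non-degenerate, of even dimension `2 dim W`, and can be split off.
      let W' := E ⊓ LinearMap.ker P
      have hW' : ∀ g, ∀ x ∈ W', ρ g x ∈ W' := fun g x hx => ⟨hE g x hx.1, by
        have := LinearMap.congr_fun (hPc g) x
        rw [Module.End.mul_apply, Module.End.mul_apply, LinearMap.mem_ker.mp hx.2, map_zero] at this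
        exact this⟩
      have hdec : ∀ y ∈ E, ∃ y₁ ∈ E ⊓ orthoCompl B W, ∃ y₂ ∈ W', y = y₁ + y₂ := fun y hy =>
        ⟨P y, hP.map_mem y, y - P y, ⟨E.sub_mem hy (hP.map_mem y).1, by
          show P (y - P y) = 0
          rw [map_sub, hP.map_id _ (hP.map_mem y), sub_self]⟩, by abel⟩
      have hdisj : ∀ x ∈ W', x ∈ orthoCompl B W → x = 0 := fun x hx hx' => by
        rw [← hP.map_id x ⟨hx.1, hx'⟩]
        exact hx.2
      have hpair : ∀ x ∈ W, (∀ y ∈ W', B x y = 0) → x = 0 := fun x hx hxy =>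
        hnd x (hWE hx) fun y hy => by
          obtain ⟨y₁, hy₁, y₂, hy₂, rfl⟩ := hdec y hy
          rw [map_add, hsymm, hy₁.2 x hx, hxy y₂ hy₂, add_zero]
      have hfin : finrank ℂ W' = finrank ℂ W :=
        le_antisymm (finrank_le_of_pairing (B := B) fun x hx hxy => hdisj x hx hxy)
          (finrank_le_of_pairing hpair)
      have hWW' : W ⊓ W' = ⊥ := by
        rw [Submodule.eq_bot_iff]
        exact fun x hx => hdisj x hx.2 (hiso x hx.1)
      refine reduce (W ⊔ W') (sup_le hWE inf_le_left) (fun h => hW0 ?_) ?_ ?_ ?_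
      · exact (sup_eq_bot_iff.mp h).1
      · intro g x hx
        obtain ⟨x₁, hx₁, x₂, hx₂, rfl⟩ := Submodule.mem_sup.mp hx
        rw [map_add]
        exact Submodule.add_mem_sup (hW g _ hx₁) (hW' g _ hx₂)
      · intro x hx hxy
        obtain ⟨x₁, hx₁, x₂, hx₂, rfl⟩ := Submodule.mem_sup.mp hx
        have h2 : x₂ = 0 := hdisj x₂ hx₂ fun y hy => by
          have := hxy y (Submodule.mem_sup_left hy)
          rwa [map_add, LinearMap.add_apply, hiso x₁ hx₁ y hy, zero_add] at this
        subst h2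
        rw [add_zero] at hxy ⊢
        exact hpair x₁ hx₁ fun y hy => hxy y (Submodule.mem_sup_right hy)
      · have := Submodule.finrank_sup_add_finrank_inf_eq W W'
        rw [hWW', finrank_bot, add_zero, hfin] at this
        exact ⟨_, this⟩

/-- A semisimple orthogonal representation with an odd-dimensional irreducible orthogonal
subrepresentation has a non-degenerate stable subspace of odd dimension. -/
theorem exists_nondegenerateOn_odd [FiniteDimensional ℂ M] {B : M →ₗ[ℂ] M →ₗ[ℂ] ℂ}
    (hρ : ρ.IsSemisimpleRepresentation) (hB : IsSelfDualForm ρ 1 B) (W : Subrepresentation ρ)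
    (hirr : W.toRepresentation.IsIrreducible) (horth : IsOrthogonal W.toRepresentation)
    (hodd : Odd (finrank ℂ W.toSubmodule)) :
    ∃ V : Submodule ℂ M, (∀ g, ∀ x ∈ V, ρ g x ∈ V) ∧ NondegenerateOn B V ∧ Odd (finrank ℂ V) := by
  have hsymm : ∀ m n, B n m = B m n := fun m n => by rw [hB.2.2, one_mul]
  obtain ⟨b, hb, hbinv, hbsymm⟩ := horth
  -- an equivariant injection of `W` either has non-degenerate or isotropic image
  have dich : ∀ f : W.toSubmodule →ₗ[ℂ] M, Function.Injective f →
      (∀ g x, f (W.toRepresentation g x) = ρ g (f x)) →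
      (∃ V : Submodule ℂ M, (∀ g, ∀ x ∈ V, ρ g x ∈ V) ∧ NondegenerateOn B V ∧ Odd (finrank ℂ V)) ∨
        ∀ x y, B (f x) (f y) = 0 := by
    intro f hf hfe
    have hst : ∀ g, ∀ x ∈ LinearMap.range f, ρ g x ∈ LinearMap.range f := by
      rintro g _ ⟨x, rfl⟩
      exact ⟨_, hfe g x⟩
    rcases minimal_of_isIrreducible hirr (W' := (orthoCompl B (LinearMap.range f)).comap f)
      (fun g x hx => by
        rw [Submodule.mem_comap, hfe]
        exact orthoCompl_stable hB.2.1 hst g _ hx) with h | h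
    · left
      refine ⟨LinearMap.range f, hst, ?_, ?_⟩
      · rintro _ ⟨x, rfl⟩ hxy
        have : x ∈ (orthoCompl B (LinearMap.range f)).comap f := hxy
        rw [h] at this
        rw [(Submodule.mem_bot ℂ).mp this, map_zero]
      · rwa [LinearMap.finrank_range_of_inj hf]
    · right
      intro x y
      have : x ∈ (orthoCompl B (LinearMap.range f)).comap f := by rw [h]; trivial
      exact this _ ⟨y, rfl⟩
  -- The given form `b` on `W` need not be the restriction of `B`, which may vanish on `W`; then
  -- another copy of `W` has to be found in `M`.
  rcases dich W.toSubmodule.subtype W.toSubmodule.injective_subtype fun g x => rfl with h | hiso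
  · exact h
  obtain ⟨P, hP, hPc⟩ := (isSemisimple_iff_exists_proj ρ).mp hρ _
    (orthoCompl_stable hB.2.1 W.apply_mem_toSubmodule)
  -- the restriction map from a complement of the orthogonal space to the dual of `W`
  let r : LinearMap.ker P →ₗ[ℂ] Dual ℂ W.toSubmodule :=
    B.domRestrict₁₂ (LinearMap.ker P) W.toSubmodule
  have hr : ∀ x y, r x y = B x y := fun _ _ => rfl
  have hrinj : Function.Injective r := by
    rw [injective_iff_map_eq_zero]
    rintro ⟨x, hx⟩ h0
    have hx' : x ∈ orthoCompl B W.toSubmodule := fun y hy => LinearMap.congr_fun h0 ⟨y, hy⟩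
    apply Subtype.ext
    rw [LinearMap.mem_ker, hP.map_id x hx'] at hx
    exact hx
  -- Non-degeneracy of `B` makes the restriction map `r` an isomorphism from `ker P` onto the dual
  -- of `W`.
  have hfin : finrank ℂ (Dual ℂ W.toSubmodule) ≤ finrank ℂ (LinearMap.ker P) := by
    rw [Subspace.dual_finrank_eq]
    refine finrank_le_of_pairing (B := B) fun x hx hxy => hB.1.1 x fun y => ?_
    have h1 : B x (P y) = 0 := by rw [hsymm]; exact hP.map_mem y x hx
    have h2 : B x (y - P y) = 0 := hxy _ (by
      rw [LinearMap.mem_ker, map_sub, hP.map_id _ (hP.map_mem y), sub_self])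
    rw [← sub_add_cancel y (P y), map_add, h1, h2, add_zero]
  let e := LinearMap.linearEquivOfInjective r hrinj
    (le_antisymm (LinearMap.finrank_le_finrank_of_injective hrinj) hfin)
  -- Since `b` identifies `W` with its dual, this embeds a second copy of `W` in `M`, and `B` pairs
  -- it with the first copy exactly as `b` does.
  let f : W.toSubmodule →ₗ[ℂ] M := (LinearMap.ker P).subtype ∘ₗ e.symm.toLinearMap ∘ₗ b
  have hfP : ∀ x, P (f x) = 0 := fun x => (e.symm (b x)).2
  have hfB : ∀ x y : W.toSubmodule, B (f x) y = b x y := fun x y =>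
    LinearMap.congr_fun (e.apply_symm_apply (b x)) y
  have huniq : ∀ x y, P x = 0 → P y = 0 → (∀ w : W.toSubmodule, B x w = B y w) → x = y := by
    intro x y hx hy hxy
    have := @hrinj ⟨x, hx⟩ ⟨y, hy⟩ (LinearMap.ext hxy)
    exact congrArg Subtype.val this
  have hfe : ∀ g x, f (W.toRepresentation g x) = ρ g (f x) := by
    intro g x
    refine huniq _ _ (hfP _) ?_ fun w => ?_
    · have := LinearMap.congr_fun (hPc g) (f x)
      rw [Module.End.mul_apply, Module.End.mul_apply, hfP, map_zero] at this
      exact this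
    · obtain ⟨w, rfl⟩ : ∃ w', w = W.toRepresentation g w' := ⟨W.toRepresentation g⁻¹ w, by
        rw [← Module.End.mul_apply, ← map_mul, mul_inv_cancel, map_one, Module.End.one_apply]⟩
      rw [hfB, hbinv]
      exact ((hB.2.1 g (f x) w).trans (hfB x w)).symm
  have hfinj : Function.Injective f := by
    rw [injective_iff_map_eq_zero]
    exact fun x hx => hb.1 x fun y => by rw [← hfB, hx, map_zero, LinearMap.zero_apply]
  rcases dich f hfinj hfe with h | hiso'
  · exact h
  -- If both copies are isotropic, the diagonal copy carries the form `2b`, which is non-degenerate.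
  have hsum : ∀ x y, B ((W.toSubmodule.subtype + f) x) ((W.toSubmodule.subtype + f) y) =
      2 * b x y := by
    intro x y
    have h1 : B (x : M) (y : M) = 0 := hiso x y
    have h2 : B (x : M) (f y) = b x y := by rw [hsymm, hfB, hbsymm, one_mul]
    show B (x + f x) (y + f y) = _
    simp only [map_add, LinearMap.add_apply, h1, h2, hfB, hiso']
    ring
  rcases dich (W.toSubmodule.subtype + f) (by
      rw [injective_iff_map_eq_zero]
      intro x hx
      refine hb.1 x fun y => ?_
      have := hsum x y
      rw [hx, map_zero, LinearMap.zero_apply] at this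
      simpa using this.symm) (fun g x => by
      show _ + _ = ρ g (x + f x)
      rw [hfe, map_add]; rfl) with h | h
  · exact h
  · exfalso
    have hb0 : ∀ x : W.toSubmodule, x = 0 := fun x => hb.1 x fun y => by
      have := (hsum x y).symm.trans (h x y)
      simpa using this
    have hz : finrank ℂ W.toSubmodule = 0 := by
      have : Subsingleton W.toSubmodule := ⟨fun x y => (hb0 x).trans (hb0 y).symm⟩
      exact finrank_zero_of_subsingleton
    rw [hz] at hodd
    exact absurd hodd (by decide)

/-- In one direction, the reflection in a non-degenerate odd-dimensional stable subspace. In the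
other, the generalized eigenspace for -1 of an equivariant isometry of determinant -1 is stable,
non-degenerate and of odd dimension. -/
theorem not_orthogonalSummandsEven_iff [FiniteDimensional ℂ M] {B : M →ₗ[ℂ] M →ₗ[ℂ] ℂ}
    (hρ : ρ.IsSemisimpleRepresentation) (hB : IsSelfDualForm ρ 1 B) :
    ¬ OrthogonalSummandsEven ρ ↔ ∃ a ∈ centralizerC ρ B, LinearMap.det (a : End ℂ M) = -1 := by
  have hsymm : ∀ m n, B n m = B m n := fun m n => by rw [hB.2.2, one_mul]
  constructor
  · intro h
    unfold OrthogonalSummandsEven at h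
    push Not at h
    obtain ⟨W, hirr, horth, hodd⟩ := h
    obtain ⟨V, hst, hnd, hV⟩ := exists_nondegenerateOn_odd hρ hB W hirr horth
      (Nat.not_even_iff_odd.mp hodd)
    exact exists_centralizer_det_neg_one hB hst hnd hV
  · rintro ⟨a, ha, hdet⟩ hev
    obtain ⟨E, hE, hnd, hdetE⟩ := exists_det_isometry hB.1 hB.2.2 (a := (a : End ℂ M)) ha.1
    have hodd : Odd (finrank ℂ E) := by
      by_contra h
      rw [(Nat.not_odd_iff_even.mp h).neg_one_pow, hdet] at hdetE
      norm_num at hdetE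
    obtain ⟨W, hirr, horth, hWodd⟩ := exists_irreducible_odd hρ hB.2.1 hsymm _ E
      (fun g => hE (ρ g) (LinearMap.ext fun m => ha.2 g m)) hnd rfl hodd
    exact Nat.not_even_iff_odd.mpr hWodd (hev W hirr horth)

end OrthogonalSummands
end ClassicalPar

namespace ClassicalPar

open Module Matrix

/-! ### The unitary trick for SL₂(ℂ) -/

section SL2

/-- The special unitary group inside `SL₂(ℂ)`. -/
def specialUnitary : Subgroup (Matrix.SpecialLinearGroup (Fin 2) ℂ) where
  carrier := {g | star (g : Matrix (Fin 2) (Fin 2) ℂ) * g = 1}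
  mul_mem' {a b} ha hb := by
    show star (a.1 * b.1) * (a.1 * b.1) = 1
    rw [star_mul, mul_assoc, ← mul_assoc (star a.1), show star a.1 * a.1 = 1 from ha, one_mul]
    exact hb
  one_mem' := by simp
  inv_mem' {a} ha := by
    have h1 : a.1 * (a⁻¹).1 = 1 := congrArg Subtype.val (mul_inv_cancel a)
    have h2 : star a.1 = (a⁻¹).1 := by
      calc star a.1 = star a.1 * (a.1 * (a⁻¹).1) := by rw [h1, mul_one]
        _ = (a⁻¹).1 := by rw [← mul_assoc, show star a.1 * a.1 = 1 from ha, one_mul]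
    show star (a⁻¹).1 * (a⁻¹).1 = 1
    rw [← h2, star_star, h2, h1]

noncomputable section

/-- A closed condition on matrices, and the entries of a unitary matrix are bounded by 1. -/
theorem isCompact_specialUnitary : IsCompact (specialUnitary : Set (Matrix.SpecialLinearGroup (Fin 2) ℂ)) := by
  have hind : Topology.IsInducing (Subtype.val : Matrix.SpecialLinearGroup (Fin 2) ℂ → Matrix (Fin 2) (Fin 2) ℂ) :=
    Topology.IsInducing.subtypeVal
  refine hind.isCompact_iff.mpr ?_
  have himg : Subtype.val '' (specialUnitary : Set (Matrix.SpecialLinearGroup (Fin 2) ℂ)) =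
      {A : Matrix (Fin 2) (Fin 2) ℂ | star A * A = 1 ∧ A.det = 1} := by
    ext A
    constructor
    · rintro ⟨g, hg, rfl⟩
      exact ⟨hg, g.2⟩
    · rintro ⟨h1, h2⟩
      exact ⟨⟨A, h2⟩, h1, rfl⟩
  rw [himg]
  have hK : IsCompact (Set.univ.pi fun _ : Fin 2 => Set.univ.pi fun _ : Fin 2 =>
      Metric.closedBall (0 : ℂ) 1) :=
    isCompact_univ_pi fun _ => isCompact_univ_pi fun _ => isCompact_closedBall _ _
  refine IsCompact.of_isClosed_subset (X := Matrix (Fin 2) (Fin 2) ℂ) hK ?_ ?_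
  · refine IsClosed.inter (s₁ := {A : Matrix (Fin 2) (Fin 2) ℂ | star A * A = 1})
      (s₂ := {A : Matrix (Fin 2) (Fin 2) ℂ | A.det = 1}) ?_ ?_
    · exact isClosed_eq (by fun_prop) continuous_const
    · exact isClosed_eq (continuous_id.matrix_det) continuous_const
  · rintro A ⟨hA, -⟩ i _ j _
    rw [mem_closedBall_zero_iff]
    exact entry_norm_bound_of_unitary (mem_unitaryGroup_iff'.mpr hA) i j

instance : CompactSpace specialUnitary := isCompact_iff_compactSpace.mp isCompact_specialUnitary

/-- The diagonal matrix with entries `z`, `z⁻¹`. -/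
def diagSL (z : ℂ) (hz : z ≠ 0) : Matrix.SpecialLinearGroup (Fin 2) ℂ := ⟨!![z, 0; 0, z⁻¹], by simp [hz]⟩

/-- A complex rotation. -/
def rotSL (x y : ℂ) (h : x ^ 2 + y ^ 2 = 1) : Matrix.SpecialLinearGroup (Fin 2) ℂ :=
  ⟨!![x, y; -y, x], by rw [det_fin_two_of]; linear_combination h⟩

/-- An upper triangular unipotent matrix. -/
def upperSL (c : ℂ) : Matrix.SpecialLinearGroup (Fin 2) ℂ := ⟨!![1, c; 0, 1], by simp⟩

/-- A lower triangular unipotent matrix. -/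
def lowerSL (c : ℂ) : Matrix.SpecialLinearGroup (Fin 2) ℂ := ⟨!![1, 0; c, 1], by simp⟩

/-- The matrix exchanging the coordinate axes. -/
def weylSL : Matrix.SpecialLinearGroup (Fin 2) ℂ := ⟨!![0, 1; -1, 0], by simp⟩

/-- SU(2) and the diagonal torus generate SL₂(ℂ): unitary conjugation of the torus gives the complex
rotations, torus-rotation-torus products give all matrices without zero entries, and from these come
the unipotent matrices. -/
theorem eq_top_of_specialUnitary_le {S : Subgroup (Matrix.SpecialLinearGroup (Fin 2) ℂ)} (hK : specialUnitary ≤ S)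
    (hT : ∀ z hz, diagSL z hz ∈ S) : S = ⊤ := by
  have hw : weylSL ∈ S := hK (by
    show star !![(0 : ℂ), 1; -1, 0] * !![0, 1; -1, 0] = 1
    ext i j
    fin_cases i <;> fin_cases j <;> simp [Matrix.mul_apply])
  have hrot : ∀ x y h, rotSL x y h ∈ S := by
    intro x y h
    have h1 : (x + Complex.I * y) * (x - Complex.I * y) = 1 := by
      linear_combination h - y ^ 2 * Complex.I_sq
    have h0 : x + Complex.I * y ≠ 0 := left_ne_zero_of_mul_eq_one h1
    have hinv : (x + Complex.I * y)⁻¹ = x - Complex.I * y := inv_eq_of_mul_eq_one_right h1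
    let c : ℂ := ((√2)⁻¹ : ℝ)
    have hc : c * c = 1 / 2 := by
      show (((√2)⁻¹ : ℝ) : ℂ) * (((√2)⁻¹ : ℝ) : ℂ) = 1 / 2
      rw [← Complex.ofReal_mul, ← mul_inv, Real.mul_self_sqrt zero_le_two]
      norm_num
    have hcs : (starRingEnd ℂ) c = c := Complex.conj_ofReal _
    -- The normalised eigenvectors `(1, i)` and `(i, 1)` of every complex rotation; the eigenvalues
    -- are `x ± iy`.
    let u : Matrix.SpecialLinearGroup (Fin 2) ℂ := ⟨!![c, Complex.I * c; Complex.I * c, c], by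
      rw [det_fin_two_of]
      linear_combination (1 - Complex.I ^ 2) * hc - 1 / 2 * Complex.I_sq⟩
    have hu : u ∈ specialUnitary := by
      show star !![c, Complex.I * c; Complex.I * c, c] * !![c, Complex.I * c; Complex.I * c, c] = 1
      ext i j
      fin_cases i <;> fin_cases j <;> simp [Matrix.mul_apply, hcs] <;>
        first | linear_combination (1 - Complex.I ^ 2) * hc - 1 / 2 * Complex.I_sq | ring
    have hprod : rotSL x y h * u = u * diagSL _ h0 := by
      apply Subtype.ext
      show !![x, y; -y, x] * !![c, Complex.I * c; Complex.I * c, c] =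
        !![c, Complex.I * c; Complex.I * c, c] *
          !![x + Complex.I * y, 0; 0, (x + Complex.I * y)⁻¹]
      rw [hinv]
      ext i j
      fin_cases i <;> fin_cases j <;> simp [Matrix.mul_apply] <;> ring_nf <;>
        simp only [Complex.I_sq] <;> ring
    rw [eq_mul_inv_of_mul_eq hprod]
    exact S.mul_mem (S.mul_mem (hK hu) (hT _ _)) (S.inv_mem (hK hu))
  have hgen : ∀ g : Matrix.SpecialLinearGroup (Fin 2) ℂ, g 0 0 ≠ 0 → g 0 1 ≠ 0 → g 1 0 ≠ 0 → g 1 1 ≠ 0 → g ∈ S := by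
    intro g hp hq hr hs
    have hdet : g 0 0 * g 1 1 - g 0 1 * g 1 0 = 1 := by rw [← det_fin_two]; exact g.2
    set p := g 0 0
    set q := g 0 1
    set r := g 1 0
    set s := g 1 1
    -- The product of `diag(a)`, the rotation by `(x, y)` and `diag(b)` has entries `axb, ay/b,
    -- -yb/a, x/(ab)`. Hence `x² = ps`, `y² = -qr`, with `x² + y² = 1` the determinant relation, and
    -- `b = p/(xa)`, `a² = pq/(xy)`.
    obtain ⟨x, hx⟩ := IsAlgClosed.exists_pow_nat_eq (p * s) (n := 2) two_pos
    obtain ⟨y, hy⟩ := IsAlgClosed.exists_pow_nat_eq (-(q * r)) (n := 2) two_pos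
    have hx0 : x ≠ 0 := by
      rintro rfl
      exact mul_ne_zero hp hs (by rw [← hx]; norm_num)
    have hy0 : y ≠ 0 := by
      rintro rfl
      exact neg_ne_zero.mpr (mul_ne_zero hq hr) (by rw [← hy]; norm_num)
    obtain ⟨a, ha⟩ := IsAlgClosed.exists_pow_nat_eq (p * q / (x * y)) (n := 2) two_pos
    have ha0 : a ≠ 0 := by
      rintro rfl
      exact div_ne_zero (mul_ne_zero hp hq) (mul_ne_zero hx0 hy0) (by rw [← ha]; norm_num)
    have hb0 : p / (x * a) ≠ 0 := div_ne_zero hp (mul_ne_zero hx0 ha0)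
    have ha' : a ^ 2 * (x * y) = p * q := by
      rw [ha, div_mul_cancel₀ _ (mul_ne_zero hx0 hy0)]
    have hxy : x ^ 2 + y ^ 2 = 1 := by rw [hx, hy]; linear_combination hdet
    have hg : g = diagSL a ha0 * rotSL x y hxy * diagSL _ hb0 := by
      apply Subtype.ext
      show g.1 = !![a, 0; 0, a⁻¹] * !![x, y; -y, x] * !![p / (x * a), 0; 0, (p / (x * a))⁻¹]
      rw [eta_fin_two g.1]
      ext i j
      fin_cases i <;> fin_cases j <;> simp [Matrix.mul_apply]
      · show p = _
        field_simp
      · show q = _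
        field_simp
        linear_combination -ha'
      · show r = _
        field_simp
        have h1 : q * (r * (a ^ 2 * x)) = q * (-(y * p)) := by
          have : q * r = -y ^ 2 := by rw [hy]; ring
          have h2 : y * (q * (r * (a ^ 2 * x))) = y * (q * (-(y * p))) := by
            linear_combination (a ^ 2 * x * y) * this - y ^ 2 * ha'
          exact mul_left_cancel₀ hy0 h2
        linear_combination mul_left_cancel₀ hq h1
      · show s = _
        field_simp
        linear_combination -hx
    rw [hg]
    exact S.mul_mem (S.mul_mem (hT _ _) (hrot _ _ _)) (hT _ _)
  -- A rotation with coordinates 3/5 and 4/5 moves this unipotent to a matrix without zero entries.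
  have hup1 : upperSL 1 ∈ S := by
    have hr : (3 / 5 : ℂ) ^ 2 + (4 / 5) ^ 2 = 1 := by norm_num
    have h : rotSL (3 / 5) (4 / 5) hr * upperSL 1 ∈ S := by
      have hval : (rotSL (3 / 5) (4 / 5) hr * upperSL 1).1 = !![3 / 5, 7 / 5; -(4 / 5), -(1 / 5)] := by
        show !![(3 / 5 : ℂ), 4 / 5; -(4 / 5), 3 / 5] * !![1, 1; 0, 1] = _
        ext i j
        fin_cases i <;> fin_cases j <;> simp [Matrix.mul_apply] <;> norm_num
      refine hgen _ ?_ ?_ ?_ ?_ <;> rw [hval] <;> simp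
    exact (S.mul_mem_cancel_left (hrot _ _ hr)).mp h
  have hup : ∀ c, upperSL c ∈ S := by
    intro c
    by_cases hc : c = 0
    · have : upperSL c = 1 := by
        apply Subtype.ext
        rw [hc]
        exact one_fin_two.symm
      rw [this]; exact S.one_mem
    -- Conjugation by `diag(z, z⁻¹)` multiplies the unipotent coordinate by `z²`.
    obtain ⟨z, hz⟩ := IsAlgClosed.exists_pow_nat_eq c (n := 2) two_pos
    have hz0 : z ≠ 0 := by
      rintro rfl
      exact hc (by rw [← hz]; norm_num)
    have : upperSL c * diagSL z hz0 = diagSL z hz0 * upperSL 1 := by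
      apply Subtype.ext
      show !![1, c; 0, 1] * !![z, 0; 0, z⁻¹] = !![z, 0; 0, z⁻¹] * !![1, 1; 0, 1]
      ext i j
      fin_cases i <;> fin_cases j <;> simp [Matrix.mul_apply, ← hz]
      field_simp
    rw [eq_mul_inv_of_mul_eq this]
    exact S.mul_mem (S.mul_mem (hT _ _) hup1) (S.inv_mem (hT _ _))
  have hlow : ∀ c, lowerSL c ∈ S := by
    intro c
    have : lowerSL c * weylSL = weylSL * upperSL (-c) := by
      apply Subtype.ext
      show !![1, 0; c, 1] * !![0, 1; -1, 0] = !![0, 1; -1, 0] * !![1, -c; 0, 1]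
      ext i j
      fin_cases i <;> fin_cases j <;> simp [Matrix.mul_apply]
    rw [eq_mul_inv_of_mul_eq this]
    exact S.mul_mem (S.mul_mem hw (hup _)) (S.inv_mem hw)
  have hgen' : ∀ g : Matrix.SpecialLinearGroup (Fin 2) ℂ, g 1 0 ≠ 0 → g ∈ S := by
    intro g hr
    have hdet : g 0 0 * g 1 1 - g 0 1 * g 1 0 = 1 := by rw [← det_fin_two]; exact g.2
    have : g = upperSL ((g 0 0 - 1) / g 1 0) * lowerSL (g 1 0) * upperSL ((g 1 1 - 1) / g 1 0) := by
      apply Subtype.ext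
      show g.1 = !![1, (g 0 0 - 1) / g 1 0; 0, 1] * !![1, 0; g 1 0, 1] *
        !![1, (g 1 1 - 1) / g 1 0; 0, 1]
      rw [eta_fin_two g.1]
      change g.1 1 0 ≠ 0 at hr
      change g.1 0 0 * g.1 1 1 - g.1 0 1 * g.1 1 0 = 1 at hdet
      ext i j
      fin_cases i <;> fin_cases j <;> simp [Matrix.mul_apply] <;> field_simp <;>
        first | (ring; done) | linear_combination -hdet
    rw [this]
    exact S.mul_mem (S.mul_mem (hup _) (hlow _)) (hup _)
  rw [eq_top_iff]
  intro g _
  by_cases hr : g 1 0 = 0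
  -- Multiplication by the Weyl element puts `-g 0 0`, nonzero in this case, in the lower left
  -- corner.
  · refine (S.mul_mem_cancel_left hw).mp (hgen' _ ?_)
    have hdet : g 0 0 * g 1 1 - g 0 1 * g 1 0 = 1 := by rw [← det_fin_two]; exact g.2
    have h00 : g 0 0 ≠ 0 := by
      intro h
      rw [h, hr] at hdet
      norm_num at hdet
    show (!![(0 : ℂ), 1; -1, 0] * g.1) 1 0 ≠ 0
    simpa [Matrix.mul_apply] using h00
  · exact hgen' g hr

/-- An algebraic function on `SL₂(ℂ)` which vanishes on the special unitary group vanishes on the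
diagonal torus. -/
theorem eval_diagSL_eq_zero (P : MvPolynomial (Fin 2 × Fin 2) ℂ)
    (h : ∀ g ∈ specialUnitary, MvPolynomial.eval (fun ij => g.1 ij.1 ij.2) P = 0)
    (z : ℂ) (hz : z ≠ 0) :
    MvPolynomial.eval (fun ij => (diagSL z hz).1 ij.1 ij.2) P = 0 := by
  -- The torus is parametrised by `t ↦ diag(e^{it}, e^{-it})`, which is entire in `t` and unitary
  -- for real `t`.
  let E : ℂ → Fin 2 × Fin 2 → ℂ := fun t ij =>
    (diagSL (Complex.exp (Complex.I * t)) (Complex.exp_ne_zero _)).1 ij.1 ij.2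
  have hE : ∀ ij, Differentiable ℂ fun t => E t ij := by
    rintro ⟨i, j⟩
    have h1 : Differentiable ℂ fun t => Complex.exp (Complex.I * t) := by fun_prop
    fin_cases i <;> fin_cases j <;> simp only [E, diagSL]
    · exact h1
    · exact differentiable_const _
    · exact differentiable_const _
    · exact h1.inv fun t => Complex.exp_ne_zero _
  have hF : ∀ P : MvPolynomial (Fin 2 × Fin 2) ℂ,
      Differentiable ℂ fun t => MvPolynomial.eval (E t) P := by
    intro P
    induction P using MvPolynomial.induction_on with
    | C a => simp
    | add p q hp hq => simp only [map_add]; exact hp.add hq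
    | mul_X p i hp => simp only [map_mul, MvPolynomial.eval_X]; exact hp.mul (hE i)
  have hreal : ∀ t : ℝ, MvPolynomial.eval (E t) P = 0 := by
    intro t
    refine h _ ?_
    have hn : (starRingEnd ℂ) (Complex.exp (Complex.I * t)) = (Complex.exp (Complex.I * t))⁻¹ := by
      rw [← Complex.exp_conj, ← Complex.exp_neg, map_mul, Complex.conj_I, Complex.conj_ofReal,
        neg_mul]
    have h0 := Complex.exp_ne_zero (Complex.I * t)
    show star !![Complex.exp (Complex.I * t), 0; 0, (Complex.exp (Complex.I * t))⁻¹] *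
      !![Complex.exp (Complex.I * t), 0; 0, (Complex.exp (Complex.I * t))⁻¹] = 1
    ext i j
    fin_cases i <;> fin_cases j <;> simp [Matrix.mul_apply, hn, h0]
  have hzero : ∀ t, MvPolynomial.eval (E t) P = 0 := by
    have han : AnalyticOnNhd ℂ (fun t => MvPolynomial.eval (E t) P) Set.univ :=
      (hF P).differentiableOn.analyticOnNhd isOpen_univ
    -- The real points `1/(n+1)` accumulate at 0, so the identity theorem applies.
    have hfreq : ∃ᶠ t in 𝓝[≠] (0 : ℂ), MvPolynomial.eval (E t) P = (0 : ℂ → ℂ) t := by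
      have htend : Filter.Tendsto (fun n : ℕ => ((1 / ((n : ℝ) + 1) : ℝ) : ℂ)) Filter.atTop
          (𝓝[≠] (0 : ℂ)) := by
        refine tendsto_nhdsWithin_iff.mpr ⟨?_, Filter.Eventually.of_forall fun n => ?_⟩
        · rw [← Complex.ofReal_zero]
          exact (Complex.continuous_ofReal.tendsto 0).comp tendsto_one_div_add_atTop_nhds_zero_nat
        · have : (1 / ((n : ℝ) + 1) : ℝ) ≠ 0 := by positivity
          exact Complex.ofReal_ne_zero.mpr this
      exact htend.frequently (Filter.Frequently.of_forall fun n => hreal _)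
    have := han.eq_of_frequently_eq (fun _ _ => analyticAt_const) hfreq
    exact fun t => congrFun this t
  obtain ⟨t, ht⟩ : ∃ t, Complex.exp (Complex.I * t) = z :=
    ⟨-Complex.I * Complex.log z, by
      rw [← mul_assoc, mul_neg, Complex.I_mul_I, neg_neg, one_mul, Complex.exp_log hz]⟩
  subst ht
  exact hzero t

/-- Averaging a projection over the special unitary group. -/
theorem exists_proj_of_isAlgebraic {M : Type*} [AddCommGroup M] [Module ℂ M] [FiniteDimensional ℂ M]
    (R : Representation ℂ (Matrix.SpecialLinearGroup (Fin 2) ℂ) M)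
    (hR : ∀ (m : M) (l : M →ₗ[ℂ] ℂ), IsAlgebraicFun fun g => l (R g m))
    {W : Submodule ℂ M} (hW : ∀ g, ∀ x ∈ W, R g x ∈ W) {P : End ℂ M} (hP : LinearMap.IsProj W P) :
    ∃ P' : End ℂ M, LinearMap.IsProj W P' ∧ (∀ g, Commute P' (R g)) ∧
      ∀ Z : End ℂ M, Commute P Z → (∀ g, Commute (R g) Z) → Commute P' Z := by
  let _ : MeasurableSpace specialUnitary := borel _
  have : BorelSpace specialUnitary := ⟨rfl⟩
  let μ : MeasureTheory.Measure specialUnitary := MeasureTheory.Measure.haarMeasure ⊤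
  have hμ : μ Set.univ = 1 := MeasureTheory.Measure.haarMeasure_self (K₀ := ⊤)
  have : MeasureTheory.IsProbabilityMeasure μ := ⟨hμ⟩
  have hval : Continuous
      (Subtype.val : Matrix.SpecialLinearGroup (Fin 2) ℂ → Matrix (Fin 2) (Fin 2) ℂ) :=
    (Topology.IsInducing.subtypeVal : Topology.IsInducing
      (Subtype.val : Matrix.SpecialLinearGroup (Fin 2) ℂ → Matrix (Fin 2) (Fin 2) ℂ)).continuous
  have hcont : ∀ m (l : M →ₗ[ℂ] ℂ), Continuous fun k : specialUnitary => l (R k m) := by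
    intro m l
    obtain ⟨p, hp⟩ := hR m l
    simp only [hp]
    refine (MvPolynomial.continuous_eval p).comp (continuous_pi fun ij => ?_)
    exact (continuous_apply_apply ij.1 ij.2).comp
      (hval.comp continuous_subtype_val)
  let b := finBasis ℂ M
  let F : specialUnitary → End ℂ M := fun k => R k * P * R (k : Matrix.SpecialLinearGroup (Fin 2) ℂ)⁻¹
  have hFc : ∀ m (l : M →ₗ[ℂ] ℂ), Continuous fun k => l (F k m) := by
    intro m l
    -- A coefficient of the conjugate of `P` is a finite sum of products of coefficients of `R k`
    -- and of `R k⁻¹`, which are continuous.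
    have heq : ∀ k, l (F k m) = ∑ j, b.coord j (R (k⁻¹ : specialUnitary) m) * l (R k (P (b j))) := by
      intro k
      show l (R k (P (R (k : Matrix.SpecialLinearGroup (Fin 2) ℂ)⁻¹ m))) = _
      conv_lhs => rw [← b.sum_repr (R (k : Matrix.SpecialLinearGroup (Fin 2) ℂ)⁻¹ m)]
      simp only [map_sum, map_smul, smul_eq_mul]
      rfl
    simp only [heq]
    exact continuous_finsetSum _ fun j _ =>
      ((hcont m (b.coord j)).comp continuous_inv).mul (hcont _ l)
  have hFi : ∀ m (l : M →ₗ[ℂ] ℂ), MeasureTheory.Integrable (fun k => l (F k m)) μ := fun m l =>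
    (hFc m l).integrable_of_hasCompactSupport (HasCompactSupport.of_compactSpace _)
  -- The Haar average, formed coordinate by coordinate so that only scalar functions are integrated.
  let P' : End ℂ M :=
    { toFun := fun m => ∑ j, (∫ k, b.coord j (F k m) ∂μ) • b j
      map_add' := fun x y => by
        simp only [map_add]
        rw [← Finset.sum_add_distrib]
        refine Finset.sum_congr rfl fun j _ => ?_
        rw [MeasureTheory.integral_add (hFi _ _) (hFi _ _), add_smul]
      map_smul' := fun c x => by
        simp only [map_smul, smul_eq_mul, RingHom.id_apply]
        rw [Finset.smul_sum]
        refine Finset.sum_congr rfl fun j _ => ?_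
        rw [MeasureTheory.integral_const_mul, mul_smul] }
  have hP' : ∀ m (l : M →ₗ[ℂ] ℂ), l (P' m) = ∫ k, l (F k m) ∂μ := by
    intro m l
    have h1 : ∀ x, l x = ∑ j, b.coord j x * l (b j) := by
      intro x
      conv_lhs => rw [← b.sum_repr x]
      simp only [map_sum, map_smul, smul_eq_mul]
      rfl
    show l (∑ j, (∫ k, b.coord j (F k m) ∂μ) • b j) = _
    simp only [map_sum, map_smul, smul_eq_mul]
    rw [MeasureTheory.integral_congr_ae (Filter.Eventually.of_forall fun k => h1 (F k m)),
      MeasureTheory.integral_finsetSum _ fun j _ => (hFi m (b.coord j)).mul_const _]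
    exact Finset.sum_congr rfl fun j _ => (MeasureTheory.integral_mul_const _ _).symm
  have hext : ∀ x y : M, (∀ l : M →ₗ[ℂ] ℂ, l x = l y) → x = y := fun x y h =>
    b.ext_elem fun j => h (b.coord j)
  have hK : ∀ h : specialUnitary, Commute P' (R h) := by
    intro h
    refine LinearMap.ext fun m => hext _ _ fun l => ?_
    show l (P' (R h m)) = (l ∘ₗ R h) (P' m)
    rw [hP', hP', ← MeasureTheory.integral_mul_left_eq_self _ h]
    refine MeasureTheory.integral_congr_ae (Filter.Eventually.of_forall fun k => ?_)
    show l ((R (h * k) * P * R (h * k)⁻¹) (R h m)) = l (R h ((R k * P * R k⁻¹) m))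
    simp only [← Module.End.mul_apply, _root_.mul_inv_rev, map_mul, mul_assoc]
    rw [← map_mul R _ (h : Matrix.SpecialLinearGroup (Fin 2) ℂ), inv_mul_cancel, map_one, mul_one]
  have hall : ∀ g, Commute P' (R g) := by
    let S : Subgroup (Matrix.SpecialLinearGroup (Fin 2) ℂ) :=
      { carrier := {g | Commute P' (R g)}
        mul_mem' := fun {a b} ha hb => by
          show Commute P' (R (a * b))
          rw [map_mul]
          exact ha.mul_right hb
        one_mem' := by
          show Commute P' (R 1)
          rw [map_one]
          exact Commute.one_right _
        inv_mem' := fun {a} ha => by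
          have h1 : R a * R a⁻¹ = 1 := by rw [← map_mul, mul_inv_cancel, map_one]
          have h2 : R a⁻¹ * R a = 1 := by rw [← map_mul, inv_mul_cancel, map_one]
          show P' * R a⁻¹ = R a⁻¹ * P'
          calc P' * R a⁻¹ = R a⁻¹ * (R a * P') * R a⁻¹ := by rw [← mul_assoc, h2, one_mul]
            _ = R a⁻¹ * P' * (R a * R a⁻¹) := by rw [← (show P' * R a = R a * P' from ha)]; simp only [mul_assoc]
            _ = _ := by rw [h1, mul_one] }
    have hS : S = ⊤ := by
      -- Commuting with `P'` is, for each coefficient, a polynomial condition on `g`. It holds on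
      -- SU(2) by invariance of Haar measure, hence on the torus, hence on all of SL₂(ℂ).
      refine eq_top_of_specialUnitary_le (fun g hg => hK ⟨g, hg⟩) fun z hz => ?_
      refine LinearMap.ext fun m => hext _ _ fun l => ?_
      obtain ⟨p, hp⟩ := hR m (l ∘ₗ P')
      obtain ⟨q, hq⟩ := hR (P' m) l
      rw [← sub_eq_zero]
      have := eval_diagSL_eq_zero (p - q) (fun g hg => by
        rw [map_sub, ← hp, ← hq, sub_eq_zero]
        exact congrArg l (LinearMap.congr_fun (hK ⟨g, hg⟩) m)) z hz
      rwa [map_sub, ← hp, ← hq] at this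
    intro g
    have : g ∈ S := by rw [hS]; trivial
    exact this
  refine ⟨P', ⟨fun m => ?_, fun x hx => hext _ _ fun l => ?_⟩, hall, fun Z hZ hRZ =>
    LinearMap.ext fun m => hext _ _ fun l => ?_⟩
  -- A functional vanishing on `W` but not at `P' m` would have as value there the integral of 0.
  · by_contra hm
    obtain ⟨l, hl, hlW⟩ := Submodule.exists_le_ker_of_notMem hm
    apply hl
    rw [hP']
    refine MeasureTheory.integral_eq_zero_of_ae (Filter.Eventually.of_forall fun k => ?_)
    exact hlW (hW _ _ (hP.map_mem _))
  · rw [hP']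
    have : ∀ k, F k x = x := by
      intro k
      show R k (P (R (k : Matrix.SpecialLinearGroup (Fin 2) ℂ)⁻¹ x)) = x
      rw [hP.map_id _ (hW _ x hx), ← Module.End.mul_apply, ← map_mul, mul_inv_cancel, map_one,
        Module.End.one_apply]
    simp [this]
  · show l (P' (Z m)) = (l ∘ₗ Z) (P' m)
    rw [hP', hP']
    refine MeasureTheory.integral_congr_ae (Filter.Eventually.of_forall fun k => ?_)
    have : Commute (F k) Z := ((hRZ _).mul_left hZ).mul_left (hRZ _)
    exact congrArg l (LinearMap.congr_fun this m)

end

end SL2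
end ClassicalPar

namespace ClassicalPar

open Module

/-! ### Galois action on the spectral norm, inertia and the Weil group -/

section Valuation

universe u v

variable {k : Type u} [NontriviallyNormedField k] {σ : k ≃+* k} {Ω : Type v} [Field Ω] [Algebra k Ω]

/-- A continuous involution of a normed field is isometric. -/
theorem norm_involution (hσ : ∀ x, σ (σ x) = x) (hc : Continuous σ) (x : k) : ‖σ x‖ = ‖x‖ := by
  have key : ∀ x : k, ¬ ‖σ x‖ < ‖x‖ := by
    intro x hx
    have hx0 : x ≠ 0 := norm_pos_iff.mp ((norm_nonneg _).trans_lt hx)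
    have hs0 : σ x ≠ 0 := fun h => hx0 ((map_eq_zero σ).mp h)
    -- An element with `‖y‖ < 1` and `y · σ y = 1`: the powers of `y` tend to 0, and by continuity
    -- so do those of `σ y`, although the products remain 1.
    set y := σ x / x with hy
    have hy1 : ‖y‖ < 1 := by rw [hy, norm_div]; exact (div_lt_one (norm_pos_iff.mpr hx0)).mpr hx
    have hsy : y * σ y = 1 := by
      rw [hy, map_div₀, hσ]
      field_simp
    have h1 := tendsto_pow_atTop_nhds_zero_of_norm_lt_one hy1
    have h2 := (hc.tendsto 0).comp h1
    rw [map_zero] at h2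
    have h3 := h1.mul h2
    have h4 : (fun n : ℕ => y ^ n * (σ ∘ fun n : ℕ => y ^ n) n) = fun _ => 1 := by
      funext n
      simp only [Function.comp, map_pow, ← mul_pow, hsy, one_pow]
    rw [h4, mul_zero] at h3
    exact one_ne_zero (tendsto_nhds_unique tendsto_const_nhds h3)
  refine le_antisymm (not_lt.mp fun h => key (σ x) ?_) (not_lt.mp (key x))
  rwa [hσ]

variable [IsUltrametricDist k] [CompleteSpace k] [Algebra.IsAlgebraic k Ω]

/-- Composition with `g` is again a power-multiplicative algebra norm over `k`, and the spectral
norm is the only one. Homogeneity uses that `σ` is isometric, since `g` need not be `k`-linear. -/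
theorem spectralNorm_gal (hσ : ∀ x, σ (σ x) = x) (hc : Continuous σ) (g : AbsGal σ Ω) (x : Ω) :
    spectralNorm k Ω (g x) = spectralNorm k Ω x := by
  let f : AlgebraNorm k Ω :=
    { toFun := fun x => spectralAlgNorm k Ω (g x)
      map_zero' := by rw [map_zero, map_zero]
      add_le' := fun x y => by rw [map_add]; exact map_add_le_add _ _ _
      neg' := fun x => by rw [map_neg, map_neg_eq_map]
      mul_le' := fun x y => by rw [map_mul]; exact map_mul_le_mul _ _ _
      eq_zero_of_map_eq_zero' := fun x hx =>
        (map_eq_zero g).mp (eq_zero_of_map_eq_zero (spectralAlgNorm k Ω) hx)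
      smul' := fun c x => by
        have h1 : spectralAlgNorm k Ω (g (algebraMap k Ω c)) = ‖c‖ := by
          rcases gal_apply hσ g c with h | h
          · rw [h, spectralAlgNorm_extends]
          · rw [h, spectralAlgNorm_extends, norm_involution hσ hc]
        show spectralAlgNorm k Ω (g (c • x)) = ‖c‖ * spectralAlgNorm k Ω (g x)
        rw [Algebra.smul_def, map_mul, spectralAlgNorm_mul, h1] }
  have hf : IsPowMul f := fun x n hn => by
    show spectralAlgNorm k Ω (g (x ^ n)) = spectralAlgNorm k Ω (g x) ^ n
    rw [map_pow]
    exact spectralAlgNorm_isPowMul _ hn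
  exact DFunLike.congr_fun (spectralNorm_unique hf) x

variable (k Ω) in
/-- The spectral norm as a valuation. -/
noncomputable def spectralVal : Valuation Ω NNReal where
  toFun x := ⟨spectralNorm k Ω x, spectralNorm_nonneg x⟩
  map_zero' := Subtype.ext spectralNorm_zero
  map_one' := Subtype.ext spectralNorm_one
  map_mul' x y := Subtype.ext (spectralAlgNorm_mul x y)
  map_add_le_max' x y := isNonarchimedean_spectralNorm x y

theorem actsOnResidueAsPow_iff {g : AbsGal σ Ω} {m : ℕ} : ActsOnResidueAsPow σ g m ↔
    ∀ x, spectralVal k Ω x ≤ 1 → spectralVal k Ω (g x - x ^ m) < 1 := Iff.rfl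

theorem spectralVal_gal (hσ : ∀ x, σ (σ x) = x) (hc : Continuous σ) (g : AbsGal σ Ω) (x : Ω) :
    spectralVal k Ω (g x) = spectralVal k Ω x := Subtype.ext (spectralNorm_gal hσ hc g x)

theorem ActsOnResidueAsPow.mul (hσ : ∀ x, σ (σ x) = x) (hc : Continuous σ) {g h : AbsGal σ Ω}
    {m n : ℕ} (hg : ActsOnResidueAsPow σ g m) (hh : ActsOnResidueAsPow σ h n) :
    ActsOnResidueAsPow σ (g * h) (m * n) := by
  rw [actsOnResidueAsPow_iff] at *
  intro x hx
  have h1 : (g * h) x - x ^ (m * n) = g (h x - x ^ n) + (g (x ^ n) - (x ^ n) ^ m) := by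
    rw [AlgEquiv.mul_apply, map_sub, ← pow_mul, mul_comm n m]
    ring
  rw [h1]
  refine (spectralVal k Ω).map_add_lt ?_ (hg _ ?_)
  · rw [spectralVal_gal hσ hc]; exact hh x hx
  · rw [map_pow]; exact pow_le_one' hx n

theorem ActsOnResidueAsPow.pow (hσ : ∀ x, σ (σ x) = x) (hc : Continuous σ) {g : AbsGal σ Ω}
    {m : ℕ} (hg : ActsOnResidueAsPow σ g m) (j : ℕ) : ActsOnResidueAsPow σ (g ^ j) (m ^ j) := by
  induction j with
  | zero =>
    rw [actsOnResidueAsPow_iff]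
    intro x _
    rw [pow_zero, pow_zero, pow_one, AlgEquiv.one_apply, sub_self, map_zero]
    exact one_pos
  | succ j ih =>
    rw [pow_succ, pow_succ]
    exact ih.mul hσ hc hg

/-- Elements with the same residual action differ by inertia; in particular any two Frobenius
elements do. -/
theorem ActsOnResidueAsPow.inv_mul (hσ : ∀ x, σ (σ x) = x) (hc : Continuous σ) {g h : AbsGal σ Ω}
    {m : ℕ} (hg : ActsOnResidueAsPow σ g m) (hh : ActsOnResidueAsPow σ h m) :
    g⁻¹ * h ∈ inertia σ Ω := by
  show ActsOnResidueAsPow σ (g⁻¹ * h) 1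
  rw [actsOnResidueAsPow_iff] at *
  intro x hx
  rw [pow_one, ← spectralVal_gal hσ hc g, map_sub, AlgEquiv.mul_apply, AlgEquiv.aut_inv,
    g.apply_symm_apply]
  have h1 : h x - g x = (h x - x ^ m) - (g x - x ^ m) := by ring
  rw [h1]
  exact (spectralVal k Ω).map_sub_lt (hh x hx) (hg x hx)

variable (Ω) in
/-- The inertia group, as a subgroup. -/
def inertiaSubgroup (hσ : ∀ x, σ (σ x) = x) (hc : Continuous σ) : Subgroup (AbsGal σ Ω) where
  carrier := inertia σ Ω
  mul_mem' ha hb := ActsOnResidueAsPow.mul (m := 1) (n := 1) hσ hc ha hb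
  one_mem' := by
    show ActsOnResidueAsPow σ 1 1
    rw [actsOnResidueAsPow_iff]
    intro x _
    rw [pow_one, AlgEquiv.one_apply, sub_self, map_zero]
    exact one_pos
  inv_mem' {a} ha := by
    have h1 : ActsOnResidueAsPow σ (1 : AbsGal σ Ω) 1 := by
      rw [actsOnResidueAsPow_iff]
      intro x _
      rw [pow_one, AlgEquiv.one_apply, sub_self, map_zero]
      exact one_pos
    have := ActsOnResidueAsPow.inv_mul hσ hc ha h1
    rwa [mul_one] at this

theorem mem_inertiaSubgroup {hσ : ∀ x, σ (σ x) = x} {hc : Continuous σ} {g : AbsGal σ Ω} :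
    g ∈ inertiaSubgroup Ω hσ hc ↔ g ∈ inertia σ Ω := Iff.rfl

instance inertiaSubgroup_normal (hσ : ∀ x, σ (σ x) = x) (hc : Continuous σ) :
    (inertiaSubgroup Ω hσ hc).Normal where
  conj_mem n hn g := by
    show ActsOnResidueAsPow σ (g * n * g⁻¹) 1
    have hn' : ActsOnResidueAsPow σ n 1 := hn
    rw [actsOnResidueAsPow_iff] at *
    intro x hx
    have h1 := hn' (g⁻¹ x) (by rwa [spectralVal_gal hσ hc])
    have h2 : (g * n * g⁻¹) x - x ^ 1 = g (n (g⁻¹ x) - (g⁻¹ x) ^ 1) := by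
      rw [map_sub, pow_one, pow_one]
      congr 1
      exact (g.apply_symm_apply x).symm
    rwa [h2, spectralVal_gal hσ hc]

/-- Modulo inertia, the Weil group is generated by any Frobenius element. -/
theorem exists_inertia_mul_zpow (hσ : ∀ x, σ (σ x) = x) (hc : Continuous σ) {f : AbsGal σ Ω}
    (hf : f ∈ geomFrob₀ σ Ω) {w : AbsGal σ Ω} (hw : w ∈ nonarchWeil σ Ω) :
    ∃ i ∈ inertia σ Ω, ∃ j : ℤ, w = i * f ^ j := by
  have hle : nonarchWeil σ Ω ≤ inertiaSubgroup Ω hσ hc ⊔ Subgroup.zpowers f := by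
    refine (Subgroup.closure_le _).mpr ?_
    rintro x (hx | hx)
    · exact Subgroup.mem_sup_left (mem_inertiaSubgroup.mpr hx)
    · have h1 : x * f⁻¹ ∈ inertiaSubgroup Ω hσ hc := by
        have := ActsOnResidueAsPow.inv_mul hσ hc hx hf
        rwa [inv_inv] at this
      have := Subgroup.mul_mem_sup h1 (Subgroup.mem_zpowers f)
      rwa [inv_mul_cancel_right] at this
  obtain ⟨i, hi, y, ⟨j, rfl⟩, h⟩ := Subgroup.mem_sup_of_normal_left.mp (hle hw)
  exact ⟨i, hi, j, h.symm⟩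

/-- The definition of the Weil group does not presuppose a Frobenius element over `k₀`; this handles
the case without one. -/
theorem mem_inertia_of_geomFrob₀_empty (hσ : ∀ x, σ (σ x) = x) (hc : Continuous σ)
    (hf : ∀ f, f ∉ geomFrob₀ σ Ω) {w : AbsGal σ Ω} (hw : w ∈ nonarchWeil σ Ω) :
    w ∈ inertia σ Ω := by
  have hle : nonarchWeil σ Ω ≤ inertiaSubgroup Ω hσ hc := by
    refine (Subgroup.closure_le _).mpr ?_
    rintro x (hx | hx)
    · exact hx
    · exact absurd hx (hf x)
  exact hle hw

end Valuation

/-- An open subgroup of a Galois group has finite index. -/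
theorem finiteIndex_of_isOpen {F E : Type*} [Field F] [Field E] [Algebra F E]
    {U : Subgroup (E ≃ₐ[F] E)} (hU : IsOpen (U : Set (E ≃ₐ[F] E))) : U.FiniteIndex := by
  obtain ⟨L, hL, hLU⟩ := (krullTopology_mem_nhds_one_iff F E U).mp (hU.mem_nhds U.one_mem)
  have hfin : Finite ((E ≃ₐ[F] E) ⧸ L.fixingSubgroup) := by
    let r : (E ≃ₐ[F] E) ⧸ L.fixingSubgroup → (L →ₐ[F] E) :=
      Quotient.lift (fun g => (g : E →ₐ[F] E).comp L.val) fun a b hab => by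
        have h : a⁻¹ * b ∈ L.fixingSubgroup := QuotientGroup.leftRel_apply.mp hab
        ext x
        have h1 : a.symm (b x) = x := h x
        exact ((AlgEquiv.symm_apply_eq a).mp h1).symm
    refine Finite.of_injective r ?_
    intro a b
    refine Quotient.inductionOn₂ a b fun a b h => Quotient.sound ?_
    refine QuotientGroup.leftRel_apply.mpr fun x => ?_
    exact (AlgEquiv.symm_apply_eq a).mpr (DFunLike.congr_fun h x).symm
  have : L.fixingSubgroup.FiniteIndex := Subgroup.finiteIndex_of_finite_quotient
  exact Subgroup.finiteIndex_of_le hLU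

/-- Powers in an extension of a cyclic group by a finite group. -/
theorem exists_pow_eq_pow {G : Type*} [Group G] {J : Subgroup G} [Finite J] {x y : G}
    (hJ : ∀ a ∈ J, y * a * y⁻¹ ∈ J) (hx : x * y⁻¹ ∈ J) : ∃ m : ℕ, 0 < m ∧ x ^ m = y ^ m := by
  -- `x^j y^{-j}` stays in the finite group `J`, so two exponents give the same value, and their
  -- difference works.
  have h1 : ∀ j : ℕ, x ^ j * (y ^ j)⁻¹ ∈ J := by
    intro j
    induction j with
    | zero => simp
    | succ j ih =>
      have : x ^ (j + 1) * (y ^ (j + 1))⁻¹ = (x * y⁻¹) * (y * (x ^ j * (y ^ j)⁻¹) * y⁻¹) := by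
        rw [pow_succ' x, pow_succ' y]; group
      rw [this]
      exact J.mul_mem hx (hJ _ ih)
  obtain ⟨a, b, hab, h⟩ := Finite.exists_ne_map_eq_of_infinite
    fun j : ℕ => (⟨x ^ j * (y ^ j)⁻¹, h1 j⟩ : J)
  have h2 : x ^ a * (y ^ a)⁻¹ = x ^ b * (y ^ b)⁻¹ := congrArg Subtype.val h
  have key : ∀ a b : ℕ, a < b → x ^ a * (y ^ a)⁻¹ = x ^ b * (y ^ b)⁻¹ →
      ∃ m : ℕ, 0 < m ∧ x ^ m = y ^ m := by
    intro a b hlt h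
    refine ⟨b - a, Nat.sub_pos_of_lt hlt, ?_⟩
    obtain ⟨c, rfl⟩ := Nat.exists_eq_add_of_lt hlt
    rw [show a + c + 1 - a = c + 1 by omega]
    rw [add_assoc, pow_add x, pow_add y, mul_inv_rev, mul_assoc (x ^ a)] at h
    have h3 := mul_left_cancel h
    rw [← mul_assoc, eq_comm] at h3
    exact mul_inv_eq_one.mp (mul_eq_right.mp h3)
  rcases lt_or_gt_of_ne hab with hlt | hlt
  · exact key a b hlt h2
  · exact key b a hlt h2.symm

end ClassicalPar

namespace ClassicalPar

open Module IsLocalRing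

/-! ### Residue fields and their cardinalities -/

section Residue

universe u v

/-- Relates the count of residue classes to the residue field of a valuation ring, so that the
theory of finite fields applies. -/
theorem residueCard_eq {k : Type u} [NormedField k] {K : Type v} [Field K]
    (v : Valuation K NNReal) (i : K →+* k) (hi : ∀ x, ‖i x‖₊ = v x) :
    residueCard i.fieldRange = Nat.card (ResidueField v.valuationSubring) := by
  have hle : ∀ {x : K}, ‖i x‖ ≤ 1 ↔ v x ≤ 1 := fun {x} => by
    rw [← hi, ← NNReal.coe_le_coe, coe_nnnorm, NNReal.coe_one]
  have hlt : ∀ {x : K}, ‖i x‖ < 1 ↔ v x < 1 := fun {x} => by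
    rw [← hi, ← NNReal.coe_lt_coe, coe_nnnorm, NNReal.coe_one]
  let f : v.valuationSubring → {x : k // x ∈ i.fieldRange ∧ ‖x‖ ≤ 1} := fun x =>
    ⟨i x.1, ⟨x.1, rfl⟩, hle.mpr x.2⟩
  have hf : Function.Surjective f := by
    rintro ⟨_, ⟨x, rfl⟩, hx⟩
    exact ⟨⟨x, hle.mp hx⟩, rfl⟩
  have hrel : ∀ x y, ‖(f x).1 - (f y).1‖ < 1 ↔ residue v.valuationSubring x = residue _ y := by
    intro x y
    show ‖i x.1 - i y.1‖ < 1 ↔ _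
    rw [← map_sub, hlt, ← sub_eq_zero, ← map_sub, residue_eq_zero_iff,
      Valuation.mem_maximalIdeal_iff]
    rfl
  symm
  refine Nat.card_congr (Equiv.ofBijective (fun z => Quot.mk _ (f (residue_surjective z).choose))
    ⟨fun a b h => ?_, fun q => ?_⟩)
  · have heq : Equivalence fun x y : {x : k // x ∈ i.fieldRange ∧ ‖x‖ ≤ 1} => ‖x.1 - y.1‖ < 1 := by
      refine ⟨fun x => by simp, fun {x y} h => by rwa [norm_sub_rev], fun {x y z} h1 h2 => ?_⟩
      obtain ⟨x, rfl⟩ := hf x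
      obtain ⟨y, rfl⟩ := hf y
      obtain ⟨z, rfl⟩ := hf z
      rw [hrel] at *
      exact h1.trans h2
    have h1 := (heq.quot_mk_eq_iff _ _).mp h
    rw [hrel, (residue_surjective a).choose_spec, (residue_surjective b).choose_spec] at h1
    exact h1
  · induction q using Quot.ind with | mk y =>
    obtain ⟨x, rfl⟩ := hf y
    refine ⟨residue _ x, Quot.sound ?_⟩
    rw [hrel]
    exact (residue_surjective (residue _ x)).choose_spec

variable (k : Type u) [NontriviallyNormedField k] [IsUltrametricDist k]

/-- By compactness finitely many open unit balls cover the ring of integers, and elements of one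
ball have the same residue by the ultrametric inequality. -/
theorem finite_residueField [ProperSpace k] :
    Finite (ResidueField (NormedField.valuation (K := k)).valuationSubring) := by
  obtain ⟨t, -, htf, ht⟩ := (isCompact_closedBall (0 : k) 1).finite_cover_balls one_pos
  have hmem : ∀ x : (NormedField.valuation (K := k)).valuationSubring, ‖x.1‖ ≤ 1 := fun x => x.2
  have : Finite t := htf
  have hex : ∀ z : ResidueField (NormedField.valuation (K := k)).valuationSubring,
      ∃ y : t, ∃ x, residue _ x = z ∧ ‖x.1 - y.1‖ < 1 := by
    intro z
    obtain ⟨x, rfl⟩ := residue_surjective z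
    obtain ⟨y, hy, hxy⟩ := Set.mem_iUnion₂.mp (ht (mem_closedBall_zero_iff.mpr (hmem x)))
    exact ⟨⟨y, hy⟩, x, rfl, by rwa [← mem_ball_iff_norm]⟩
  choose y x hx hxy using hex
  refine Finite.of_injective y fun a b hab => ?_
  rw [← hx a, ← hx b, ← sub_eq_zero, ← map_sub, residue_eq_zero_iff,
    Valuation.mem_maximalIdeal_iff, NormedField.valuation_apply, ← NNReal.coe_lt_coe, coe_nnnorm,
    NNReal.coe_one]
  have h1 : ((x a - x b : (NormedField.valuation (K := k)).valuationSubring) : k) =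
      ((x a).1 - (y a).1) - ((x b).1 - (y b).1) := by
    rw [hab]
    show (x a).1 - (x b).1 = _
    ring
  rw [h1, sub_eq_add_neg]
  refine (IsUltrametricDist.norm_add_le_max _ _).trans_lt (max_lt (hxy a) ?_)
  rw [norm_neg]
  exact hxy b

theorem residueCard_top :
    residueCard (⊤ : Subfield k) =
      Nat.card (ResidueField (NormedField.valuation (K := k)).valuationSubring) := by
  rw [← residueCard_eq (NormedField.valuation (K := k)) (RingHom.id k) fun x => rfl]
  congr 1
  exact (RingHom.fieldRange_eq_top_iff.mpr Function.surjective_id).symm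

variable {k}

/-- The residue field of `k` is a finite vector space over that of `L`; the exponent is its
dimension. -/
theorem exists_residueCard_eq_pow [ProperSpace k] (L : Subfield k) :
    ∃ f : ℕ, 0 < f ∧ residueCard (⊤ : Subfield k) = residueCard L ^ f := by
  let v : Valuation L NNReal := (NormedField.valuation (K := k)).comap L.subtype
  have : v.HasExtension (NormedField.valuation (K := k)) := ⟨Valuation.IsEquiv.refl⟩
  have hL : residueCard L = Nat.card (ResidueField v.valuationSubring) := by
    rw [← residueCard_eq v L.subtype fun x => rfl]
    congr 1
    ext x
    exact ⟨fun hx => ⟨⟨x, hx⟩, rfl⟩, by rintro ⟨y, rfl⟩; exact y.2⟩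
  have := finite_residueField k
  have : Module.Finite (ResidueField v.valuationSubring)
    (ResidueField (NormedField.valuation (K := k)).valuationSubring) := Module.Finite.of_finite
  refine ⟨Module.finrank (ResidueField v.valuationSubring)
    (ResidueField (NormedField.valuation (K := k)).valuationSubring), Module.finrank_pos, ?_⟩
  rw [residueCard_top, hL]
  exact Module.natCard_eq_pow_finrank

end Residue

/-! ### Existence of Frobenius elements -/

section Frobenius

universe u v

variable {k : Type u} [NontriviallyNormedField k] [IsUltrametricDist k] [ProperSpace k]
  {Ω : Type v} [Field Ω] [Algebra k Ω] [IsSepClosure k Ω]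

/-- The decomposition group of a maximal ideal surjects onto the automorphisms of the residue
extension. Galois acts on the valuation ring `B` of `Ω` with ring of invariants `A`, so the
Frobenius of the residue field lifts. -/
theorem exists_frobenius (σ : k ≃+* k) : ∃ g ∈ galOver σ Ω,
    ActsOnResidueAsPow σ g (residueCard (⊤ : Subfield k)) := by
  have : Algebra.IsAlgebraic k Ω := Algebra.IsSeparable.isAlgebraic k Ω
  let vk : Valuation k NNReal := NormedField.valuation
  have hext : ∀ x : k, spectralVal k Ω (algebraMap k Ω x) = vk x := fun x =>
    Subtype.ext (spectralNorm_extends x)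
  have : vk.HasExtension (spectralVal k Ω) := ⟨by
    have : (spectralVal k Ω).comap (algebraMap k Ω) = vk := Valuation.ext hext
    rw [this]
    exact Valuation.IsEquiv.refl⟩
  have hgal : ∀ (g : Ω ≃ₐ[k] Ω) x, spectralVal k Ω (g x) = spectralVal k Ω x := fun g x =>
    Subtype.ext (spectralNorm_eq_of_equiv g x).symm
  let A := vk.valuationSubring
  let B := (spectralVal k Ω).valuationSubring
  have hfin : Finite (ResidueField A) := finite_residueField k
  let _ : Fintype (ResidueField A) := Fintype.ofFinite _
  let _ : MulSemiringAction (Ω ≃ₐ[k] Ω) B :=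
    { smul := fun g x => ⟨g x.1, by
        show spectralVal k Ω (g x.1) ≤ 1
        rw [hgal]; exact x.2⟩
      one_smul := fun _ => rfl
      mul_smul := fun _ _ _ => rfl
      smul_zero := fun g => Subtype.ext (map_zero g)
      smul_add := fun g x y => Subtype.ext (map_add g x.1 y.1)
      smul_one := fun g => Subtype.ext (map_one g)
      smul_mul := fun g x y => Subtype.ext (map_mul g x.1 y.1) }
  have : SMulCommClass (Ω ≃ₐ[k] Ω) A B := ⟨fun g a b => Subtype.ext (by
    show g (a.1 • b.1) = a.1 • g b.1
    rw [map_smul])⟩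
  -- For the discrete topology the action is continuous, because the stabilizer of an element is
  -- open; this is the form required for profinite group actions.
  let _ : TopologicalSpace B := ⊥
  have : DiscreteTopology B := ⟨rfl⟩
  have : IsGalois k Ω := inferInstance
  have : Algebra.IsInvariant A B (Ω ≃ₐ[k] Ω) := ⟨fun b hb => by
    obtain ⟨x, hx⟩ := (InfiniteGalois.mem_bot_iff_fixed b.1).mpr fun g => congrArg Subtype.val (hb g)
    refine ⟨⟨x, ?_⟩, Subtype.ext hx⟩
    show vk x ≤ 1
    rw [← hext]
    have : algebraMap k Ω x = b.1 := hx
    rw [this]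
    exact b.2⟩
  have : ContinuousSMul (Ω ≃ₐ[k] Ω) B := by
    refine ⟨continuous_iff_continuousAt.mpr ?_⟩
    rintro ⟨g, b⟩
    have hb : FiniteDimensional k (IntermediateField.adjoin k {b.1}) :=
      IntermediateField.adjoin.finiteDimensional (Algebra.IsIntegral.isIntegral b.1)
    have hopen := (IntermediateField.adjoin k {b.1}).fixingSubgroup_isOpen
    have h1 : {h | g⁻¹ * h ∈ (IntermediateField.adjoin k {b.1}).fixingSubgroup} ∈ 𝓝 g := by
      refine (hopen.preimage (continuous_const_mul g⁻¹)).mem_nhds ?_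
      show g⁻¹ * g ∈ (IntermediateField.adjoin k {b.1}).fixingSubgroup
      rw [inv_mul_cancel]
      exact Subgroup.one_mem _
    have h2 : {b} ∈ 𝓝 b := mem_nhds_discrete.mpr rfl
    rw [ContinuousAt, nhds_discrete B, Filter.tendsto_pure]
    filter_upwards [prod_mem_nhds h1 h2]
    rintro ⟨h, c⟩ ⟨hh, rfl⟩
    refine Subtype.ext ?_
    have h3 : g.symm (h c.1) = c.1 := hh ⟨c.1, IntermediateField.mem_adjoin_simple_self k c.1⟩
    exact (AlgEquiv.symm_apply_eq g).mp h3
  have : Algebra.IsIntegral A B :=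
    Algebra.IsInvariant.isIntegral_of_profinite (G := Ω ≃ₐ[k] Ω)
  have : Algebra.IsAlgebraic (ResidueField A) (ResidueField B) := by
    refine Algebra.isAlgebraic_def.mpr fun z => ?_
    obtain ⟨x, rfl⟩ := residue_surjective z
    exact (((Algebra.IsIntegral.isIntegral (R := A) x).map
      (IsScalarTower.toAlgHom A B (ResidueField B))).tower_top).isAlgebraic
  obtain ⟨g, hg⟩ := Ideal.Quotient.stabilizerHom_surjective_of_profinite (G := Ω ≃ₐ[k] Ω)
    (maximalIdeal A) (maximalIdeal B)
    (FiniteField.frobeniusAlgEquivOfAlgebraic (ResidueField A) (ResidueField B))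
  refine ⟨(g : Ω ≃ₐ[k] Ω).restrictScalars (fixedField σ), fun x => (g : Ω ≃ₐ[k] Ω).commutes x, ?_⟩
  rw [actsOnResidueAsPow_iff]
  intro x hx
  have h1 := DFunLike.congr_fun hg (residue B ⟨x, hx⟩)
  have h2 : residue B ((g : Ω ≃ₐ[k] Ω) • ⟨x, hx⟩) = residue B (⟨x, hx⟩ ^ residueCard (⊤ : Subfield k)) := by
    rw [map_pow, residueCard_top, Nat.card_eq_fintype_card]
    exact h1
  rw [← sub_eq_zero, ← map_sub, residue_eq_zero_iff, Valuation.mem_maximalIdeal_iff] at h2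
  exact h2

end Frobenius

end ClassicalPar

namespace ClassicalPar

open Module

/-! ### The Galois groups of `k` and of `k₀` -/

section GaloisGroups

universe u v

variable {k : Type u} [Field k] {σ : k ≃+* k} {Ω : Type v} [Field Ω] [Algebra k Ω]

/-- An automorphism over `k₀` is trivial on `k`, or acts on `k` as `σ`. -/
theorem mem_galOver_or (hσ : ∀ x, σ (σ x) = x) (g : AbsGal σ Ω) :
    g ∈ galOver σ Ω ∨ ∀ x, g (algebraMap k Ω x) = algebraMap k Ω (σ x) := by
  by_contra! h
  obtain ⟨h1, y, hy⟩ := h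
  obtain ⟨x, hx⟩ := not_forall.mp h1
  have hx' := (gal_apply hσ g x).resolve_left hx
  have hy' := (gal_apply hσ g y).resolve_right hy
  -- `g` acts as `σ` and not trivially at `x`, trivially and not as `σ` at `y`; at `x + y` neither
  -- is possible.
  rcases gal_apply hσ g (x + y) with h | h
  · rw [map_add, map_add, hy'] at h
    exact hx (add_right_cancel h)
  · rw [map_add, map_add, hx', map_add, map_add] at h
    exact hy (add_left_cancel h)

theorem mul_mem_galOver (hσ : ∀ x, σ (σ x) = x) {g h : AbsGal σ Ω} (hg : g ∉ galOver σ Ω)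
    (hh : h ∉ galOver σ Ω) : g * h ∈ galOver σ Ω := by
  intro x
  rw [AlgEquiv.mul_apply, (mem_galOver_or hσ h).resolve_left hh,
    (mem_galOver_or hσ g).resolve_left hg, hσ]

theorem galOver_refl : galOver (RingEquiv.refl k) Ω = ⊤ :=
  eq_top_iff.mpr fun g _ x => g.commutes ⟨x, rfl⟩

theorem isIntegral_algebraMap (hσ : ∀ x, σ (σ x) = x) (x : k) :
    IsIntegral (fixedField σ) (algebraMap k Ω x) := by
  let t : fixedField σ := ⟨x + σ x, by rw [mem_fixedField, map_add, hσ, add_comm]⟩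
  let m : fixedField σ := ⟨x * σ x, by rw [mem_fixedField, map_mul, hσ, mul_comm]⟩
  refine ⟨Polynomial.X ^ 2 + (Polynomial.C (-t) * Polynomial.X + Polynomial.C m),
    Polynomial.monic_X_pow_add Polynomial.degree_linear_lt, ?_⟩
  have ht : algebraMap (fixedField σ) Ω t = algebraMap k Ω x + algebraMap k Ω (σ x) :=
    map_add (algebraMap k Ω) _ _
  have hm : algebraMap (fixedField σ) Ω m = algebraMap k Ω x * algebraMap k Ω (σ x) :=
    map_mul (algebraMap k Ω) _ _
  simp only [Polynomial.eval₂_add, Polynomial.eval₂_mul, Polynomial.eval₂_pow, Polynomial.eval₂_X,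
    Polynomial.eval₂_C, Polynomial.eval₂_neg, map_neg, ht, hm]
  ring

/-- If `σ` moves `x`, an automorphism over `k₀` is trivial on `k` as soon as it fixes `x`, and `x`
is integral over `k₀`. -/
theorem isOpen_galOver (hσ : ∀ x, σ (σ x) = x) : IsOpen (galOver σ Ω : Set (AbsGal σ Ω)) := by
  by_cases h : ∃ x, σ x ≠ x
  · obtain ⟨x, hx⟩ := h
    let L := IntermediateField.adjoin (fixedField σ) {algebraMap k Ω x}
    have : FiniteDimensional (fixedField σ) L :=
      IntermediateField.adjoin.finiteDimensional (isIntegral_algebraMap hσ x)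
    have hL := L.fixingSubgroup_isOpen
    have heq : L.fixingSubgroup = galOver σ Ω := by
      ext g
      constructor
      · intro hg
        refine (mem_galOver_or hσ g).resolve_right fun h => hx ?_
        refine (algebraMap k Ω).injective ((h x).symm.trans ?_)
        exact hg ⟨_, IntermediateField.mem_adjoin_simple_self _ _⟩
      · intro hg
        rw [IntermediateField.mem_fixingSubgroup_iff]
        intro y hy
        have hle : L ≤ IntermediateField.fixedField (Subgroup.zpowers g) := by
          refine IntermediateField.adjoin_le_iff.mpr ?_
          rintro _ rfl
          rintro ⟨g', hg'⟩
          have : g' ∈ galOver σ Ω := (Subgroup.zpowers_le.mpr hg) hg'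
          exact this x
        exact hle hy ⟨g, Subgroup.mem_zpowers g⟩
    rwa [heq] at hL
  · push Not at h
    have : galOver σ Ω = ⊤ := eq_top_iff.mpr fun g _ x => g.commutes ⟨x, h x⟩
    rw [this]
    exact isOpen_univ

end GaloisGroups

theorem finiteIndex_comap {G H : Type*} [Group G] [Group H] (U : Subgroup H) [U.FiniteIndex]
    (f : G →* H) : (U.comap f).FiniteIndex := by
  refine ⟨?_⟩
  rw [Subgroup.index_comap]
  exact (inferInstance : (U.subgroupOf f.range).FiniteIndex).index_ne_zero

/-! ### Images of inertia and Frobenius -/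

section NonarchImage

universe u v

variable {k : Type u} [NontriviallyNormedField k] {σ : k ≃+* k} {Ω : Type v} [Field Ω] [Algebra k Ω]
  [IsUltrametricDist k] [CompleteSpace k] [Algebra.IsAlgebraic k Ω]
  (hσ : ∀ x, σ (σ x) = x) (hc : Continuous σ)

variable (Ω) in
/-- The inertia group, as a subgroup of the Weil group. -/
def inertiaWeil : Subgroup (nonarchWeil σ Ω) :=
  (inertiaSubgroup Ω hσ hc).comap (nonarchWeil σ Ω).subtype

variable {G : Type*} [Group G] (ψ : nonarchWeil σ Ω →* G)

/-- An open subgroup has finite index, so the kernel of `ψ` on inertia has finite index in inertia.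
-/
theorem finite_map_inertiaWeil {U : Subgroup (AbsGal σ Ω)} (hU : IsOpen (U : Set (AbsGal σ Ω)))
    (hψ : ∀ w : nonarchWeil σ Ω, (w : AbsGal σ Ω) ∈ inertia σ Ω → (w : AbsGal σ Ω) ∈ U →
      ψ w = 1) : Finite ((inertiaWeil Ω hσ hc).map ψ) := by
  have := finiteIndex_of_isOpen hU
  have : (U.comap
      ((nonarchWeil σ Ω).subtype.comp (inertiaWeil Ω hσ hc).subtype)).FiniteIndex :=
    finiteIndex_comap U _
  let r := ψ.comp (inertiaWeil Ω hσ hc).subtype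
  have hle : U.comap ((nonarchWeil σ Ω).subtype.comp (inertiaWeil Ω hσ hc).subtype) ≤ r.ker :=
    fun w hw => hψ w.1 w.2 hw
  have := Subgroup.finiteIndex_of_le hle
  have hr : r.range = (inertiaWeil Ω hσ hc).map ψ := by
    rw [MonoidHom.range_comp, Subgroup.range_subtype]
  rw [← hr]
  refine Nat.finite_of_card_ne_zero ?_
  rw [← Subgroup.index_ker]
  exact this.index_ne_zero

theorem conj_mem_map_inertiaWeil (w : nonarchWeil σ Ω) {a : G}
    (ha : a ∈ (inertiaWeil Ω hσ hc).map ψ) :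
    ψ w * a * (ψ w)⁻¹ ∈ (inertiaWeil Ω hσ hc).map ψ := by
  obtain ⟨i, hi, rfl⟩ := ha
  refine ⟨w * i * w⁻¹, ?_, by rw [map_mul, map_mul, map_inv]⟩
  exact (inertiaSubgroup_normal hσ hc).conj_mem _ hi _

/-- Finiteness of the image of inertia lets semisimplicity pass between Weil elements that agree
modulo inertia, by way of a common power. -/
theorem exists_map_pow_eq [Finite ((inertiaWeil Ω hσ hc).map ψ)] {w w' : nonarchWeil σ Ω}
    (h : w * w'⁻¹ ∈ inertiaWeil Ω hσ hc) : ∃ m : ℕ, 0 < m ∧ ψ w ^ m = ψ w' ^ m :=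
  exists_pow_eq_pow (fun _ ha => conj_mem_map_inertiaWeil hσ hc ψ w' ha)
    ⟨_, h, by rw [map_mul, map_inv]⟩

/-- A Frobenius element generates a subgroup of finite index of the image of the Weil group. -/
theorem finiteIndex_comap_zpowers [Finite ((inertiaWeil Ω hσ hc).map ψ)] {f : nonarchWeil σ Ω}
    (hf : (f : AbsGal σ Ω) ∈ geomFrob₀ σ Ω) :
    ((Subgroup.zpowers (ψ f)).comap ψ).FiniteIndex := by
  let J := (inertiaWeil Ω hσ hc).map ψ
  have hex : ∀ w : nonarchWeil σ Ω, ∃ i : J, ∃ j : ℤ, ψ w = i * ψ f ^ j := by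
    intro w
    obtain ⟨i, hi, j, h⟩ := exists_inertia_mul_zpow hσ hc hf w.2
    have hiw : i ∈ nonarchWeil σ Ω := Subgroup.subset_closure (Or.inl hi)
    refine ⟨⟨ψ ⟨i, hiw⟩, ⟨i, hiw⟩, hi, rfl⟩, j, ?_⟩
    rw [← map_zpow, ← map_mul]
    congr 1
    exact Subtype.ext h
  choose i j hij using hex
  let H := (Subgroup.zpowers (ψ f)).comap ψ
  -- Modulo powers of Frobenius an image is determined by its inertial part, of which there are
  -- finitely many.
  have : Finite (nonarchWeil σ Ω ⧸ H) := by
    refine Finite.of_injective (fun q : nonarchWeil σ Ω ⧸ H => i q.out) fun q q' h => ?_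
    rw [← q.out_eq, ← q'.out_eq]
    refine Quotient.sound (QuotientGroup.leftRel_apply.mpr ?_)
    show ψ (q.out⁻¹ * q'.out) ∈ Subgroup.zpowers (ψ f)
    refine ⟨-j q.out + j q'.out, ?_⟩
    have h' : i q.out = i q'.out := h
    rw [map_mul, map_inv, hij q.out, hij q'.out, h']
    simp only
    rw [zpow_add, mul_inv_rev, mul_assoc, inv_mul_cancel_left, zpow_neg]
  exact Subgroup.finiteIndex_of_finite_quotient

end NonarchImage

/-! ### Archimedean Galois and Weil groups -/

section ArchGalois

universe u v

variable {k : Type u} [NontriviallyNormedField k] {σ : k ≃+* k} {Ω : Type v} [Field Ω] [Algebra k Ω]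

/-- Both kinds of `k` embed in ℂ with ℂ finite over `k`, and the algebraic extension `Ω` embeds in ℂ
over `k`. -/
theorem finite_of_isLocalField [Algebra.IsAlgebraic k Ω] (hk : IsLocalField .archimedean k) :
    FiniteDimensional k Ω := by
  obtain ⟨r, hr⟩ : ∃ r : k →+* ℂ, ∀ z : ℂ, ∃ x y : k, z = r x + r y * Complex.I := by
    rcases hk with ⟨e, -, -⟩ | ⟨e, -, -⟩
    · refine ⟨Complex.ofRealHom.comp e.toRingHom, fun z => ⟨e.symm z.re, e.symm z.im, ?_⟩⟩
      show z = ((e (e.symm z.re) : ℝ) : ℂ) + ((e (e.symm z.im) : ℝ) : ℂ) * Complex.I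
      rw [e.apply_symm_apply, e.apply_symm_apply, Complex.re_add_im]
    · refine ⟨e.toRingHom, fun z => ⟨e.symm z, 0, ?_⟩⟩
      show z = e (e.symm z) + e 0 * Complex.I
      rw [e.apply_symm_apply, map_zero, zero_mul, add_zero]
  let _ : Algebra k ℂ := r.toAlgebra
  have : FiniteDimensional k ℂ := by
    classical
    refine ⟨⟨{1, Complex.I}, eq_top_iff.mpr fun z _ => ?_⟩⟩
    obtain ⟨x, y, h⟩ := hr z
    have : z = x • (1 : ℂ) + y • Complex.I := by
      rw [Algebra.smul_def, Algebra.smul_def, mul_one]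
      exact h
    rw [this]
    exact add_mem (Submodule.smul_mem _ _ (Submodule.subset_span (by simp)))
      (Submodule.smul_mem _ _ (Submodule.subset_span (by simp)))
  let φ : Ω →ₐ[k] ℂ := IsAlgClosed.lift
  exact FiniteDimensional.of_injective φ.toLinearMap φ.injective

theorem finite_absGal [FiniteDimensional k Ω] (hσ : ∀ x, σ (σ x) = x) : Finite (AbsGal σ Ω) := by
  have h1 : Finite (galOver σ Ω) := by
    refine Finite.of_injective
      (fun g : galOver σ Ω => (AlgEquiv.ofRingEquiv (f := g.1.toRingEquiv) g.2 : Ω ≃ₐ[k] Ω)) ?_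
    intro g h hgh
    refine Subtype.ext (AlgEquiv.ext fun x => ?_)
    exact DFunLike.congr_fun hgh x
  by_cases h2 : ∃ c, c ∉ galOver σ Ω
  · obtain ⟨c, hc⟩ := h2
    classical
    refine Finite.of_surjective (fun x : galOver σ Ω ⊕ galOver σ Ω =>
      Sum.elim (fun g => g.1) (fun g => c⁻¹ * g.1) x) fun g => ?_
    by_cases hg : g ∈ galOver σ Ω
    · exact ⟨Sum.inl ⟨g, hg⟩, rfl⟩
    · exact ⟨Sum.inr ⟨c * g, mul_mem_galOver hσ hc hg⟩, inv_mul_cancel_left c g⟩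
  · push Not at h2
    have : galOver σ Ω = ⊤ := eq_top_iff.mpr fun g _ => h2 g
    rw [this] at h1
    exact Finite.of_equiv _ Subgroup.topEquiv.toEquiv

theorem exists_ofUnit {w : WD₀ σ Ω .archimedean} (hw : WD₀.toGal σ Ω .archimedean w = 1) :
    ∃ z, w = ofUnit σ Ω z := ⟨ArchWeil.unit w, ArchWeil.ext rfl hw⟩

theorem toGal_ofUnit (z : Ωˣ) : WD₀.toGal σ Ω .archimedean (ofUnit σ Ω z) = 1 := rfl

theorem ofUnit_mul (z z' : Ωˣ) : ofUnit σ Ω z * ofUnit σ Ω z' = ofUnit σ Ω (z * z') := by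
  refine ArchWeil.ext ?_ (one_mul _)
  show z * Units.map ((1 : AbsGal σ Ω) : Ω →* Ω) z' *
    weilCocycle (1 : AbsGal σ Ω) (1 : AbsGal σ Ω) = z * z'
  have h1 : weilCocycle (1 : AbsGal σ Ω) (1 : AbsGal σ Ω) = 1 := by
    unfold weilCocycle
    rw [if_neg]
    rintro ⟨⟨i, _, hi⟩, _⟩
    exact hi rfl
  rw [h1, mul_one]
  congr 1

theorem exists_pow_ofUnit [Finite (AbsGal σ Ω)] (w : WD₀ σ Ω .archimedean) :
    ∃ m : ℕ, 0 < m ∧ ∃ z, w ^ m = ofUnit σ Ω z := by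
  refine ⟨Nat.card (AbsGal σ Ω), Nat.card_pos, exists_ofUnit ?_⟩
  rw [map_pow, pow_card_eq_one']

end ArchGalois

end ClassicalPar

namespace ClassicalPar

open Module

/-! ### Matrix entries and matrix coefficients -/

section Entries

/-- Coefficients are fixed linear combinations of entries, and entries are coefficients. The
property `p` stands for continuity in one use and for algebraicity in the other. -/
theorem entries_iff {X : Type*} {N : ℕ} (p : (X → ℂ) → Prop) (h0 : p fun _ => 0)
    (hadd : ∀ a b, p a → p b → p fun x => a x + b x) (hmul : ∀ c a, p a → p fun x => c * a x)
    (A : X → Matrix (Fin N) (Fin N) ℂ) :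
    (∀ i j, p fun x => A x i j) ↔
      ∀ (m : Fin N → ℂ) (l : (Fin N → ℂ) →ₗ[ℂ] ℂ), p fun x => l (Matrix.toLin' (A x) m) := by
  constructor
  · intro h m l
    have hsum : ∀ (s : Finset (Fin N)) (a : Fin N → X → ℂ), (∀ i, p (a i)) →
        p fun x => ∑ i ∈ s, a i x := by
      classical
      intro s a ha
      induction s using Finset.induction_on with
      | empty => simpa using h0
      | insert i s hi ih =>
        simp only [Finset.sum_insert hi]
        exact hadd _ _ (ha i) ih
    have heq : ∀ x, l (Matrix.toLin' (A x) m) =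
        ∑ i, ∑ j, (l (Pi.single i 1) * m j) * A x i j := by
      intro x
      have h1 : Matrix.toLin' (A x) m = ∑ i, (A x *ᵥ m) i • (Pi.single i 1 : Fin N → ℂ) := by
        rw [Matrix.toLin'_apply]
        exact pi_eq_sum_univ' _
      rw [h1, map_sum]
      refine Finset.sum_congr rfl fun i _ => ?_
      rw [map_smul, smul_eq_mul, Matrix.mulVec, dotProduct, Finset.sum_mul]
      exact Finset.sum_congr rfl fun j _ => by ring
    simp only [heq]
    exact hsum _ _ fun i => hsum _ _ fun j => hmul _ _ (h i j)
  · intro h i j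
    have := h (Pi.single j 1) (LinearMap.proj i)
    simpa using this

theorem isAlgebraicFun_entries_iff {N : ℕ}
    (A : Matrix.SpecialLinearGroup (Fin 2) ℂ → Matrix (Fin N) (Fin N) ℂ) :
    (∀ i j, IsAlgebraicFun fun x => A x i j) ↔
      ∀ (m : Fin N → ℂ) (l : (Fin N → ℂ) →ₗ[ℂ] ℂ),
        IsAlgebraicFun fun x => l (Matrix.toLin' (A x) m) := by
  refine entries_iff IsAlgebraicFun ⟨0, fun _ => by simp⟩ ?_ ?_ A
  · rintro a b ⟨P, hP⟩ ⟨Q, hQ⟩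
    exact ⟨P + Q, fun g => by show a g + b g = _; rw [map_add, hP, hQ]⟩
  · rintro c a ⟨P, hP⟩
    exact ⟨MvPolynomial.C c * P, fun g => by
      show c * a g = _
      rw [map_mul, MvPolynomial.eval_C, hP]⟩

theorem continuous_entries_iff {X : Type*} [TopologicalSpace X] {N : ℕ}
    (A : X → Matrix (Fin N) (Fin N) ℂ) :
    (∀ i j, Continuous fun x => A x i j) ↔
      ∀ (m : Fin N → ℂ) (l : (Fin N → ℂ) →ₗ[ℂ] ℂ), Continuous fun x => l (Matrix.toLin' (A x) m) :=
  entries_iff Continuous continuous_const (fun _ _ h h' => h.add h')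
    (fun _ _ h => continuous_const.mul h) A

end Entries

/-! ### Semisimplicity in the L-group and in the representation -/

section Admissible

universe u v

variable {k : Type u} [NontriviallyNormedField k] {κ : LocalKind} {σ : k ≃+* k}
  {Ω : Type v} [Field Ω] [Algebra k Ω] {L : LGroupData σ Ω}

/-- The properties of the data of an L-group used in the study of parameters. -/
structure LGroupData.IsStandard (L : LGroupData σ Ω) : Prop where
  std_eq : ∀ x : overBase L.K L.act, x.1.right = 1 → L.std x = L.incl x.1.left
  incl_injective : Function.Injective L.incl
  finite : FiniteDimensional (fixedField σ) L.K

variable {f : WD₀ σ Ω κ →* L.LG}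

theorem map_mem_overBase
    (hr : ∀ w, (f w).right = AlgEquiv.restrictNormalHom L.K (WD₀.toGal σ Ω κ w))
    (w : WD κ σ Ω) : f w ∈ overBase L.K L.act := by
  rintro y ⟨x, hx⟩
  apply Subtype.ext
  rw [hr, AlgEquiv.restrictNormalHom_apply, ← hx]
  exact w.2 x

/-- The representation of `WD(k)` attached to a homomorphism to the L-group. -/
noncomputable def homRep
    (hr : ∀ w, (f w).right = AlgEquiv.restrictNormalHom L.K (WD₀.toGal σ Ω κ w)) :
    Representation ℂ (WD κ σ Ω) (Fin L.N → ℂ) :=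
  ((Matrix.toLinAlgEquiv' : Matrix (Fin L.N) (Fin L.N) ℂ ≃ₐ[ℂ] _) :
      Matrix (Fin L.N) (Fin L.N) ℂ →* ((Fin L.N → ℂ) →ₗ[ℂ] (Fin L.N → ℂ))).comp
    ((Units.coeHom _).comp
      (L.std.comp ((f.comp (WD κ σ Ω).subtype).codRestrict _ (map_mem_overBase hr))))

variable (hr : ∀ w, (f w).right = AlgEquiv.restrictNormalHom L.K (WD₀.toGal σ Ω κ w))

theorem homRep_apply (w : WD κ σ Ω) : homRep hr w =
    Matrix.toLin' (L.std ⟨f w, map_mem_overBase hr w⟩ : Matrix (Fin L.N) (Fin L.N) ℂ) := rfl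

theorem homRep_of_right_eq_one (hL : L.IsStandard) (w : WD κ σ Ω) (hw : (f w).right = 1) :
    homRep hr w = Matrix.toLin' (L.incl (f w).left : Matrix (Fin L.N) (Fin L.N) ℂ) := by
  rw [homRep_apply, hL.std_eq _ hw]

theorem LGroupData.IsSemisimple.of_pow {x : L.LG} {N : ℕ} (hN : 0 < N)
    (h : L.IsSemisimple (x ^ N)) : L.IsSemisimple x := by
  obtain ⟨m, hm, h1, h2⟩ := h
  rw [← pow_mul] at h1 h2
  exact ⟨N * m, Nat.mul_pos hN hm, h1, h2⟩

theorem eq_inl_of_right_eq_one {x : L.LG} (h : x.right = 1) : x = SemidirectProduct.inl x.left :=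
  SemidirectProduct.ext rfl h

theorem LGroupData.IsSemisimple.zpow {x : L.LG} (h : L.IsSemisimple x) (j : ℤ) :
    L.IsSemisimple (x ^ j) := by
  obtain ⟨m, hm, h1, h2⟩ := h
  have h3 : (x ^ j) ^ m = SemidirectProduct.inl ((x ^ m).left ^ j) := by
    rw [← zpow_natCast, ← zpow_mul, mul_comm, zpow_mul, zpow_natCast, map_zpow,
      ← eq_inl_of_right_eq_one h1]
  refine ⟨m, hm, by rw [h3]; rfl, ?_⟩
  rw [h3, SemidirectProduct.left_inl, map_zpow]
  have hnat : ∀ n : ℕ, Module.End.IsSemisimple (Matrix.toLin'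
      ((L.incl (x ^ m).left ^ n : GL (Fin L.N) ℂ) : Matrix (Fin L.N) (Fin L.N) ℂ)) := by
    intro n
    rw [Units.val_pow_eq_pow_val, Matrix.toLin'_pow]
    exact h2.pow n
  cases j with
  | ofNat n => exact hnat n
  | negSucc n =>
    refine isSemisimple_inv ?_ (hnat (n + 1))
    rw [zpow_negSucc]
    refine (Matrix.toLin'_mul _ _).symm.trans ?_
    rw [← Units.val_mul, mul_inv_cancel, Units.val_one, Matrix.toLin'_one]
    rfl

theorem LGroupData.IsSemisimple.pow {x : L.LG} (h : L.IsSemisimple x) (j : ℕ) :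
    L.IsSemisimple (x ^ j) := by
  rw [← zpow_natCast]
  exact h.zpow j

theorem LGroupData.isSemisimple_one : L.IsSemisimple (1 : L.LG) := by
  refine ⟨1, one_pos, rfl, ?_⟩
  rw [one_pow, SemidirectProduct.one_left, map_one, Units.val_one, Matrix.toLin'_one]
  exact Module.End.isSemisimple_id

/-- Raising to the order of the finite Galois group lands in the dual group, and neither notion of
semisimplicity changes on passing to a power. -/
theorem isSemisimple_map_iff (hL : L.IsStandard) (w : WD κ σ Ω) :
    L.IsSemisimple (f w) ↔ Module.End.IsSemisimple (homRep hr w) := by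
  have hpow : ∀ m : ℕ, (f w ^ m).right = 1 → homRep hr w ^ m =
      Matrix.toLin' (L.incl (f w ^ m).left : Matrix (Fin L.N) (Fin L.N) ℂ) := by
    intro m hm
    have : f (w ^ m : WD κ σ Ω) = f w ^ m := by rw [Subgroup.coe_pow, map_pow]
    rw [← map_pow, homRep_of_right_eq_one hr hL _ (by rw [this]; exact hm), this]
  constructor
  · rintro ⟨m, hm, h1, h2⟩
    refine isSemisimple_of_pow ((Group.isUnit w).map (homRep hr)) hm ?_
    rwa [hpow m h1]
  · intro h
    have := hL.finite
    have hm : (f w ^ Nat.card (L.K ≃ₐ[fixedField σ] L.K)).right = 1 := by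
      have : (f w ^ Nat.card (L.K ≃ₐ[fixedField σ] L.K)).right =
          (f w).right ^ Nat.card (L.K ≃ₐ[fixedField σ] L.K) :=
        map_pow (SemidirectProduct.rightHom (φ := L.act)) _ _
      rw [this, pow_card_eq_one']
    refine ⟨_, Nat.card_pos, hm, ?_⟩
    rw [← hpow _ hm]
    exact h.pow _

end Admissible

/-! ### Admissibility in the archimedean case -/

section Arch

universe u v

variable {k : Type u} [NontriviallyNormedField k] {σ : k ≃+* k}
  {Ω : Type v} [Field Ω] [Algebra k Ω] {L : LGroupData σ Ω} {f : WD₀ σ Ω .archimedean →* L.LG}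

variable (σ Ω) in
/-- The subgroup `Ωˣ` of the archimedean Weil group of `k`. -/
noncomputable def unitSubgroup : Subgroup (WD .archimedean σ Ω) :=
  ((WD₀.toGal σ Ω .archimedean).comp (WD .archimedean σ Ω).subtype).ker

theorem unitSubgroup_comm (a : WD .archimedean σ Ω) (ha : a ∈ unitSubgroup σ Ω)
    (b : WD .archimedean σ Ω) (hb : b ∈ unitSubgroup σ Ω) : a * b = b * a := by
  obtain ⟨z, hz⟩ := exists_ofUnit ha
  obtain ⟨z', hz'⟩ := exists_ofUnit hb
  refine Subtype.ext ?_
  show (a : WD₀ σ Ω .archimedean) * b = b * a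
  have hz : (a : WD₀ σ Ω .archimedean) = ofUnit σ Ω z := hz
  have hz' : (b : WD₀ σ Ω .archimedean) = ofUnit σ Ω z' := hz'
  rw [hz, hz', ofUnit_mul, ofUnit_mul, mul_comm]

/-- Semisimple elements make the commutative group `Ωˣ` act semisimply, and averaging over the
finite Galois quotient gives a semisimple representation. Conversely a commutative normal subgroup
acts by semisimple operators in a semisimple representation, and every element has a power in `Ωˣ`.
-/
theorem isAdmissible_iff_archimedean [Algebra.IsAlgebraic k Ω]
    (hk : IsLocalField .archimedean k) (hσ : ∀ x, σ (σ x) = x) (hL : L.IsStandard)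
    (hr : ∀ w, (f w).right = AlgEquiv.restrictNormalHom L.K (WD₀.toGal σ Ω .archimedean w)) :
    IsAdmissible L .archimedean f ↔ IsWDRep .archimedean (homRep hr) := by
  have := finite_of_isLocalField (Ω := Ω) hk
  have := finite_absGal (Ω := Ω) hσ
  have hunit : ∀ z, homRep hr ⟨ofUnit σ Ω z, ofUnit_mem σ Ω z⟩ =
      Matrix.toLin' (L.incl (f (ofUnit σ Ω z)).left : Matrix (Fin L.N) (Fin L.N) ℂ) := by
    intro z
    refine homRep_of_right_eq_one hr hL _ ?_
    rw [hr]
    exact map_one (AlgEquiv.restrictNormalHom L.K)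
  refine and_congr ?_ ⟨fun h => ?_, fun h w => ?_⟩
  · let _ := unitsTopology k Ω
    simp only [hunit]
    exact continuous_entries_iff _
  · rw [isSemisimple_iff_exists_proj]
    intro W hW
    obtain ⟨P, hP, hPc⟩ := exists_proj_of_commute (fun a : unitSubgroup σ Ω => homRep hr a.1)
      (fun a b => by
        show homRep hr a.1 * homRep hr b.1 = homRep hr b.1 * homRep hr a.1
        rw [← map_mul, unitSubgroup_comm _ a.2 _ b.2, map_mul])
      (fun a => (isSemisimple_map_iff hr hL a.1).mp (h _)) (fun a => hW a.1)
    have : (unitSubgroup σ Ω).FiniteIndex := by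
      unfold unitSubgroup
      infer_instance
    exact exists_proj_of_finiteIndex (homRep hr) (unitSubgroup σ Ω) hW hP fun a ha => hPc ⟨a, ha⟩
  · obtain ⟨m, hm, z, hz⟩ := exists_pow_ofUnit w
    refine LGroupData.IsSemisimple.of_pow hm ?_
    rw [← map_pow, hz]
    refine (isSemisimple_map_iff hr hL ⟨ofUnit σ Ω z, ofUnit_mem σ Ω z⟩).mpr ?_
    have hn : (unitSubgroup σ Ω).Normal := MonoidHom.normal_ker _
    exact isSemisimple_of_normal_commutative h (unitSubgroup σ Ω) unitSubgroup_comm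
      (show _ ∈ unitSubgroup σ Ω from toGal_ofUnit z)

end Arch

end ClassicalPar

namespace ClassicalPar

open Module

/-! ### Admissibility in the nonarchimedean case -/

section Nonarch

universe u v

variable {k : Type u} [NontriviallyNormedField k] {σ : k ≃+* k}
  {Ω : Type v} [Field Ω] [Algebra k Ω]

variable (σ Ω) in
/-- The inclusion of the Weil group in the Weil-Deligne group. -/
noncomputable def weilHom : nonarchWeil σ Ω →* WD₀ σ Ω .nonarchimedean :=
  MonoidHom.inl (nonarchWeil σ Ω) (Matrix.SpecialLinearGroup (Fin 2) ℂ)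

variable {L : LGroupData σ Ω} {f : WD₀ σ Ω .nonarchimedean →* L.LG}

theorem isSemisimple_of_pow_eq {x y : L.LG} {N : ℕ} (hN : 0 < N) (h : x ^ N = y ^ N)
    (hy : L.IsSemisimple y) : L.IsSemisimple x :=
  LGroupData.IsSemisimple.of_pow hN (h ▸ hy.pow N)

variable [IsUltrametricDist k] [ProperSpace k] [IsSepClosure k Ω]

/-- The residue cardinality of `k` is the `n`-th power of that of `k₀`, so the `n`-th power of a
Frobenius of `k₀` has the residual action of a Frobenius of `k`. -/
theorem exists_geomFrob (hσ : ∀ x, σ (σ x) = x) (hc : Continuous σ) {f₀ : AbsGal σ Ω}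
    (hf₀ : f₀ ∈ geomFrob₀ σ Ω) : ∃ F ∈ geomFrob σ Ω, ∃ n : ℕ, 0 < n ∧ F * (f₀ ^ n)⁻¹ ∈ inertia σ Ω := by
  have : Algebra.IsAlgebraic k Ω := Algebra.IsSeparable.isAlgebraic k Ω
  obtain ⟨g, hg, hgq⟩ := exists_frobenius (Ω := Ω) σ
  obtain ⟨n, hn, hcard⟩ := exists_residueCard_eq_pow (fixedField σ)
  refine ⟨g⁻¹, ⟨inv_mem hg, by rwa [inv_inv]⟩, n, hn, ?_⟩
  rw [← inv_pow]
  refine ActsOnResidueAsPow.inv_mul hσ hc hgq ?_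
  rw [hcard]
  exact ActsOnResidueAsPow.pow hσ hc hf₀ n

/-- Modulo inertia `w` is a power of Frobenius, or trivial if there is no Frobenius. Hence a power
of its image is a power of a semisimple element. -/
theorem isSemisimple_map_ofWeil (hσ : ∀ x, σ (σ x) = x) (hc : Continuous σ)
    (hU : ∃ U : Subgroup (AbsGal σ Ω), IsOpen (U : Set (AbsGal σ Ω)) ∧
        ∀ w : nonarchWeil σ Ω, (w : AbsGal σ Ω) ∈ inertia σ Ω → (w : AbsGal σ Ω) ∈ U →
          f (ofWeil σ Ω w) = 1)
    (hF : ∀ w : nonarchWeil σ Ω, (w : AbsGal σ Ω) ∈ geomFrob₀ σ Ω →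
        L.IsSemisimple (f (ofWeil σ Ω w))) (w : nonarchWeil σ Ω) :
    L.IsSemisimple (f (ofWeil σ Ω w)) := by
  have : Algebra.IsAlgebraic k Ω := Algebra.IsSeparable.isAlgebraic k Ω
  obtain ⟨U, hUo, hU⟩ := hU
  let ψ : nonarchWeil σ Ω →* L.LG := f.comp (weilHom σ Ω)
  have := finite_map_inertiaWeil hσ hc ψ hUo hU
  by_cases hex : ∃ f₀, f₀ ∈ geomFrob₀ σ Ω
  · obtain ⟨f₀, hf₀⟩ := hex
    let f₁ : nonarchWeil σ Ω := ⟨f₀, Subgroup.subset_closure (Or.inr hf₀)⟩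
    obtain ⟨i, hi, j, hw⟩ := exists_inertia_mul_zpow hσ hc hf₀ w.2
    obtain ⟨m, hm, h⟩ := exists_map_pow_eq hσ hc ψ (w := w) (w' := f₁ ^ j) (by
      show (w : AbsGal σ Ω) * (f₀ ^ j)⁻¹ ∈ inertia σ Ω
      rwa [hw, mul_inv_cancel_right])
    refine isSemisimple_of_pow_eq hm h ?_
    rw [map_zpow]
    exact (hF f₁ hf₀).zpow j
  · obtain ⟨m, hm, h⟩ := exists_map_pow_eq hσ hc ψ (w := w) (w' := 1) (by
      rw [inv_one, mul_one]
      exact mem_inertia_of_geomFrob₀_empty hσ hc (fun f hf => hex ⟨f, hf⟩) w.2)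
    refine isSemisimple_of_pow_eq hm h ?_
    rw [map_one]
    exact LGroupData.isSemisimple_one

/-- The SL₂ conditions agree entry by entry. The other two need a transfer between `k₀` and `k`: the
open subgroup is shrunk, and Frobenius elements of the two fields are compared through powers. -/
theorem isAdmissible_iff_nonarchimedean (hσ : ∀ x, σ (σ x) = x) (hc : Continuous σ)
    (hL : L.IsStandard)
    (hr : ∀ w, (f w).right = AlgEquiv.restrictNormalHom L.K (WD₀.toGal σ Ω .nonarchimedean w)) :
    IsAdmissible L .nonarchimedean f ↔ IsWDRep .nonarchimedean (homRep hr) := by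
  have : Algebra.IsAlgebraic k Ω := Algebra.IsSeparable.isAlgebraic k Ω
  have hSL : ∀ g, homRep hr ⟨ofSL₂ σ Ω g, ofSL₂_mem σ Ω g⟩ =
      Matrix.toLin' (L.incl (f (ofSL₂ σ Ω g)).left : Matrix (Fin L.N) (Fin L.N) ℂ) := by
    intro g
    refine homRep_of_right_eq_one hr hL _ ?_
    rw [hr]
    exact map_one (AlgEquiv.restrictNormalHom L.K)
  have hU : (∃ U : Subgroup (AbsGal σ Ω), IsOpen (U : Set (AbsGal σ Ω)) ∧
        ∀ w : nonarchWeil σ Ω, (w : AbsGal σ Ω) ∈ inertia σ Ω → (w : AbsGal σ Ω) ∈ U →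
          f (ofWeil σ Ω w) = 1) ↔
      ∃ U : Subgroup (AbsGal σ Ω), IsOpen (U : Set (AbsGal σ Ω)) ∧
        ∀ (w : nonarchWeil σ Ω) (hw : (w : AbsGal σ Ω) ∈ galOver σ Ω),
          (w : AbsGal σ Ω) ∈ inertia σ Ω → (w : AbsGal σ Ω) ∈ U →
            homRep hr ⟨ofWeil σ Ω w, ofWeil_mem σ Ω w hw⟩ = 1 := by
    constructor
    · rintro ⟨U, hUo, hU⟩
      refine ⟨U, hUo, fun w hw hwI hwU => ?_⟩
      have h1 : f (ofWeil σ Ω w) = 1 := hU w hwI hwU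
      rw [homRep_of_right_eq_one hr hL ⟨ofWeil σ Ω w, _⟩ (by rw [h1]; rfl), h1,
        SemidirectProduct.one_left, map_one, Units.val_one, Matrix.toLin'_one]
      rfl
    · rintro ⟨U, hUo, hU⟩
      have := hL.finite
      -- The representation sees only `WD(k)`, and it determines `f` only where the Galois component
      -- is trivial; both restrictions cut out open subgroups.
      refine ⟨U ⊓ (galOver σ Ω ⊓ L.K.fixingSubgroup),
        hUo.inter ((isOpen_galOver hσ).inter L.K.fixingSubgroup_isOpen), ?_⟩
      rintro w hwI ⟨hwU, hw, hwK⟩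
      have hw' : (w : AbsGal σ Ω) ∈ galOver σ Ω := hw
      have h1 : (f (ofWeil σ Ω w)).right = 1 := by
        rw [hr]
        ext x
        exact (AlgEquiv.restrictNormalHom_apply _ _ _).trans (hwK x)
      have h2 := hU w hw hwI hwU
      rw [homRep_of_right_eq_one hr hL _ h1] at h2
      have h3 : L.incl (f (ofWeil σ Ω w)).left = 1 :=
        Units.ext (Matrix.toLin'.injective (h2.trans Matrix.toLin'_one.symm))
      exact SemidirectProduct.ext (hL.incl_injective (h3.trans (map_one _).symm)) h1
  constructor
  · rintro ⟨h1, h2, h3⟩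
    refine ⟨hU.mp h1, fun w hw hwF => ?_, ?_⟩
    · exact (isSemisimple_map_iff hr hL ⟨ofWeil σ Ω w, _⟩).mp
        (isSemisimple_map_ofWeil hσ hc h1 h2 w)
    · simp only [hSL]
      exact (isAlgebraicFun_entries_iff _).mp h3
  · rintro ⟨h1, h2, h3⟩
    refine ⟨hU.mpr h1, fun w hw => ?_, ?_⟩
    · obtain ⟨U, hUo, h4⟩ := hU.mpr h1
      let ψ : nonarchWeil σ Ω →* L.LG := f.comp (weilHom σ Ω)
      have := finite_map_inertiaWeil hσ hc ψ hUo h4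
      -- Semisimplicity is known only at Frobenius elements `F` of `k`. Such an `F` agrees modulo
      -- inertia with `w ^ n`, so their images have a common power.
      obtain ⟨F, hF, n, hn, hFw⟩ := exists_geomFrob hσ hc hw
      have hFW : F ∈ nonarchWeil σ Ω := by
        have hi : F * ((w : AbsGal σ Ω) ^ n)⁻¹ ∈ nonarchWeil σ Ω :=
          Subgroup.subset_closure (Or.inl hFw)
        exact (Subgroup.mul_mem_cancel_right _ (inv_mem (pow_mem w.2 n))).mp hi
      obtain ⟨m, hm, h⟩ := exists_map_pow_eq hσ hc ψ (w := ⟨F, hFW⟩) (w' := w ^ n) hFw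
      refine LGroupData.IsSemisimple.of_pow hn ?_
      have h5 : f (ofWeil σ Ω w) ^ n = ψ (w ^ n) := (map_pow ψ w n).symm
      rw [h5]
      refine isSemisimple_of_pow_eq hm h.symm ?_
      exact (isSemisimple_map_iff hr hL ⟨ofWeil σ Ω ⟨F, hFW⟩, ofWeil_mem σ Ω _ hF.1⟩).mpr
        (h2 ⟨F, hFW⟩ hF.1 hF)
    · simp only [hSL] at h3
      exact (isAlgebraicFun_entries_iff _).mpr h3

end Nonarch

/-! ### Admissibility in general and transport along isomorphisms -/

section General

universe u v

variable {k : Type u} [NontriviallyNormedField k] {κ : LocalKind} {σ : k ≃+* k}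
  {Ω : Type v} [Field Ω] [Algebra k Ω] {L : LGroupData σ Ω} {f : WD₀ σ Ω κ →* L.LG}

theorem isAdmissible_iff_isWDRep [IsSepClosure k Ω] (hk : IsLocalField κ k)
    (hσ : ∀ x, σ (σ x) = x) (hc : Continuous σ) (hL : L.IsStandard)
    (hr : ∀ w, (f w).right = AlgEquiv.restrictNormalHom L.K (WD₀.toGal σ Ω κ w)) :
    IsAdmissible L κ f ↔ IsWDRep κ (homRep hr) := by
  have : Algebra.IsAlgebraic k Ω := Algebra.IsSeparable.isAlgebraic k Ω
  cases κ with
  | archimedean => exact isAdmissible_iff_archimedean hk hσ hL hr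
  | nonarchimedean =>
    have : IsUltrametricDist k := hk.1
    have : LocallyCompactSpace k := hk.2
    have : ProperSpace k := ProperSpace.of_locallyCompactSpace k
    exact isAdmissible_iff_nonarchimedean hσ hc hL hr

variable {M : Type*} [AddCommGroup M] [Module ℂ M] {M' : Type*} [AddCommGroup M'] [Module ℂ M']

theorem isSemisimple_conj (T : M ≃ₗ[ℂ] M') {a : End ℂ M} {b : End ℂ M'}
    (h : ∀ m, T (a m) = b (T m)) [FiniteDimensional ℂ M'] (ha : a.IsSemisimple) : b.IsSemisimple := by
  have : FiniteDimensional ℂ M := T.symm.finiteDimensional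
  have hb : b = T.conjAlgEquiv ℂ a := LinearMap.ext fun m => by
    rw [LinearEquiv.conjAlgEquiv_apply]
    show b m = T (a (T.symm m))
    rw [h, T.apply_symm_apply]
  refine Module.End.isSemisimple_of_squarefree_aeval_eq_zero ha.minpoly_squarefree ?_
  rw [hb, Polynomial.aeval_algEquiv, AlgHom.comp_apply, minpoly.aeval, map_zero]

theorem isSemisimpleRepresentation_conj {G : Type*} [Group G] {ρ : Representation ℂ G M}
    {ρ' : Representation ℂ G M'} (T : M ≃ₗ[ℂ] M') (h : ∀ g m, T (ρ g m) = ρ' g (T m))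
    (hρ : ρ.IsSemisimpleRepresentation) : ρ'.IsSemisimpleRepresentation := by
  rw [isSemisimple_iff_exists_proj] at *
  intro W hW
  obtain ⟨P, hP, hPc⟩ := hρ (W.comap T.toLinearMap) fun g x hx => by
    show T (ρ g x) ∈ W
    rw [h]
    exact hW g _ hx
  refine ⟨T.toLinearMap ∘ₗ P ∘ₗ T.symm.toLinearMap, ⟨fun x => hP.map_mem _, fun x hx => ?_⟩, ?_⟩
  · show T (P (T.symm x)) = x
    rw [hP.map_id _ (by show T (T.symm x) ∈ W; rwa [T.apply_symm_apply]), T.apply_symm_apply]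
  · intro g
    refine LinearMap.ext fun m => ?_
    show T (P (T.symm (ρ' g m))) = ρ' g (T (P (T.symm m)))
    rw [← h]
    congr 1
    have h1 : T.symm (ρ' g m) = ρ g (T.symm m) := by
      rw [LinearEquiv.symm_apply_eq, h, T.apply_symm_apply]
    rw [h1]
    exact LinearMap.congr_fun (hPc g) (T.symm m)

theorem isWDRep_conj [FiniteDimensional ℂ M'] {ρ : Representation ℂ (WD κ σ Ω) M}
    {ρ' : Representation ℂ (WD κ σ Ω) M'} (T : M ≃ₗ[ℂ] M') (h : ∀ g m, T (ρ g m) = ρ' g (T m))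
    (hρ : IsWDRep κ ρ) : IsWDRep κ ρ' := by
  have hmat : ∀ g m (l : M' →ₗ[ℂ] ℂ), l (ρ' g m) = (l ∘ₗ T.toLinearMap) (ρ g (T.symm m)) := by
    intro g m l
    show _ = l (T (ρ g (T.symm m)))
    rw [h, T.apply_symm_apply]
  cases κ with
  | archimedean =>
    refine ⟨fun m l => ?_, isSemisimpleRepresentation_conj T h hρ.2⟩
    simp only [hmat]
    exact hρ.1 _ _
  | nonarchimedean =>
    obtain ⟨⟨U, hUo, hU⟩, h2, h3⟩ := hρ
    refine ⟨⟨U, hUo, fun w hw hwI hwU => LinearMap.ext fun m => ?_⟩, fun w hw hF => ?_,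
      fun m l => ?_⟩
    · have h4 := h ⟨ofWeil σ Ω w, ofWeil_mem σ Ω w hw⟩ (T.symm m)
      rw [hU w hw hwI hwU, T.apply_symm_apply] at h4
      rw [← h4]
      exact T.apply_symm_apply m
    · exact isSemisimple_conj T (h _) (h2 w hw hF)
    · simp only [hmat]
      exact h3 _ _

end General

/-! ### Complete reducibility when σ is trivial -/

section Semisimple

universe u v

variable {k : Type u} [NontriviallyNormedField k] {κ : LocalKind}
  {Ω : Type v} [Field Ω] [Algebra k Ω]

theorem WD_refl : WD κ (RingEquiv.refl k) Ω = ⊤ := by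
  unfold WD
  rw [galOver_refl, Subgroup.comap_top]

variable [IsSepClosure k Ω] {M : Type*} [AddCommGroup M] [Module ℂ M] [FiniteDimensional ℂ M]

/-- An invariant projection is built in three stages: one commuting with a semisimple Frobenius,
then its average over SU(2), then an average over a finite quotient of the Weil group. -/
theorem isSemisimpleRepresentation_of_isWDRep (hk : IsLocalField κ k)
    {ρ : Representation ℂ (WD κ (RingEquiv.refl k) Ω) M} (hρ : IsWDRep κ ρ) :
    ρ.IsSemisimpleRepresentation := by
  have : Algebra.IsAlgebraic k Ω := Algebra.IsSeparable.isAlgebraic k Ω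
  cases κ with
  | archimedean => exact hρ.2
  | nonarchimedean =>
    have : IsUltrametricDist k := hk.1
    have : LocallyCompactSpace k := hk.2
    have : ProperSpace k := ProperSpace.of_locallyCompactSpace k
    have hσ : ∀ x : k, RingEquiv.refl k (RingEquiv.refl k x) = x := fun _ => rfl
    have hc : Continuous (RingEquiv.refl k) := continuous_id
    obtain ⟨⟨U, hUo, hU⟩, h2, h3⟩ := hρ
    have hgal : ∀ w : AbsGal (RingEquiv.refl k) Ω, w ∈ galOver (RingEquiv.refl k) Ω := fun w => by
      rw [galOver_refl]; trivial
    let ι : nonarchWeil (RingEquiv.refl k) Ω →* WD .nonarchimedean (RingEquiv.refl k) Ω :=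
      (weilHom (RingEquiv.refl k) Ω).codRestrict _ fun w => ofWeil_mem _ Ω w (hgal w)
    let ψ : nonarchWeil (RingEquiv.refl k) Ω →* (End ℂ M)ˣ := (ρ.comp ι).toHomUnits
    have hψ : ∀ w, (ψ w : End ℂ M) = ρ (ι w) := fun w => rfl
    have := finite_map_inertiaWeil hσ hc ψ hUo fun w hwI hwU =>
      Units.ext (hU w (hgal w) hwI hwU)
    obtain ⟨g, hg, hgq⟩ := exists_frobenius (Ω := Ω) (RingEquiv.refl k)
    have hfix : fixedField (RingEquiv.refl k) = ⊤ := eq_top_iff.mpr fun x _ => rfl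
    have hF₀ : g⁻¹ ∈ geomFrob₀ (RingEquiv.refl k) Ω := by
      show ActsOnResidueAsPow _ _ _
      rwa [inv_inv, hfix]
    have hF : g⁻¹ ∈ geomFrob (RingEquiv.refl k) Ω := ⟨hgal _, by rwa [inv_inv]⟩
    let F : nonarchWeil (RingEquiv.refl k) Ω := ⟨g⁻¹, Subgroup.subset_closure (Or.inr hF₀)⟩
    have hfin := finiteIndex_comap_zpowers hσ hc ψ (f := F) hF₀
    have hZ : Module.End.IsSemisimple (ρ (ι F)) := h2 F (hgal _) hF
    let R : Representation ℂ (Matrix.SpecialLinearGroup (Fin 2) ℂ) M :=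
      ρ.comp ((MonoidHom.inr (nonarchWeil (RingEquiv.refl k) Ω)
        (Matrix.SpecialLinearGroup (Fin 2) ℂ) : _ →* WD₀ (RingEquiv.refl k) Ω .nonarchimedean).codRestrict
        (WD .nonarchimedean (RingEquiv.refl k) Ω) fun g => ofSL₂_mem _ Ω g)
    rw [isSemisimple_iff_exists_proj]
    intro W hW
    obtain ⟨P, hP, hPc⟩ := exists_proj_of_commute (fun _ : Unit => ρ (ι F)) (fun _ _ => rfl)
      (fun _ => hZ) (fun _ => hW _)
    have hRι : ∀ g w, Commute (R g) (ρ (ι w)) := by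
      intro g w
      show ρ _ * ρ _ = ρ _ * ρ _
      rw [← map_mul, ← map_mul]
      congr 1
      refine Subtype.ext (Prod.ext ?_ ?_)
      · exact (one_mul _).trans (mul_one _).symm
      · exact (mul_one _).trans (one_mul _).symm
    -- Averaging over SU(2) preserves commutation with Frobenius, since the Weil group commutes with
    -- SL₂(ℂ).
    obtain ⟨P', hP', hRP, hZP⟩ := exists_proj_of_isAlgebraic R h3 (fun g => hW _) hP
    have hP'F := hZP _ (hPc ()) (fun g => hRι g F)
    let pr : WD .nonarchimedean (RingEquiv.refl k) Ω →* nonarchWeil (RingEquiv.refl k) Ω :=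
      (MonoidHom.fst (nonarchWeil (RingEquiv.refl k) Ω)
        (Matrix.SpecialLinearGroup (Fin 2) ℂ)).comp
        (WD .nonarchimedean (RingEquiv.refl k) Ω).subtype
    have := finiteIndex_comap ((Subgroup.zpowers (ψ F)).comap ψ) pr
    -- The Weil elements whose image is a power of that of Frobenius, times SL₂(ℂ), form a subgroup
    -- of finite index already commuting with `P'`.
    refine exists_proj_of_finiteIndex ρ (((Subgroup.zpowers (ψ F)).comap ψ).comap pr) hW hP' ?_
    rintro τ ⟨j, hj⟩
    have h4 : τ = ι (pr τ) * ⟨ofSL₂ _ Ω τ.1.2, ofSL₂_mem _ Ω _⟩ := by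
      refine Subtype.ext (Prod.ext ?_ ?_)
      · exact (mul_one _).symm
      · exact (one_mul _).symm
    rw [h4, map_mul]
    refine Commute.mul_right ?_ (hRP _)
    have h5 : ψ F ^ j = ψ (pr τ) := hj
    rw [← hψ, ← h5]
    exact Commute.units_zpow_right hP'F j

end Semisimple

end ClassicalPar

namespace ClassicalPar

open Module

/-! ### Making isomorphisms isometric -/

section Forms

variable {M : Type*} [AddCommGroup M] [Module ℂ M] {M' : Type*} [AddCommGroup M'] [Module ℂ M']

/-- An equivalence of modules with operators which carry non-degenerate forms of the same type can
be chosen to be an isometry. -/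
theorem exists_isometry_of_equiv [FiniteDimensional ℂ M] {ι : Type*} (T₀ : M ≃ₗ[ℂ] M')
    {B : M →ₗ[ℂ] M →ₗ[ℂ] ℂ} {B' : M' →ₗ[ℂ] M' →ₗ[ℂ] ℂ}
    (hB : B.Nondegenerate) (hB' : B'.Nondegenerate) {f f₁ : ι → End ℂ M} {f' f₁' : ι → End ℂ M'}
    (hT : ∀ i m, T₀ (f i m) = f' i (T₀ m)) (hT₁ : ∀ i m, T₀ (f₁ i m) = f₁' i (T₀ m))
    (hf₁ : ∀ i, Function.Surjective (f₁ i)) (h : ∀ i m n, B (f i m) (f₁ i n) = B m n)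
    (h' : ∀ i m n, B' (f' i m) (f₁' i n) = B' m n) (b : ℂ) (i₀ : ι)
    (hs : ∀ m n, B n m = b * B m (f i₀ n)) (hs' : ∀ m n, B' n m = b * B' m (f' i₀ n)) :
    ∃ T : M ≃ₗ[ℂ] M', (∀ m n, B' (T m) (T n) = B m n) ∧ ∀ i m, T (f i m) = f' i (T m) := by
  -- Pulling `B'` back along `T₀` puts both forms on `M`; the isometry found there corrects `T₀`.
  let B₂ : M →ₗ[ℂ] M →ₗ[ℂ] ℂ := B'.compl₁₂ T₀.toLinearMap T₀.toLinearMap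
  have hB₂ : ∀ m n, B₂ m n = B' (T₀ m) (T₀ n) := fun m n => rfl
  have hnd : B₂.Nondegenerate := by
    refine ⟨fun m hm => ?_, fun n hn => ?_⟩
    · refine T₀.map_eq_zero_iff.mp (hB'.1 _ fun y => ?_)
      rw [← T₀.apply_symm_apply y]
      exact hm _
    · refine T₀.map_eq_zero_iff.mp (hB'.2 _ fun y => ?_)
      rw [← T₀.apply_symm_apply y]
      exact hn _
  obtain ⟨T, h1, h2⟩ := exists_isometry B B₂ hB hnd f f₁ hf₁ h
    (fun i m n => by rw [hB₂, hB₂, hT, hT₁, h']) b i₀ hs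
    (fun m n => by rw [hB₂, hB₂, hT]; exact hs' _ _)
  refine ⟨T.symm.trans T₀, fun m n => ?_, fun i m => ?_⟩
  · show B' (T₀ (T.symm m)) (T₀ (T.symm n)) = B m n
    rw [← hB₂, h1, T.apply_symm_apply, T.apply_symm_apply]
  · show T₀ (T.symm (f i m)) = f' i (T₀ (T.symm m))
    rw [← hT]
    congr 1
    rw [LinearEquiv.symm_apply_eq, h2, T.apply_symm_apply]

theorem surjective_representation {G : Type*} [Group G] (ρ : Representation ℂ G M) (g : G) :
    Function.Surjective (ρ g) := fun m => ⟨ρ g⁻¹ m, by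
  rw [← Module.End.mul_apply, ← map_mul, mul_inv_cancel, map_one, Module.End.one_apply]⟩

/-- Equivalent representations with self-duality forms of the same sign are isometric. -/
theorem exists_isometry_of_isSelfDualForm [FiniteDimensional ℂ M] {G : Type*} [Group G]
    {ρ : Representation ℂ G M} {ρ' : Representation ℂ G M'} (T₀ : M ≃ₗ[ℂ] M')
    (hT : ∀ g m, T₀ (ρ g m) = ρ' g (T₀ m)) {b : ℂ} {B : M →ₗ[ℂ] M →ₗ[ℂ] ℂ}
    {B' : M' →ₗ[ℂ] M' →ₗ[ℂ] ℂ} (hB : IsSelfDualForm ρ b B) (hB' : IsSelfDualForm ρ' b B') :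
    ∃ T : M ≃ₗ[ℂ] M', (∀ m n, B' (T m) (T n) = B m n) ∧ ∀ g m, T (ρ g m) = ρ' g (T m) :=
  exists_isometry_of_equiv T₀ hB.1 hB'.1 hT hT (surjective_representation ρ) hB.2.1 hB'.2.1 b 1
    (fun m n => by rw [map_one]; exact hB.2.2 m n) (fun m n => by rw [map_one]; exact hB'.2.2 m n)

/-- The case without operators: over ℂ dimension and sign classify non-degenerate forms. -/
theorem exists_isometry_of_finrank_eq [FiniteDimensional ℂ M] [FiniteDimensional ℂ M']
    (hd : finrank ℂ M = finrank ℂ M') {b : ℂ} {B : M →ₗ[ℂ] M →ₗ[ℂ] ℂ}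
    {B' : M' →ₗ[ℂ] M' →ₗ[ℂ] ℂ} (hB : B.Nondegenerate) (hB' : B'.Nondegenerate)
    (hs : ∀ m n, B n m = b * B m n) (hs' : ∀ m n, B' n m = b * B' m n) :
    ∃ T : M ≃ₗ[ℂ] M', ∀ m n, B' (T m) (T n) = B m n := by
  obtain ⟨T, hT, -⟩ := exists_isometry_of_equiv (LinearEquiv.ofFinrankEq M M' hd) hB hB'
    (ι := Unit) (f := fun _ => 1) (f₁ := fun _ => 1) (f' := fun _ => 1) (f₁' := fun _ => 1)
    (fun _ _ => rfl) (fun _ _ => rfl) (fun _ => Function.surjective_id) (fun _ _ _ => rfl)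
    (fun _ _ _ => rfl) b () hs hs'
  exact ⟨T, hT⟩

end Forms

section Matrices

open Matrix

variable {N : ℕ}

/-- The linear automorphism attached to an invertible matrix. -/
noncomputable def glEquiv (N : ℕ) : GL (Fin N) ℂ ≃* ((Fin N → ℂ) ≃ₗ[ℂ] (Fin N → ℂ)) :=
  Matrix.GeneralLinearGroup.toLin.trans (LinearMap.GeneralLinearGroup.generalLinearEquiv _ _)

theorem glEquiv_apply (g : GL (Fin N) ℂ) (x : Fin N → ℂ) :
    glEquiv N g x = (g : Matrix (Fin N) (Fin N) ℂ) *ᵥ x := rfl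

theorem exists_gl (a : (Fin N → ℂ) ≃ₗ[ℂ] (Fin N → ℂ)) :
    ∃ g : GL (Fin N) ℂ, ∀ x, (g : Matrix (Fin N) (Fin N) ℂ) *ᵥ x = a x := by
  obtain ⟨g, rfl⟩ := (glEquiv N).surjective a
  exact ⟨g, fun _ => rfl⟩

theorem gl_ext {g g' : GL (Fin N) ℂ}
    (h : ∀ x, (g : Matrix (Fin N) (Fin N) ℂ) *ᵥ x = (g' : Matrix (Fin N) (Fin N) ℂ) *ᵥ x) :
    g = g' := (glEquiv N).injective (LinearEquiv.ext h)

/-- The bilinear form with a given Gram matrix. -/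
noncomputable abbrev matForm (J : Matrix (Fin N) (Fin N) ℂ) :
    (Fin N → ℂ) →ₗ[ℂ] (Fin N → ℂ) →ₗ[ℂ] ℂ := Matrix.toLinearMap₂' ℂ J

theorem matForm_apply (J : Matrix (Fin N) (Fin N) ℂ) (m n : Fin N → ℂ) :
    matForm J m n = m ⬝ᵥ J *ᵥ n := Matrix.toLinearMap₂'_apply' J m n

theorem matForm_mulVec (J A C : Matrix (Fin N) (Fin N) ℂ) (m n : Fin N → ℂ) :
    matForm J (A *ᵥ m) (C *ᵥ n) = matForm (Aᵀ * J * C) m n := by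
  rw [matForm_apply, matForm_apply, ← Matrix.vecMul_transpose, ← Matrix.dotProduct_mulVec,
    Matrix.mulVec_mulVec, Matrix.mulVec_mulVec, mul_assoc]

theorem matForm_ext {J J' : Matrix (Fin N) (Fin N) ℂ} (h : ∀ m n, matForm J m n = matForm J' m n) :
    J = J' := (Matrix.toLinearMap₂' ℂ).injective (LinearMap.ext₂ h)

theorem matForm_swap (J : Matrix (Fin N) (Fin N) ℂ) (m n : Fin N → ℂ) :
    matForm J n m = matForm Jᵀ m n := by
  rw [matForm_apply, matForm_apply, dotProduct_comm, Matrix.dotProduct_mulVec,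
    Matrix.vecMul_transpose]

theorem matForm_nondegenerate {J : Matrix (Fin N) (Fin N) ℂ} (hJ : IsUnit J) :
    (matForm J).Nondegenerate :=
  LinearMap.nondegenerate_toLinearMap₂'_iff_det_ne_zero.mpr
    ((Matrix.isUnit_iff_isUnit_det J).mp hJ).ne_zero

theorem matForm_smul (c : ℂ) (J : Matrix (Fin N) (Fin N) ℂ) (m n : Fin N → ℂ) :
    matForm (c • J) m n = c * matForm J m n := by
  rw [matForm_apply, matForm_apply, Matrix.smul_mulVec, dotProduct_smul, smul_eq_mul]

end Matrices

/-! ### Parameters of symplectic and special orthogonal groups -/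

section SelfDual

universe u v

variable {k : Type u} [NontriviallyNormedField k] {κ : LocalKind} {σ : k ≃+* k}
  {Ω : Type v} [Field Ω] [Algebra k Ω]

/-- The L-group `L` is the extension of a special isometry group by a Galois group which acts by
conjugation by isometries. -/
structure LGroupData.IsSelfDual (L : LGroupData σ Ω) (J : Matrix (Fin L.N) (Fin L.N) ℂ) (b : ℂ)
    (h : (L.K ≃ₐ[fixedField σ] L.K) →* GL (Fin L.N) ℂ) : Prop where
  incl_injective : Function.Injective L.incl
  finite : FiniteDimensional (fixedField σ) L.K
  mem_range : ∀ g : GL (Fin L.N) ℂ, g ∈ L.incl.range ↔ g ∈ specialIsometryGroup J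
  isometry : ∀ γ, (h γ : Matrix (Fin L.N) (Fin L.N) ℂ)ᵀ * J * h γ = J
  incl_act : ∀ γ x, L.incl (L.act γ x) = h γ * L.incl x * (h γ)⁻¹
  std_eq : ∀ x : overBase L.K L.act, L.std x = L.incl x.1.left * h x.1.right
  isUnit : IsUnit J
  transpose : Jᵀ = b • J

variable {L : LGroupData σ Ω} {J : Matrix (Fin L.N) (Fin L.N) ℂ} {b : ℂ}
    {h : (L.K ≃ₐ[fixedField σ] L.K) →* GL (Fin L.N) ℂ} (D : L.IsSelfDual J b h)

namespace LGroupData.IsSelfDual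

include D

theorem isStandard : L.IsStandard where
  std_eq x hx := by rw [D.std_eq, hx, map_one, mul_one]
  incl_injective := D.incl_injective
  finite := D.finite

/-- The standard representation of the whole L-group. -/
noncomputable def fullStd : L.LG →* GL (Fin L.N) ℂ where
  toFun x := L.incl x.left * h x.right
  map_one' := by simp
  map_mul' x y := by
    rw [SemidirectProduct.mul_left, SemidirectProduct.mul_right, map_mul, map_mul, D.incl_act]
    group

theorem fullStd_apply (x : L.LG) : D.fullStd x = L.incl x.left * h x.right := rfl

theorem fullStd_inl (c : L.dual) : D.fullStd (SemidirectProduct.inl c) = L.incl c := by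
  rw [fullStd_apply, SemidirectProduct.left_inl, SemidirectProduct.right_inl, map_one, mul_one]

theorem ext {x y : L.LG} (h1 : D.fullStd x = D.fullStd y) (h2 : x.right = y.right) : x = y := by
  rw [fullStd_apply, fullStd_apply, h2] at h1
  exact SemidirectProduct.ext (D.incl_injective (mul_right_cancel h1)) h2

theorem rep_apply (φ : LParam κ L) (w : WD κ σ Ω) (x : Fin L.N → ℂ) :
    φ.rep w x = (D.fullStd (φ.toHom w) : Matrix (Fin L.N) (Fin L.N) ℂ) *ᵥ x := by
  have h1 : φ.rep w x =
    (L.std ⟨φ.toHom w, φ.mem_overBase w⟩ : Matrix (Fin L.N) (Fin L.N) ℂ) *ᵥ x := rfl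
  rw [h1, D.std_eq]
  rfl

theorem incl_mem (c : L.dual) : L.incl c ∈ specialIsometryGroup J :=
  (D.mem_range _).mp ⟨c, rfl⟩

theorem fullStd_isometry (x : L.LG) : (D.fullStd x : Matrix (Fin L.N) (Fin L.N) ℂ)ᵀ * J *
    D.fullStd x = J := by
  rw [fullStd_apply, Units.val_mul, Matrix.transpose_mul]
  calc _ = (h x.right : Matrix (Fin L.N) (Fin L.N) ℂ)ᵀ *
        ((L.incl x.left : Matrix (Fin L.N) (Fin L.N) ℂ)ᵀ * J * L.incl x.left) * h x.right := by
        simp only [mul_assoc]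
    _ = J := by rw [(D.incl_mem _).1, D.isometry]

theorem det_fullStd (x : L.LG) : Matrix.GeneralLinearGroup.det (D.fullStd x) =
    Matrix.GeneralLinearGroup.det (h x.right) := by
  rw [fullStd_apply, map_mul, (D.incl_mem _).2, one_mul]

theorem isSelfDualForm_rep (φ : LParam κ L) : IsSelfDualForm φ.rep b (matForm J) := by
  refine ⟨matForm_nondegenerate D.isUnit, fun w m n => ?_, fun m n => ?_⟩
  · rw [D.rep_apply, D.rep_apply, matForm_mulVec, D.fullStd_isometry]
  · rw [matForm_swap, D.transpose, matForm_smul]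

theorem isWDRep_rep [IsSepClosure k Ω] (hk : IsLocalField κ k) (hσ : ∀ x, σ (σ x) = x)
    (hc : Continuous σ) (φ : LParam κ L) : IsWDRep κ φ.rep :=
  (isAdmissible_iff_isWDRep hk hσ hc D.isStandard φ.right_eq).mp φ.admissible

/-- Parameters correspond to isometric representations with the right determinant. -/
theorem exists_param [IsSepClosure k Ω] (hk : IsLocalField κ k) (hσ : ∀ x, σ (σ x) = x)
    (hc : Continuous σ) (hW : ∀ w : WD₀ σ Ω κ, w ∈ WD κ σ Ω)
    {M : Type*} [AddCommGroup M] [Module ℂ M] {ρ : Representation ℂ (WD κ σ Ω) M}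
    (hρ : IsWDRep κ ρ) (T : M ≃ₗ[ℂ] (Fin L.N → ℂ)) {B : M →ₗ[ℂ] M →ₗ[ℂ] ℂ}
    (hB : ∀ τ m n, B (ρ τ m) (ρ τ n) = B m n) (hT : ∀ m n, matForm J (T m) (T n) = B m n)
    (hdet : ∀ τ : WD κ σ Ω, LinearMap.det (ρ τ) =
      (h (AlgEquiv.restrictNormalHom L.K (WD₀.toGal σ Ω κ τ))).1.det) :
    ∃ φ : LParam κ L, ∀ τ m, T (ρ τ m) = φ.rep τ (T m) := by
  let γ : WD₀ σ Ω κ →* (L.K ≃ₐ[fixedField σ] L.K) :=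
    (AlgEquiv.restrictNormalHom L.K).comp (WD₀.toGal σ Ω κ)
  have hA : ∀ w : WD₀ σ Ω κ, ∃ g : GL (Fin L.N) ℂ, ∀ x,
      (g : Matrix (Fin L.N) (Fin L.N) ℂ) *ᵥ x = T (ρ ⟨w, hW w⟩ (T.symm x)) := by
    intro w
    exact exists_gl ((T.symm.trans (LinearEquiv.ofBijective (ρ ⟨w, hW w⟩)
      ⟨fun x y hxy => by
        have := congrArg (ρ ⟨w, hW w⟩⁻¹) hxy
        simpa only [← Module.End.mul_apply, ← map_mul, inv_mul_cancel, map_one,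
          Module.End.one_apply] using this, surjective_representation ρ _⟩)).trans T)
  choose A hA using hA
  have hAiso : ∀ w, (A w : Matrix (Fin L.N) (Fin L.N) ℂ)ᵀ * J * A w = J := by
    intro w
    refine matForm_ext fun m n => ?_
    rw [← matForm_mulVec, hA, hA, hT, hB, ← hT, T.apply_symm_apply, T.apply_symm_apply]
  have hAdet : ∀ w, Matrix.GeneralLinearGroup.det (A w) =
      Matrix.GeneralLinearGroup.det (h (γ w)) := by
    intro w
    refine Units.ext ?_
    rw [Matrix.GeneralLinearGroup.val_det_apply, Matrix.GeneralLinearGroup.val_det_apply]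
    refine Eq.trans ?_ (hdet ⟨w, hW w⟩)
    rw [← LinearMap.det_toLin', ← LinearMap.det_conj (ρ ⟨w, hW w⟩) T]
    congr 1
    exact LinearMap.ext fun x => hA w x
  have hx : ∀ w, ∃ x : L.LG, D.fullStd x = A w ∧ x.right = γ w := by
    intro w
    -- Dividing by the isometry attached to the Galois component leaves determinant 1, hence an
    -- element of the dual group.
    have hmem : A w * (h (γ w))⁻¹ ∈ specialIsometryGroup J := by
      have h1 : ((h (γ w))⁻¹ : GL (Fin L.N) ℂ) = h (γ w)⁻¹ := (map_inv h _).symm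
      refine ⟨?_, by rw [map_mul, map_inv, hAdet, mul_inv_cancel]⟩
      rw [h1, Units.val_mul, Matrix.transpose_mul]
      calc _ = (h (γ w)⁻¹ : Matrix (Fin L.N) (Fin L.N) ℂ)ᵀ *
            ((A w : Matrix (Fin L.N) (Fin L.N) ℂ)ᵀ * J * A w) * h (γ w)⁻¹ := by
            simp only [mul_assoc]
        _ = J := by rw [hAiso, D.isometry]
    obtain ⟨c, hcx⟩ := (D.mem_range _).mpr hmem
    refine ⟨⟨c, γ w⟩, ?_, rfl⟩
    show L.incl c * h (γ w) = A w
    rw [hcx, inv_mul_cancel_right]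
  choose f hf hfr using hx
  have hAmul : ∀ w w', A (w * w') = A w * A w' := fun w w' => gl_ext fun x => by
    rw [hA, Units.val_mul, ← Matrix.mulVec_mulVec, hA, hA, T.symm_apply_apply,
      ← Module.End.mul_apply, ← map_mul]
    rfl
  have hAone : A 1 = 1 := mul_eq_left.mp ((hAmul 1 1).symm.trans (by rw [one_mul]))
  let F : WD₀ σ Ω κ →* L.LG :=
    { toFun := f
      map_one' := D.ext (by rw [hf, hAone, map_one]) (by rw [hfr, map_one]; rfl)
      map_mul' := fun w w' => D.ext (by rw [hf, hAmul, map_mul, hf, hf])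
        (by rw [hfr, map_mul, SemidirectProduct.mul_right, hfr, hfr]) }
  have hr : ∀ w, (F w).right = AlgEquiv.restrictNormalHom L.K (WD₀.toGal σ Ω κ w) := hfr
  have hequiv : ∀ τ m, T (ρ τ m) = homRep hr τ (T m) := by
    intro τ m
    rw [homRep_apply, D.std_eq]
    show _ = (D.fullStd (F τ) : Matrix (Fin L.N) (Fin L.N) ℂ) *ᵥ (T m)
    rw [show D.fullStd (F τ) = A τ from hf _, hA, T.symm_apply_apply]
  exact ⟨⟨F, (isAdmissible_iff_isWDRep hk hσ hc D.isStandard hr).mpr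
    (isWDRep_conj T hequiv hρ), hr⟩, hequiv⟩

/-- The representations of `WD(k)` given by parameters. -/
theorem exists_rep_equiv_iff [IsSepClosure k Ω] (hk : IsLocalField κ k) (hσ : ∀ x, σ (σ x) = x)
    (hc : Continuous σ) (hW : ∀ w : WD₀ σ Ω κ, w ∈ WD κ σ Ω)
    {M : Type*} [AddCommGroup M] [Module ℂ M] [FiniteDimensional ℂ M]
    (ρ : Representation ℂ (WD κ σ Ω) M) :
    (∃ φ : LParam κ L, Nonempty (φ.rep.Equiv ρ)) ↔
      IsWDRep κ ρ ∧ (∃ B, IsSelfDualForm ρ b B) ∧ finrank ℂ M = L.N ∧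
        ∀ τ : WD κ σ Ω, LinearMap.det (ρ τ) =
          (h (AlgEquiv.restrictNormalHom L.K (WD₀.toGal σ Ω κ τ))).1.det := by
  constructor
  · rintro ⟨φ, ⟨e⟩⟩
    let T := e.toLinearEquiv
    have hT : ∀ τ m, T (φ.rep τ m) = ρ τ (T m) := fun τ m =>
      LinearMap.congr_fun (e.isIntertwining' τ) m
    have hTs : ∀ τ m, T.symm (ρ τ m) = φ.rep τ (T.symm m) := fun τ m => by
      rw [LinearEquiv.symm_apply_eq, hT, T.apply_symm_apply]
    refine ⟨isWDRep_conj T hT (D.isWDRep_rep hk hσ hc φ), ?_, ?_, fun τ => ?_⟩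
    · obtain ⟨h1, h2, h3⟩ := D.isSelfDualForm_rep φ
      refine ⟨(matForm J).compl₁₂ T.symm.toLinearMap T.symm.toLinearMap, ⟨fun m hm => ?_,
        fun m hm => ?_⟩, fun τ m n => ?_, fun m n => h3 _ _⟩
      · refine T.symm.map_eq_zero_iff.mp (h1.1 _ fun y => ?_)
        rw [← T.symm_apply_apply y]
        exact hm _
      · refine T.symm.map_eq_zero_iff.mp (h1.2 _ fun y => ?_)
        rw [← T.symm_apply_apply y]
        exact hm _
      · show matForm J (T.symm (ρ τ m)) (T.symm (ρ τ n)) = matForm J (T.symm m) (T.symm n)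
        rw [hTs, hTs, h2]
    · rw [← T.finrank_eq, finrank_fin_fun]
    · have h1 : ρ τ = T.toLinearMap ∘ₗ φ.rep τ ∘ₗ T.symm.toLinearMap := LinearMap.ext fun m => by
        show ρ τ m = T (φ.rep τ (T.symm m))
        rw [hT, T.apply_symm_apply]
      have h2 : φ.rep τ = Matrix.toLin' (D.fullStd (φ.toHom τ) : Matrix (Fin L.N) (Fin L.N) ℂ) :=
        LinearMap.ext fun m => D.rep_apply φ τ m
      rw [h1, LinearMap.det_conj, h2, LinearMap.det_toLin', ← φ.right_eq]
      exact congrArg Units.val (D.det_fullStd _)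
  · rintro ⟨hρ, ⟨B, hB⟩, hd, hdet⟩
    obtain ⟨T, hT⟩ := exists_isometry_of_finrank_eq (M' := Fin L.N → ℂ)
      (by rw [hd, finrank_fin_fun]) hB.1 (matForm_nondegenerate D.isUnit) hB.2.2
      (b := b) (fun m n => by rw [matForm_swap, D.transpose, matForm_smul])
    obtain ⟨φ, hφ⟩ := D.exists_param hk hσ hc hW hρ T hB.2.1 hT hdet
    refine ⟨φ, ⟨Representation.Equiv.mk T.symm fun τ => LinearMap.ext fun m => ?_⟩⟩
    show T.symm (φ.rep τ m) = ρ τ (T.symm m)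
    rw [LinearEquiv.symm_apply_eq, hφ, T.apply_symm_apply]

/-- The Galois components of two parameters agree automatically, so equivalence is conjugacy in the
full standard representation by an isometry of determinant 1. -/
theorem equivalent_iff (φ φ' : LParam κ L) :
    φ.Equivalent φ' ↔ ∃ A : GL (Fin L.N) ℂ, (A : Matrix (Fin L.N) (Fin L.N) ℂ)ᵀ * J * A = J ∧
      Matrix.GeneralLinearGroup.det A = 1 ∧
      ∀ w, D.fullStd (φ'.toHom w) = A * D.fullStd (φ.toHom w) * A⁻¹ := by
  constructor
  · rintro ⟨g, hg⟩
    refine ⟨L.incl g, (D.incl_mem g).1, (D.incl_mem g).2, fun w => ?_⟩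
    rw [hg, map_mul, map_mul, map_inv, D.fullStd_inl]
  · rintro ⟨A, hA, hAd, hw⟩
    obtain ⟨g, rfl⟩ := (D.mem_range A).mpr ⟨hA, hAd⟩
    refine ⟨g, fun w => D.ext ?_ ?_⟩
    · rw [hw, map_mul, map_mul, map_inv, D.fullStd_inl]
    · have h1 : ((SemidirectProduct.inl g : L.LG) * φ.toHom w *
        (SemidirectProduct.inl g)⁻¹).right = (φ.toHom w).right := by
        rw [← map_inv, SemidirectProduct.mul_right, SemidirectProduct.mul_right,
          SemidirectProduct.right_inl, SemidirectProduct.right_inl, one_mul, mul_one]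
      rw [h1, φ.right_eq, φ'.right_eq]

/-- Without the determinant condition: any isomorphism can be replaced by an isometry. All failure
of injectivity is therefore a question of determinants. -/
theorem nonempty_equiv_iff (hW : ∀ w : WD₀ σ Ω κ, w ∈ WD κ σ Ω) (φ φ' : LParam κ L) :
    Nonempty (φ.rep.Equiv φ'.rep) ↔ ∃ A : GL (Fin L.N) ℂ,
      (A : Matrix (Fin L.N) (Fin L.N) ℂ)ᵀ * J * A = J ∧
      ∀ w, D.fullStd (φ'.toHom w) = A * D.fullStd (φ.toHom w) * A⁻¹ := by
  constructor
  · rintro ⟨e⟩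
    obtain ⟨T, hT, hTρ⟩ := exists_isometry_of_isSelfDualForm e.toLinearEquiv
      (fun τ m => LinearMap.congr_fun (e.isIntertwining' τ) m) (D.isSelfDualForm_rep φ)
      (D.isSelfDualForm_rep φ')
    obtain ⟨A, hA⟩ := exists_gl T
    refine ⟨A, matForm_ext fun m n => ?_, fun w => ?_⟩
    · rw [← matForm_mulVec, hA, hA, hT]
    · rw [eq_mul_inv_iff_mul_eq]
      refine gl_ext fun x => ?_
      rw [Units.val_mul, Units.val_mul, ← Matrix.mulVec_mulVec, ← Matrix.mulVec_mulVec, hA, hA]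
      have := hTρ ⟨w, hW w⟩ x
      rw [D.rep_apply, D.rep_apply] at this
      exact this.symm
  · rintro ⟨A, -, hA⟩
    refine ⟨Representation.Equiv.mk (glEquiv _ A) fun τ => LinearMap.ext fun m => ?_⟩
    show (A : Matrix (Fin L.N) (Fin L.N) ℂ) *ᵥ (φ.rep τ m) =
      φ'.rep τ ((A : Matrix (Fin L.N) (Fin L.N) ℂ) *ᵥ m)
    rw [D.rep_apply, D.rep_apply, hA, Matrix.mulVec_mulVec, Matrix.mulVec_mulVec,
      ← Units.val_mul, ← Units.val_mul, inv_mul_cancel_right]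

end LGroupData.IsSelfDual

/-- Reduces the comparison of centralizers to a membership criterion for matrices and operators that
correspond under `T`. -/
theorem centralizerIso_of {M : Type*} [AddCommGroup M] [Module ℂ M] {L : LGroupData σ Ω}
    (hinj : Function.Injective L.incl) (φ : LParam κ L) (C : Subgroup (M ≃ₗ[ℂ] M))
    (T : (Fin L.N → ℂ) ≃ₗ[ℂ] M)
    (hC : ∀ (g : GL (Fin L.N) ℂ) (a : M ≃ₗ[ℂ] M),
      (∀ x, a (T x) = T ((g : Matrix (Fin L.N) (Fin L.N) ℂ) *ᵥ x)) →
        (a ∈ C ↔ ∃ c ∈ φ.centralizer, L.incl c = g)) : CentralizerIso φ C := by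
  let θ : GL (Fin L.N) ℂ →* (M ≃ₗ[ℂ] M) :=
    { toFun := fun g => (T.symm.trans (glEquiv _ g)).trans T
      map_one' := LinearEquiv.ext fun x => by
        show T ((glEquiv _ 1) (T.symm x)) = x
        rw [map_one]
        exact T.apply_symm_apply x
      map_mul' := fun g g' => LinearEquiv.ext fun x => by
        show T (glEquiv _ (g * g') (T.symm x)) = T (glEquiv _ g (T.symm (T (glEquiv _ g' (T.symm x)))))
        rw [map_mul, T.symm_apply_apply]
        rfl }
  have hθ : ∀ g x, θ g (T x) = T ((g : Matrix (Fin L.N) (Fin L.N) ℂ) *ᵥ x) := fun g x => by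
    show T (glEquiv _ g (T.symm (T x))) = _
    rw [T.symm_apply_apply, glEquiv_apply]
  let e : φ.centralizer →* C := ((θ.comp L.incl).comp φ.centralizer.subtype).codRestrict C
    fun c => (hC (L.incl c) _ (hθ _)).mpr ⟨c, c.2, rfl⟩
  have he : ∀ c, (e c : M ≃ₗ[ℂ] M) = θ (L.incl c) := fun c => rfl
  refine ⟨T, MulEquiv.ofBijective e ⟨fun c c' hcc => ?_, fun a => ?_⟩, fun c x => hθ _ x⟩
  · refine Subtype.ext (hinj (gl_ext fun x => T.injective ?_))
    rw [← hθ, ← hθ, ← he, ← he, hcc]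
  · obtain ⟨g, hg⟩ := exists_gl ((T.trans a.1).trans T.symm)
    have ha : ∀ x, a.1 (T x) = T ((g : Matrix (Fin L.N) (Fin L.N) ℂ) *ᵥ x) := fun x => by
      rw [hg]
      exact (T.apply_symm_apply _).symm
    obtain ⟨c, hc, hcg⟩ := (hC g a ha).mp a.2
    refine ⟨⟨c, hc⟩, Subtype.ext (LinearEquiv.ext fun m => ?_)⟩
    rw [← T.apply_symm_apply m, ha, he, hθ, hcg]

include D in
-- An isometric isomorphism carries `J` to the given `B`, so the dual group corresponds to the
-- isometries of `B` of determinant 1.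
theorem LGroupData.IsSelfDual.centralizerIso (hW : ∀ w : WD₀ σ Ω κ, w ∈ WD κ σ Ω)
    (φ : LParam κ L) {M : Type*} [AddCommGroup M] [Module ℂ M]
    {ρ : Representation ℂ (WD κ σ Ω) M} (he : Nonempty (φ.rep.Equiv ρ))
    {B : M →ₗ[ℂ] M →ₗ[ℂ] ℂ} (hB : IsSelfDualForm ρ b B) :
    CentralizerIso φ (centralizerCPlus ρ B) := by
  obtain ⟨e⟩ := he
  obtain ⟨T, hT, hTρ⟩ := exists_isometry_of_isSelfDualForm e.toLinearEquiv
    (fun τ m => LinearMap.congr_fun (e.isIntertwining' τ) m) (D.isSelfDualForm_rep φ) hB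
  refine centralizerIso_of D.incl_injective φ _ T fun g a hga => ?_
  have hdet : LinearEquiv.det a = Matrix.GeneralLinearGroup.det g := by
    refine Units.ext ?_
    rw [LinearEquiv.coe_det, Matrix.GeneralLinearGroup.val_det_apply, ← LinearMap.det_toLin',
      ← LinearMap.det_conj (Matrix.toLin' g.1) T]
    congr 1
    refine LinearMap.ext fun m => ?_
    show a m = T ((g : Matrix (Fin L.N) (Fin L.N) ℂ) *ᵥ (T.symm m))
    rw [← hga, T.apply_symm_apply]
  constructor
  · rintro ⟨⟨h1, h2⟩, h3⟩
    have h3' : LinearEquiv.det a = 1 := h3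
    obtain ⟨c, rfl⟩ := (D.mem_range g).mpr ⟨matForm_ext fun m n => by
      rw [← matForm_mulVec, ← hT, ← hga, ← hga, h1, hT], by rw [← hdet, h3']⟩
    refine ⟨c, ?_, rfl⟩
    show SemidirectProduct.inl c ∈ Subgroup.centralizer _
    rw [Subgroup.mem_centralizer_iff]
    rintro _ ⟨w, rfl⟩
    refine D.ext (gl_ext fun x => T.injective ?_) ?_
    · rw [map_mul, map_mul, D.fullStd_inl, Units.val_mul, Units.val_mul, ← Matrix.mulVec_mulVec,
        ← Matrix.mulVec_mulVec, ← hga, ← D.rep_apply φ ⟨w, hW w⟩, ← D.rep_apply φ ⟨w, hW w⟩, hTρ,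
        hTρ, h2, hga]
    · rw [SemidirectProduct.mul_right, SemidirectProduct.mul_right, SemidirectProduct.right_inl,
        one_mul, mul_one]
  · rintro ⟨c, hc, rfl⟩
    refine ⟨⟨fun m n => ?_, fun τ m => ?_⟩, ?_⟩
    · rw [← T.apply_symm_apply m, ← T.apply_symm_apply n, hga, hga, hT, matForm_mulVec,
        (D.incl_mem c).1, hT]
    · rw [← T.apply_symm_apply m, hga, ← hTρ, ← hTρ, hga, D.rep_apply, D.rep_apply,
        Matrix.mulVec_mulVec, Matrix.mulVec_mulVec, ← Units.val_mul, ← Units.val_mul,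
        ← D.fullStd_inl, ← map_mul, ← map_mul]
      congr 4
      exact (Subgroup.mem_centralizer_iff.mp hc _ ⟨τ, rfl⟩).symm
    · show LinearEquiv.det a = 1
      rw [hdet, (D.incl_mem c).2]

end SelfDual

end ClassicalPar

namespace ClassicalPar

open Module

/-! ### The explicit matrices and the L-groups built from them -/

section MatrixFacts

variable {N : ℕ}

theorem altAntidiag_transpose (N : ℕ) : (altAntidiag N)ᵀ = ((-1 : ℂ) ^ (N - 1)) • altAntidiag N := by
  have h1 : altAntidiag N * (altAntidiag N)ᵀ =
      altAntidiag N * (((-1 : ℂ) ^ (N - 1)) • altAntidiag N) := by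
    rw [altAntidiag_mul_transpose, Matrix.mul_smul, altAntidiag_mul_self, smul_smul, ← mul_pow]
    simp
  exact (altGL N).isUnit.mul_left_cancel h1

theorem isUnit_altAntidiag (N : ℕ) : IsUnit (altAntidiag N) := (altGL N).isUnit

theorem antidiag_transpose (N : ℕ) : (antidiag N)ᵀ = antidiag N := by
  ext i j
  have : i = j.rev ↔ j = i.rev := ⟨fun h => by rw [h, Fin.rev_rev], fun h => by rw [h, Fin.rev_rev]⟩
  simp [antidiag, this]

theorem isUnit_antidiag (N : ℕ) : IsUnit (antidiag N) := by
  have h : antidiag N * antidiag N = 1 := by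
    ext i j
    rw [Matrix.mul_apply, Finset.sum_eq_single i.rev]
    · simp [antidiag, Matrix.one_apply, eq_comm]
    · intro l _ hl
      simp [antidiag, hl]
    · simp
  exact IsUnit.of_mul_eq_one _ h

theorem det_isometry_eq {J A : Matrix (Fin N) (Fin N) ℂ} (hJ : IsUnit J) (hA : Aᵀ * J * A = J) :
    A.det = 1 ∨ A.det = -1 := by
  have h1 := congrArg Matrix.det hA
  rw [Matrix.det_mul, Matrix.det_mul, Matrix.det_transpose] at h1
  have hJ0 : J.det ≠ 0 := ((Matrix.isUnit_iff_isUnit_det J).mp hJ).ne_zero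
  have h2 : A.det ^ 2 = 1 := by
    refine mul_right_cancel₀ hJ0 ?_
    linear_combination h1
  exact mul_self_eq_one_iff.mp (by rw [← sq, h2])

theorem gl_det_isometry_eq {J : Matrix (Fin N) (Fin N) ℂ} {A : GL (Fin N) ℂ} (hJ : IsUnit J)
    (hA : (A : Matrix (Fin N) (Fin N) ℂ)ᵀ * J * A = J) :
    Matrix.GeneralLinearGroup.det A = 1 ∨ Matrix.GeneralLinearGroup.det A = -1 :=
  (det_isometry_eq hJ hA).imp (fun h => Units.ext h) (fun h => Units.ext h)

theorem det_reflMatrix {n : ℕ} (hn : 0 < n) : (reflMatrix n).det = -1 := by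
  -- The two middle indices, counted from 0; the matrix is that of the transposition exchanging
  -- them.
  let a : Fin (2 * n) := ⟨n - 1, by omega⟩
  let c : Fin (2 * n) := ⟨n, by omega⟩
  have hac : a ≠ c := fun h => by
    have := congrArg Fin.val h
    simp only [a, c] at this
    omega
  have h : reflMatrix n = (Equiv.swap a c).permMatrix ℂ := by
    ext i j
    have hsw : middleSwap n i = Equiv.swap a c i := by
      unfold middleSwap
      have := i.2
      split_ifs with hi
      · rcases hi with hi | hi
        · have : i = a := Fin.ext (by simp only [a]; omega)
          rw [this, Equiv.swap_apply_left]
          refine Fin.ext ?_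
          rw [Fin.val_rev]
          simp only [a, c]
          omega
        · have : i = c := Fin.ext hi
          rw [this, Equiv.swap_apply_right]
          refine Fin.ext ?_
          rw [Fin.val_rev]
          simp only [a, c]
          omega
      · rw [Equiv.swap_apply_of_ne_of_ne]
        · rintro rfl
          exact hi (Or.inl (by simp only [a]; omega))
        · rintro rfl
          exact hi (Or.inr rfl)
    rw [reflMatrix, Matrix.of_apply, hsw, Equiv.Perm.permMatrix, PEquiv.toMatrix_apply]
    simp [Equiv.toPEquiv_apply, eq_comm]
  rw [h, Matrix.det_permutation, Equiv.Perm.sign_swap hac]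
  simp

theorem reflMatrix_isometry (n : ℕ) :
    (reflMatrix n)ᵀ * antidiag (2 * n) * reflMatrix n = antidiag (2 * n) := by
  rw [reflMatrix_transpose, reflMatrix_antidiag, mul_assoc, reflMatrix_mul_self, mul_one]

end MatrixFacts

section Instances

universe u v

variable {k : Type u} [NontriviallyNormedField k] (σ : k ≃+* k) (Ω : Type v) [Field Ω] [Algebra k Ω]

theorem splitLGroup_isSelfDual {N : ℕ} {J : Matrix (Fin N) (Fin N) ℂ} {b : ℂ} (hJ : IsUnit J)
    (hb : Jᵀ = b • J) : (splitLGroup σ Ω (specialIsometryGroup J)).IsSelfDual J b 1 := by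
  have h1 : ∀ g : GL (Fin N) ℂ,
      g ∈ (specialIsometryGroup J).subtype.range ↔ g ∈ specialIsometryGroup J := fun g => by
    rw [Subgroup.range_subtype]
  have h2 : ((1 : GL (Fin N) ℂ) : Matrix (Fin N) (Fin N) ℂ)ᵀ * J * (1 : GL (Fin N) ℂ) = J := by
    simp
  have h3 : ∀ x : GL (Fin N) ℂ, x = 1 * x * 1⁻¹ := fun x => by simp
  exact
    { incl_injective := Subtype.val_injective
      finite := inferInstanceAs (FiniteDimensional (fixedField σ)
        (⊥ : IntermediateField (fixedField σ) Ω))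
      mem_range := h1
      isometry := fun _ => h2
      incl_act := fun _ x => h3 x.1
      std_eq := fun x => (mul_one (x.1.left.1 : GL (Fin N) ℂ)).symm
      isUnit := hJ
      transpose := hb }

variable {σ}

theorem finiteDimensional_sqrtField (d : fixedField σ) :
    FiniteDimensional (fixedField σ) (sqrtField Ω d) := by
  classical
  unfold sqrtField
  have hfin : {x : Ω | x ^ 2 = algebraMap k Ω d}.Finite := by
    have hne : (Polynomial.X ^ 2 - Polynomial.C (algebraMap k Ω d) : Polynomial Ω) ≠ 0 :=
      Polynomial.X_pow_sub_C_ne_zero (by norm_num) _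
    refine (Polynomial.X ^ 2 - Polynomial.C (algebraMap k Ω d) : Polynomial Ω).roots.toFinset.finite_toSet.subset ?_
    intro x hx
    have hx' : x ^ 2 = algebraMap k Ω d := hx
    simp [hne, hx']
  have := hfin.to_subtype
  refine IntermediateField.finiteDimensional_adjoin fun x hx => ?_
  exact ⟨Polynomial.X ^ 2 - Polynomial.C d, Polynomial.monic_X_pow_sub_C _ (by norm_num), by
    have hx' : x ^ 2 = algebraMap k Ω d := hx
    rw [Polynomial.eval₂_sub, Polynomial.eval₂_pow, Polynomial.eval₂_X, Polynomial.eval₂_C, hx',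
      sub_eq_zero]
    rfl⟩

/-- The homomorphism from the Galois group of `k₀(√d)` to `O_{2n}(ℂ)`. -/
noncomputable def reflHom (n : ℕ) (d : fixedField σ) :
    (sqrtField Ω d ≃ₐ[fixedField σ] sqrtField Ω d) →* GL (Fin (2 * n)) ℂ :=
  homOfInvolution (sqrtField_gal Ω d) (refl n) (refl_mul_self n)

theorem lgroupSOEven_isSelfDual (n : ℕ) (d : fixedField σ) :
    (lgroupSOEven Ω n d).IsSelfDual (antidiag (2 * n)) 1 (reflHom Ω n d) := by
  have h1 : ∀ g : GL (Fin (2 * n)) ℂ,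
      g ∈ (SOEvenGroup n).subtype.range ↔ g ∈ SOEvenGroup n := fun g => by
    rw [Subgroup.range_subtype]
  have h2 : ∀ γ, (reflHom Ω n d γ : Matrix (Fin (2 * n)) (Fin (2 * n)) ℂ)ᵀ * antidiag (2 * n) *
      reflHom Ω n d γ = antidiag (2 * n) := fun γ => by
    by_cases h : γ = 1
    · rw [h, map_one]
      simp
    · have : reflHom Ω n d γ = refl n := homOfInvolution_of_ne _ _ _ h
      rw [this]
      exact reflMatrix_isometry n
  have h3 : ∀ γ (x : SOEvenGroup n), ((homOfInvolution (sqrtField_gal Ω d) (soInvolution n)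
      (soInvolution_mul_self n) γ x : SOEvenGroup n) : GL (Fin (2 * n)) ℂ) =
      reflHom Ω n d γ * x * (reflHom Ω n d γ)⁻¹ := fun γ x => by
    by_cases h : γ = 1
    · rw [h, map_one, map_one]
      simp
    · have h1 : reflHom Ω n d γ = refl n := homOfInvolution_of_ne _ _ _ h
      rw [h1, homOfInvolution_of_ne _ _ _ h, inv_eq_of_mul_eq_one_left (refl_mul_self n)]
      rfl
  exact
    { incl_injective := Subtype.val_injective
      finite := finiteDimensional_sqrtField Ω d
      mem_range := h1
      isometry := h2
      incl_act := h3
      std_eq := fun _ => rfl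
      isUnit := isUnit_antidiag _
      transpose := (antidiag_transpose _).trans (one_smul _ _).symm }

theorem restrict_eq_one_iff (d : fixedField σ) (g : AbsGal σ Ω) :
    AlgEquiv.restrictNormalHom (sqrtField Ω d) g = 1 ↔
      ∀ x : Ω, x ^ 2 = algebraMap k Ω d → g x = x := by
  constructor
  · intro h x hx
    have hmem : x ∈ sqrtField Ω d := IntermediateField.subset_adjoin _ _ hx
    have := congrArg Subtype.val (DFunLike.congr_fun h ⟨x, hmem⟩)
    rwa [AlgEquiv.restrictNormalHom_apply] at this
  · intro h
    refine sqrtField_ext Ω d _ fun r hr => Subtype.ext ?_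
    rw [AlgEquiv.restrictNormalHom_apply]
    exact h _ hr

/-- The Galois group acts nontrivially on `√d` exactly when the reflection occurs. For `n = 0` the
reflection is the empty matrix, of determinant 1, so the discriminant has to be 1 there. -/
theorem det_reflHom (n : ℕ) (d : fixedField σ) (hd : n = 0 → (d : k) = 1) (g : AbsGal σ Ω) :
    (reflHom Ω n d (AlgEquiv.restrictNormalHom (sqrtField Ω d) g)).1.det = discChar Ω (d : k) g := by
  unfold discChar
  by_cases h : AlgEquiv.restrictNormalHom (sqrtField Ω d) g = 1
  · rw [if_pos ((restrict_eq_one_iff Ω d g).mp h), h, map_one]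
    exact Matrix.det_one
  · rw [if_neg fun h' => h ((restrict_eq_one_iff Ω d g).mpr h')]
    have h1 : reflHom Ω n d (AlgEquiv.restrictNormalHom (sqrtField Ω d) g) = refl n :=
      homOfInvolution_of_ne _ _ _ h
    rw [h1]
    rcases Nat.eq_zero_or_pos n with hn | hn
    · exfalso
      refine h ((restrict_eq_one_iff Ω d g).mpr fun x hx => ?_)
      rw [hd hn, map_one] at hx
      rcases mul_self_eq_one_iff.mp ((sq x).symm.trans hx) with rfl | rfl
      · rw [map_one]
      · rw [map_neg, map_one]
    · exact det_reflMatrix hn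

end Instances

/-! ### Injectivity for odd orthogonal and symplectic dual groups -/

section Classes

universe u v

variable {k : Type u} [NontriviallyNormedField k] {κ : LocalKind} {σ : k ≃+* k}
  {Ω : Type v} [Field Ω] [Algebra k Ω] {L : LGroupData σ Ω}
  {J : Matrix (Fin L.N) (Fin L.N) ℂ} {h : (L.K ≃ₐ[fixedField σ] L.K) →* GL (Fin L.N) ℂ}

namespace LGroupData.IsSelfDual

/-- The scalar `-1` is a central isometry of determinant -1, so the conjugating isometry can be
corrected. -/
theorem nonempty_equiv_iff_equivalent_of_odd {b : ℂ} (D : L.IsSelfDual J b h) (hN : Odd L.N)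
    (hW : ∀ w : WD₀ σ Ω κ, w ∈ WD κ σ Ω) (φ φ' : LParam κ L) :
    Nonempty (φ.rep.Equiv φ'.rep) ↔ φ.Equivalent φ' := by
  rw [D.nonempty_equiv_iff hW, D.equivalent_iff]
  refine ⟨fun ⟨A, hA, hw⟩ => ?_, fun ⟨A, hA, _, hw⟩ => ⟨A, hA, hw⟩⟩
  rcases gl_det_isometry_eq D.isUnit hA with h | h
  · exact ⟨A, hA, h, hw⟩
  · refine ⟨-A, ?_, ?_, fun w => ?_⟩
    · rw [Units.val_neg, Matrix.transpose_neg, neg_mul, neg_mul_neg, hA]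
    · refine Units.ext ?_
      have h' := congrArg Units.val h
      rw [Matrix.GeneralLinearGroup.val_det_apply] at h' ⊢
      rw [Units.val_neg, Matrix.det_neg, h', Fintype.card_fin, hN.neg_one_pow]
      simp
    · rw [hw, inv_neg, neg_mul, neg_mul_neg]

theorem nonempty_equiv_iff_equivalent_of_skew (D : L.IsSelfDual J (-1) h)
    (hW : ∀ w : WD₀ σ Ω κ, w ∈ WD κ σ Ω) (φ φ' : LParam κ L) :
    Nonempty (φ.rep.Equiv φ'.rep) ↔ φ.Equivalent φ' := by
  rw [D.nonempty_equiv_iff hW, D.equivalent_iff]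
  refine ⟨fun ⟨A, hA, hw⟩ => ⟨A, hA, Units.ext ?_, hw⟩, fun ⟨A, hA, _, hw⟩ => ⟨A, hA, hw⟩⟩
  have h1 := det_symplectic (matForm_nondegenerate D.isUnit)
    (fun m n => by rw [matForm_swap, D.transpose, matForm_smul, neg_one_mul])
    (a := Matrix.toLin' A.1) (fun m n => by
      rw [Matrix.toLin'_apply, Matrix.toLin'_apply, matForm_mulVec, hA])
  rwa [LinearMap.det_toLin'] at h1

theorem isometry_mul {A C : GL (Fin L.N) ℂ} (hA : (A : Matrix (Fin L.N) (Fin L.N) ℂ)ᵀ * J * A = J)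
    (hC : (C : Matrix (Fin L.N) (Fin L.N) ℂ)ᵀ * J * C = J) :
    ((A * C : GL (Fin L.N) ℂ) : Matrix (Fin L.N) (Fin L.N) ℂ)ᵀ * J * (A * C : GL (Fin L.N) ℂ) =
      J := by
  rw [Units.val_mul, Matrix.transpose_mul]
  calc _ = (C : Matrix (Fin L.N) (Fin L.N) ℂ)ᵀ * ((A : Matrix (Fin L.N) (Fin L.N) ℂ)ᵀ * J *
        (A : Matrix (Fin L.N) (Fin L.N) ℂ)) * (C : Matrix (Fin L.N) (Fin L.N) ℂ) := by
        simp only [mul_assoc]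
    _ = _ := by rw [hA, hC]

end LGroupData.IsSelfDual

end Classes

/-! ### The exceptional even orthogonal case -/

section Summands

universe u v

variable {k : Type u} [NontriviallyNormedField k] {κ : LocalKind}
  {Ω : Type v} [Field Ω] [Algebra k Ω] [IsSepClosure k Ω] {L : LGroupData (RingEquiv.refl k) Ω}
  {J : Matrix (Fin L.N) (Fin L.N) ℂ}
  {h : (L.K ≃ₐ[fixedField (RingEquiv.refl k)] L.K) →* GL (Fin L.N) ℂ}

namespace LGroupData.IsSelfDual

/-- In odd dimension `-1` is itself an equivariant isometry of determinant -1. -/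
theorem not_orthogonalSummandsEven_of_odd (D : L.IsSelfDual J 1 h) (hN : Odd L.N)
    (hk : IsLocalField κ k) (hσ : ∀ x, RingEquiv.refl k (RingEquiv.refl k x) = x)
    (hc : Continuous (RingEquiv.refl k)) (φ : LParam κ L) :
    ¬ OrthogonalSummandsEven φ.rep := by
  have hB := D.isSelfDualForm_rep φ
  have hs : φ.rep.IsSemisimpleRepresentation :=
    isSemisimpleRepresentation_of_isWDRep hk (D.isWDRep_rep hk hσ hc φ)
  refine (not_orthogonalSummandsEven_iff (ρ := φ.rep) (B := matForm J) hs hB).mpr ?_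
  refine ⟨LinearEquiv.neg ℂ, ⟨fun m n => ?_, fun τ m => ?_⟩, ?_⟩
  · rw [LinearEquiv.neg_apply, LinearEquiv.neg_apply, map_neg, map_neg, LinearMap.neg_apply,
      neg_neg]
  · rw [LinearEquiv.neg_apply, LinearEquiv.neg_apply, map_neg]
  · have : ((LinearEquiv.neg ℂ : (Fin L.N → ℂ) ≃ₗ[ℂ] _) :
        End ℂ (Fin L.N → ℂ)) = (-1 : ℂ) • LinearMap.id := by
      refine LinearMap.ext fun x => ?_
      simp
    refine (congrArg LinearMap.det this).trans ?_
    rw [LinearMap.det_smul, LinearMap.det_id, finrank_fin_fun, hN.neg_one_pow, mul_one]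

theorem not_orthogonalSummandsEven_rep_iff (D : L.IsSelfDual J 1 h)
    (hW : ∀ w : WD₀ (RingEquiv.refl k) Ω κ, w ∈ WD κ (RingEquiv.refl k) Ω)
    (hk : IsLocalField κ k) (hσ : ∀ x, RingEquiv.refl k (RingEquiv.refl k x) = x)
    (hc : Continuous (RingEquiv.refl k)) (φ : LParam κ L) :
    ¬ OrthogonalSummandsEven φ.rep ↔
      ∃ A : GL (Fin L.N) ℂ, (A : Matrix (Fin L.N) (Fin L.N) ℂ)ᵀ * J * A = J ∧
        Matrix.GeneralLinearGroup.det A = -1 ∧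
        ∀ w, D.fullStd (φ.toHom w) = A * D.fullStd (φ.toHom w) * A⁻¹ := by
  have hB := D.isSelfDualForm_rep φ
  have hs : φ.rep.IsSemisimpleRepresentation :=
    isSemisimpleRepresentation_of_isWDRep hk (D.isWDRep_rep hk hσ hc φ)
  refine (not_orthogonalSummandsEven_iff (ρ := φ.rep) (B := matForm J) hs hB).trans ?_
  constructor
  · rintro ⟨a, ⟨h1, h2⟩, h3⟩
    obtain ⟨A, hA⟩ := exists_gl a
    refine ⟨A, matForm_ext fun m n => ?_, Units.ext ?_, fun w => ?_⟩
    · rw [← matForm_mulVec, hA, hA, h1]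
    · rw [Matrix.GeneralLinearGroup.val_det_apply, ← LinearMap.det_toLin']
      refine Eq.trans (congrArg LinearMap.det (LinearMap.ext fun x => ?_)) h3
      exact hA x
    · rw [eq_mul_inv_iff_mul_eq]
      refine gl_ext fun x => ?_
      rw [Units.val_mul, Units.val_mul, ← Matrix.mulVec_mulVec, ← Matrix.mulVec_mulVec, hA, hA]
      have := h2 ⟨w, hW w⟩ x
      rw [D.rep_apply, D.rep_apply] at this
      exact this.symm
  · rintro ⟨A, h1, h2, h3⟩
    refine ⟨glEquiv _ A, ⟨fun m n => ?_, fun τ m => ?_⟩, ?_⟩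
    · rw [glEquiv_apply, glEquiv_apply, matForm_mulVec, h1]
    · rw [glEquiv_apply, glEquiv_apply, D.rep_apply, D.rep_apply, Matrix.mulVec_mulVec,
        Matrix.mulVec_mulVec, ← Units.val_mul, ← Units.val_mul, eq_mul_inv_iff_mul_eq.mp (h3 τ)]
    · have : ((glEquiv _ A : (Fin L.N → ℂ) ≃ₗ[ℂ] _) : End ℂ (Fin L.N → ℂ)) =
        Matrix.toLin' A.1 := rfl
      refine (congrArg LinearMap.det this).trans ?_
      rw [LinearMap.det_toLin', ← Matrix.GeneralLinearGroup.val_det_apply, h2]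
      rfl

/-- A conjugating isometry of determinant -1 can be multiplied by one of determinant -1 that
centralizes the image of `φ`. For `N = 0` the determinant -1 does not occur. -/
theorem equivalent_of_not_orthogonalSummandsEven (D : L.IsSelfDual J 1 h)
    (hW : ∀ w : WD₀ (RingEquiv.refl k) Ω κ, w ∈ WD κ (RingEquiv.refl k) Ω)
    (hk : IsLocalField κ k) (hσ : ∀ x, RingEquiv.refl k (RingEquiv.refl k x) = x)
    (hc : Continuous (RingEquiv.refl k)) {φ φ' : LParam κ L}
    (hne : ¬ (0 < L.N ∧ OrthogonalSummandsEven φ.rep)) (he : Nonempty (φ.rep.Equiv φ'.rep)) :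
    φ.Equivalent φ' := by
  obtain ⟨A, hA, hw⟩ := (D.nonempty_equiv_iff hW φ φ').mp he
  rcases gl_det_isometry_eq D.isUnit hA with hdet | hdet
  · exact (D.equivalent_iff φ φ').mpr ⟨A, hA, hdet, hw⟩
  · have hn : 0 < L.N := by
      by_contra hn
      have : IsEmpty (Fin L.N) := by
        rw [Nat.eq_zero_of_not_pos hn]
        infer_instance
      have h1 := congrArg Units.val hdet
      rw [Matrix.GeneralLinearGroup.val_det_apply, Matrix.det_isEmpty] at h1
      norm_num at h1
    obtain ⟨C, hC, hCd, hCw⟩ := (D.not_orthogonalSummandsEven_rep_iff hW hk hσ hc φ).mp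
      fun h => hne ⟨hn, h⟩
    refine (D.equivalent_iff φ φ').mpr ⟨A * C, isometry_mul hA hC, ?_, fun w => ?_⟩
    · rw [map_mul, hdet, hCd]
      simp
    · rw [hw]
      conv_lhs => rw [hCw w]
      group

/-- If every irreducible orthogonal summand has even dimension, an isometry of determinant `-1`
yields a second class of parameters. -/
theorem exists_not_equivalent (D : L.IsSelfDual J 1 h) (hW : ∀ w : WD₀ (RingEquiv.refl k) Ω κ, w ∈ WD κ (RingEquiv.refl k) Ω)
    (hk : IsLocalField κ k) (hσ : ∀ x, RingEquiv.refl k (RingEquiv.refl k x) = x)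
    (hc : Continuous (RingEquiv.refl k)) {φ : LParam κ L}
    (hE : OrthogonalSummandsEven φ.rep) {r : GL (Fin L.N) ℂ}
    (hr : (r : Matrix (Fin L.N) (Fin L.N) ℂ)ᵀ * J * r = J)
    (hrd : Matrix.GeneralLinearGroup.det r = -1) (hrr : r * r = 1) :
    ∃ φ' : LParam κ L, Nonempty (φ.rep.Equiv φ'.rep) ∧ ¬ φ.Equivalent φ' ∧
      ∀ φ'' : LParam κ L, Nonempty (φ.rep.Equiv φ''.rep) →
        φ.Equivalent φ'' ∨ φ'.Equivalent φ'' := by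
  -- The second class is the conjugate by `r`, which preserves `J` and all determinants but does not
  -- lie in the dual group.
  obtain ⟨φ', hφ'⟩ := D.exists_param hk hσ hc hW (D.isWDRep_rep hk hσ hc φ) (glEquiv _ r)
    (D.isSelfDualForm_rep φ).2.1
    (fun m n => by rw [glEquiv_apply, glEquiv_apply, matForm_mulVec, hr]) (fun τ => by
      have h2 : φ.rep τ = Matrix.toLin' (D.fullStd (φ.toHom τ) : Matrix (Fin L.N) (Fin L.N) ℂ) :=
        LinearMap.ext fun m => D.rep_apply φ τ m
      rw [← φ.right_eq, h2, LinearMap.det_toLin']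
      exact congrArg Units.val (D.det_fullStd _))
  have hφw : ∀ w, D.fullStd (φ'.toHom w) = r * D.fullStd (φ.toHom w) * r⁻¹ := by
    intro w
    refine eq_mul_inv_iff_mul_eq.mpr (gl_ext fun x => ?_)
    have := hφ' ⟨w, hW w⟩ x
    rw [D.rep_apply, D.rep_apply, glEquiv_apply, glEquiv_apply] at this
    rw [Units.val_mul, Units.val_mul, ← Matrix.mulVec_mulVec, ← Matrix.mulVec_mulVec]
    exact this.symm
  have h3 : r⁻¹ = r := inv_eq_of_mul_eq_one_left hrr
  have h4 : ∀ z : GL (Fin L.N) ℂ, r * (r * z) = z := fun z => by rw [← mul_assoc, hrr, one_mul]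
  refine ⟨φ', (D.nonempty_equiv_iff hW φ φ').mpr ⟨r, hr, hφw⟩, fun h => ?_, fun φ'' h => ?_⟩
  · obtain ⟨A, hA, hAd, hw⟩ := (D.equivalent_iff φ φ').mp h
    -- If `A` of determinant 1 also conjugated `φ` to `φ'`, then `r * A = r⁻¹ * A` would centralize
    -- `φ` with determinant -1.
    refine (D.not_orthogonalSummandsEven_rep_iff hW hk hσ hc φ).mpr
      ⟨r * A, isometry_mul hr hA, ?_, fun w => ?_⟩ hE
    · rw [map_mul, hrd, hAd, mul_one]
    · have h1 := hφw w
      rw [hw] at h1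
      calc D.fullStd (φ.toHom w) = r⁻¹ * (r * D.fullStd (φ.toHom w) * r⁻¹) * r := by group
        _ = r⁻¹ * (A * D.fullStd (φ.toHom w) * A⁻¹) * r := by rw [h1]
        _ = _ := by
            rw [mul_inv_rev]
            simp only [h3, mul_assoc]
  · obtain ⟨A, hA, hw⟩ := (D.nonempty_equiv_iff hW φ φ'').mp h
    rcases gl_det_isometry_eq D.isUnit hA with hdet | hdet
    · exact Or.inl ((D.equivalent_iff φ φ'').mpr ⟨A, hA, hdet, hw⟩)
    -- An isometry of determinant -1 differs from `r` by one of determinant 1, so two classes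
    -- suffice.
    · refine Or.inr ((D.equivalent_iff φ' φ'').mpr ⟨A * r, isometry_mul hA hr, ?_, fun w => ?_⟩)
      · rw [map_mul, hdet, hrd]
        simp
      · rw [hw, hφw, mul_inv_rev]
        simp only [h3, mul_assoc, h4]

end LGroupData.IsSelfDual

end Summands

/-! ### The three cases with trivial involution -/

section Cases

universe u v w x

variable {k : Type u} [NontriviallyNormedField k] {κ : LocalKind} {Ω : Type v} [Field Ω]
  [Algebra k Ω] [IsSepClosure k Ω]

/-- Parameters of `Sp(V)`, `dim V = 2n`. -/
theorem parameters_Sp (hk : IsLocalField κ k) (n : ℕ) :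
    (∀ (M : Type w) [AddCommGroup M] [Module ℂ M] [FiniteDimensional ℂ M]
        (ρ : Representation ℂ (WD κ (RingEquiv.refl k) Ω) M),
        (∃ φ : LParam κ (lgroupSp (RingEquiv.refl k) Ω n), Nonempty (φ.rep.Equiv ρ)) ↔
          IsWDRep κ ρ ∧ IsOrthogonal ρ ∧ finrank ℂ M = 2 * n + 1 ∧
            ∀ τ, LinearMap.det (ρ τ) = 1) ∧
      (∀ φ φ' : LParam κ (lgroupSp (RingEquiv.refl k) Ω n),
        Nonempty (φ.rep.Equiv φ'.rep) ↔ φ.Equivalent φ') ∧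
      (∀ φ : LParam κ (lgroupSp (RingEquiv.refl k) Ω n), ¬ OrthogonalSummandsEven φ.rep) ∧
      (∀ (φ : LParam κ (lgroupSp (RingEquiv.refl k) Ω n))
        (M : Type w) [AddCommGroup M] [Module ℂ M] [FiniteDimensional ℂ M]
        (ρ : Representation ℂ (WD κ (RingEquiv.refl k) Ω) M), Nonempty (φ.rep.Equiv ρ) →
        ∀ B, IsSelfDualForm ρ 1 B → CentralizerIso φ (centralizerCPlus ρ B)) := by
  have hW : ∀ w : WD₀ (RingEquiv.refl k) Ω κ, w ∈ WD κ (RingEquiv.refl k) Ω := fun w => by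
    rw [WD_refl]; trivial
  have hσ : ∀ x : k, RingEquiv.refl k (RingEquiv.refl k x) = x := fun _ => rfl
  have hc : Continuous (RingEquiv.refl k) := continuous_id
  have D : (lgroupSp (RingEquiv.refl k) Ω n).IsSelfDual (altAntidiag (2 * n + 1)) 1 1 :=
    splitLGroup_isSelfDual _ Ω (isUnit_altAntidiag _) (by
      rw [altAntidiag_transpose, Nat.add_sub_cancel, pow_mul, neg_one_sq, one_pow])
  have hN : Odd (lgroupSp (RingEquiv.refl k) Ω n).N := ⟨n, rfl⟩
  refine ⟨fun M _ _ _ ρ => ?_, D.nonempty_equiv_iff_equivalent_of_odd hN hW,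
    D.not_orthogonalSummandsEven_of_odd hN hk hσ hc, fun φ M _ _ _ ρ he B hB =>
    D.centralizerIso hW φ he hB⟩
  · rw [D.exists_rep_equiv_iff hk hσ hc hW ρ]
    refine and_congr_right fun _ => and_congr_right fun _ => and_congr_right fun _ =>
      forall_congr' fun τ => ?_
    rw [MonoidHom.one_apply, Units.val_one, Matrix.det_one]

/-- Parameters of `SO(V)`, `dim V = 2n + 1`. -/
theorem parameters_SOOdd (hk : IsLocalField κ k) (n : ℕ) :
      (∀ (M : Type w) [AddCommGroup M] [Module ℂ M] [FiniteDimensional ℂ M]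
        (ρ : Representation ℂ (WD κ (RingEquiv.refl k) Ω) M),
        (∃ φ : LParam κ (lgroupSOOdd (RingEquiv.refl k) Ω n), Nonempty (φ.rep.Equiv ρ)) ↔
          IsWDRep κ ρ ∧ IsSymplectic ρ ∧ finrank ℂ M = 2 * n) ∧
      (∀ φ φ' : LParam κ (lgroupSOOdd (RingEquiv.refl k) Ω n),
        Nonempty (φ.rep.Equiv φ'.rep) ↔ φ.Equivalent φ') ∧
      (∀ (φ : LParam κ (lgroupSOOdd (RingEquiv.refl k) Ω n))
        (M : Type w) [AddCommGroup M] [Module ℂ M] [FiniteDimensional ℂ M]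
        (ρ : Representation ℂ (WD κ (RingEquiv.refl k) Ω) M), Nonempty (φ.rep.Equiv ρ) →
        ∀ B, IsSelfDualForm ρ (-1) B → CentralizerIso φ (centralizerCPlus ρ B)) := by
  have hW : ∀ w : WD₀ (RingEquiv.refl k) Ω κ, w ∈ WD κ (RingEquiv.refl k) Ω := fun w => by
    rw [WD_refl]; trivial
  have hσ : ∀ x : k, RingEquiv.refl k (RingEquiv.refl k x) = x := fun _ => rfl
  have hc : Continuous (RingEquiv.refl k) := continuous_id
  have htr : (altAntidiag (2 * n))ᵀ = (-1 : ℂ) • altAntidiag (2 * n) := by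
    -- The exponent `2n - 1` is truncated to 0 when `n = 0`; for empty matrices either sign is
    -- correct.
    rcases Nat.eq_zero_or_pos n with rfl | hn
    · ext i
      exact i.elim0
    · rw [altAntidiag_transpose, Odd.neg_one_pow ⟨n - 1, by omega⟩]
  have D : (lgroupSOOdd (RingEquiv.refl k) Ω n).IsSelfDual (altAntidiag (2 * n)) (-1) 1 :=
    splitLGroup_isSelfDual _ Ω (isUnit_altAntidiag _) htr
  refine ⟨fun M _ _ _ ρ => ?_, D.nonempty_equiv_iff_equivalent_of_skew hW, fun φ M _ _ _ ρ he B hB =>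
    D.centralizerIso hW φ he hB⟩
  · rw [D.exists_rep_equiv_iff hk hσ hc hW ρ]
    refine and_congr_right fun _ => and_congr_right fun ⟨B, hB⟩ =>
      ⟨fun h => h.1, fun h => ⟨h, fun τ => ?_⟩⟩
    rw [MonoidHom.one_apply, Units.val_one, Matrix.det_one]
    exact det_symplectic hB.1 (fun m n => by rw [hB.2.2 m n, neg_one_mul]) (hB.2.1 τ)

/-- Parameters of `SO(V)`, `dim V = 2n`. -/
theorem parameters_SOEven (hk : IsLocalField κ k) (n : ℕ) (d : fixedField (RingEquiv.refl k))
    (hd : n = 0 → (d : k) = 1) :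
      (∀ (M : Type w) [AddCommGroup M] [Module ℂ M] [FiniteDimensional ℂ M]
        (ρ : Representation ℂ (WD κ (RingEquiv.refl k) Ω) M),
        (∃ φ : LParam κ (lgroupSOEven Ω n d), Nonempty (φ.rep.Equiv ρ)) ↔
          IsWDRep κ ρ ∧ IsOrthogonal ρ ∧ finrank ℂ M = 2 * n ∧
            ∀ τ, LinearMap.det (ρ τ) = discChar Ω (d : k) (WD₀.toGal (RingEquiv.refl k) Ω κ τ)) ∧
      (∀ φ φ' : LParam κ (lgroupSOEven Ω n d),
        φ.Equivalent φ' → Nonempty (φ.rep.Equiv φ'.rep)) ∧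
      (∀ φ : LParam κ (lgroupSOEven Ω n d),
        (¬ (0 < n ∧ OrthogonalSummandsEven φ.rep) →
          ∀ φ' : LParam κ (lgroupSOEven Ω n d),
            Nonempty (φ.rep.Equiv φ'.rep) → φ.Equivalent φ') ∧
        (0 < n ∧ OrthogonalSummandsEven φ.rep →
          ∃ φ' : LParam κ (lgroupSOEven Ω n d),
            Nonempty (φ.rep.Equiv φ'.rep) ∧ ¬ φ.Equivalent φ' ∧
            ∀ φ'' : LParam κ (lgroupSOEven Ω n d), Nonempty (φ.rep.Equiv φ''.rep) →
              φ.Equivalent φ'' ∨ φ'.Equivalent φ'')) ∧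
      (∀ (φ : LParam κ (lgroupSOEven Ω n d))
        (M : Type w) [AddCommGroup M] [Module ℂ M] [FiniteDimensional ℂ M]
        (ρ : Representation ℂ (WD κ (RingEquiv.refl k) Ω) M), Nonempty (φ.rep.Equiv ρ) →
        ∀ B, IsSelfDualForm ρ 1 B → CentralizerIso φ (centralizerCPlus ρ B)) := by
  have hW : ∀ w : WD₀ (RingEquiv.refl k) Ω κ, w ∈ WD κ (RingEquiv.refl k) Ω := fun w => by
    rw [WD_refl]; trivial
  have hσ : ∀ x : k, RingEquiv.refl k (RingEquiv.refl k x) = x := fun _ => rfl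
  have hc : Continuous (RingEquiv.refl k) := continuous_id
  have D := lgroupSOEven_isSelfDual Ω n d
  have hN : 0 < (lgroupSOEven Ω n d).N ↔ 0 < n := Nat.mul_pos_iff_of_pos_left two_pos
  refine ⟨fun M _ _ _ ρ => ?_, fun φ φ' h => ?_, fun φ => ⟨fun hne φ' h => ?_, fun ⟨hn, hE⟩ => ?_⟩,
    fun φ M _ _ _ ρ he B hB => D.centralizerIso hW φ he hB⟩
  · rw [D.exists_rep_equiv_iff hk hσ hc hW ρ]
    refine and_congr_right fun _ => and_congr_right fun _ => and_congr_right fun _ =>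
      forall_congr' fun τ => ?_
    have := det_reflHom Ω n d hd (WD₀.toGal (RingEquiv.refl k) Ω κ τ)
    rw [← this]
    rfl
  · obtain ⟨A, hA, -, hw⟩ := (D.equivalent_iff φ φ').mp h
    exact (D.nonempty_equiv_iff hW φ φ').mpr ⟨A, hA, hw⟩
  · exact D.equivalent_of_not_orthogonalSummandsEven hW hk hσ hc
      (fun h' => hne ⟨hN.mp h'.1, h'.2⟩) h
  · have hr : ((refl n : GL (Fin (2 * n)) ℂ) : Matrix (Fin (2 * n)) (Fin (2 * n)) ℂ)ᵀ *
        antidiag (2 * n) * (refl n : GL (Fin (2 * n)) ℂ) = antidiag (2 * n) := reflMatrix_isometry n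
    have hrd : Matrix.GeneralLinearGroup.det (refl n) = -1 := Units.ext (det_reflMatrix hn)
    exact D.exists_not_equivalent hW hk hσ hc hE (r := refl n) hr hrd (refl_mul_self n)

end Cases

end ClassicalPar

namespace ClassicalPar

open Module

/-! ### Extending homomorphisms from a subgroup of index two -/

section Extension

/-- Extension of a homomorphism from a subgroup of index `2`. -/
theorem exists_hom_extension {G K : Type*} [Group G] [Group K] {H : Subgroup G}
    (hmul : ∀ x y, x ∉ H → y ∉ H → x * y ∈ H) {s : G} (hs : s ∉ H)
    (hconj : ∀ x : H, s * x * s⁻¹ ∈ H) (hsq : s * s ∈ H) (F : H →* K) (t : K)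
    (ht : ∀ x : H, t * F x = F ⟨s * x * s⁻¹, hconj x⟩ * t) (ht2 : t * t = F ⟨s * s, hsq⟩) :
    ∃ f : G →* K, (∀ x : H, f x = F x) ∧ ∀ x : H, f (x * s) = F x * t := by
  classical
  have hs' : s⁻¹ ∉ H := fun h => hs (H.inv_mem_iff.mp h)
  -- Elements outside `H` are written uniquely as `y s` with `y ∈ H`. The relations `ht` and `ht2`
  -- govern the products in which the first factor lies outside `H`.
  let f : G → K := fun x => if h : x ∈ H then F ⟨x, h⟩ else F ⟨x * s⁻¹, hmul x s⁻¹ h hs'⟩ * t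
  have f1 : ∀ x (h : x ∈ H), f x = F ⟨x, h⟩ := fun x h => dif_pos h
  have f2 : ∀ x : H, f (x * s) = F x * t := fun x => by
    have h : (x : G) * s ∉ H := fun h => hs ((H.mul_mem_cancel_left x.2).mp h)
    refine (dif_neg h).trans ?_
    congr 2
    exact Subtype.ext (mul_inv_cancel_right _ _)
  have hcase : ∀ x, x ∈ H ∨ ∃ y : H, x = y * s := fun x => by
    by_cases h : x ∈ H
    · exact Or.inl h
    · exact Or.inr ⟨⟨x * s⁻¹, hmul x s⁻¹ h hs'⟩, (inv_mul_cancel_right _ _).symm⟩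
  refine ⟨MonoidHom.mk' f fun x y => ?_, fun x => f1 x x.2, f2⟩
  rcases hcase x with hx | ⟨a, rfl⟩ <;> rcases hcase y with hy | ⟨c, rfl⟩
  · rw [f1 x hx, f1 y hy, f1 _ (mul_mem hx hy), ← map_mul]
    rfl
  · have := f2 (⟨x, hx⟩ * c)
    rw [map_mul, Subgroup.coe_mul] at this
    rw [f1 x hx, f2, ← mul_assoc, ← mul_assoc, ← this]
  · have := f2 (a * ⟨s * y * s⁻¹, hconj ⟨y, hy⟩⟩)
    rw [map_mul, mul_assoc (F a), ← ht ⟨y, hy⟩, Subgroup.coe_mul] at this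
    rw [f1 y hy, f2, mul_assoc (F a), ← this]
    congr 1
    group
  · have h1 : (a : G) * s * (c * s) = (a * ⟨s * c * s⁻¹, hconj c⟩ * ⟨s * s, hsq⟩ : H) := by
      simp only [Subgroup.coe_mul]
      group
    rw [h1, f1 _ (Subtype.mem _), f2, f2, Subtype.coe_eta, map_mul, map_mul, ← ht2]
    calc _ = F a * (F ⟨s * c * s⁻¹, hconj c⟩ * t) * t := by simp only [mul_assoc]
      _ = _ := by rw [← ht]; simp only [mul_assoc]

end Extension

/-! ### Form identities as identities in GL_N(ℂ) -/

section MatrixForms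

variable {N : ℕ}

/-- The square of `J` is a sign, so the sign of a duality becomes a group element. The exponent `N +
1` has the parity of `N - 1` without truncation at `N = 0`. -/
theorem coe_mul_altGL_mul_self (Y : GL (Fin N) ℂ) :
    ((Y * (altGL N * altGL N) : GL (Fin N) ℂ) : Matrix (Fin N) (Fin N) ℂ) =
      ((-1 : ℂ) ^ (N + 1)) • (Y : Matrix (Fin N) (Fin N) ℂ) := by
  show (Y : Matrix (Fin N) (Fin N) ℂ) * (altAntidiag N * altAntidiag N) = _
  rcases Nat.eq_zero_or_pos N with rfl | hN
  · ext i
    exact i.elim0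
  · rw [altAntidiag_mul_self, Matrix.mul_smul, mul_one]
    congr 1
    obtain ⟨m, rfl⟩ := Nat.exists_eq_succ_of_ne_zero hN.ne'
    rw [Nat.succ_eq_add_one, Nat.add_sub_cancel, pow_succ, pow_succ]
    ring

/-- The inverse of `invTranspose N g` is the transpose of `g`. In this form invariance can be
handled by computing in the group alone. -/
theorem matForm_gl_mulVec_eq_iff (X X' g g' : GL (Fin N) ℂ) :
    (∀ m n, matForm (X : Matrix (Fin N) (Fin N) ℂ) ((g : Matrix (Fin N) (Fin N) ℂ) *ᵥ m)
      ((g' : Matrix (Fin N) (Fin N) ℂ) *ᵥ n) = matForm (X' : Matrix (Fin N) (Fin N) ℂ) m n) ↔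
      (invTranspose N g)⁻¹ * X * g' = X' := by
  simp only [matForm_mulVec]
  refine ⟨fun h => Units.ext (matForm_ext h), fun h m n => ?_⟩
  rw [← h]
  rfl

theorem matForm_gl_swap_iff (X g : GL (Fin N) ℂ) :
    (∀ m n, matForm (X : Matrix (Fin N) (Fin N) ℂ) n m =
      (-1) ^ (N + 1) * matForm (X : Matrix (Fin N) (Fin N) ℂ) m
        ((g : Matrix (Fin N) (Fin N) ℂ) *ᵥ n)) ↔
      (invTranspose N X)⁻¹ = X * g * (altGL N * altGL N) := by
  have h1 : ∀ m n, (-1) ^ (N + 1) * matForm (X : Matrix (Fin N) (Fin N) ℂ) m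
      ((g : Matrix (Fin N) (Fin N) ℂ) *ᵥ n) =
      matForm ((X * g * (altGL N * altGL N) : GL (Fin N) ℂ) : Matrix (Fin N) (Fin N) ℂ) m n := by
    intro m n
    have := matForm_mulVec (X : Matrix (Fin N) (Fin N) ℂ) 1 (g : Matrix (Fin N) (Fin N) ℂ) m n
    rw [Matrix.one_mulVec, Matrix.transpose_one, one_mul] at this
    rw [this, ← matForm_smul, coe_mul_altGL_mul_self]
    rfl
  simp only [h1]
  refine ⟨fun h => Units.ext (matForm_ext fun m n => ?_), fun h m n => ?_⟩
  · rw [← h, matForm_swap]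
    rfl
  · rw [← h, matForm_swap]
    rfl

theorem exists_gl_matForm {B : (Fin N → ℂ) →ₗ[ℂ] (Fin N → ℂ) →ₗ[ℂ] ℂ} (hB : B.Nondegenerate) :
    ∃ X : GL (Fin N) ℂ, matForm (X : Matrix (Fin N) (Fin N) ℂ) = B := by
  have h1 : matForm (LinearMap.toMatrix₂' ℂ B) = B := Matrix.toLinearMap₂'_toMatrix' B
  have h2 : (LinearMap.toMatrix₂' ℂ B).det ≠ 0 :=
    LinearMap.nondegenerate_toLinearMap₂'_iff_det_ne_zero.mp (by rwa [← h1] at hB)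
  obtain ⟨X, hX⟩ := (Matrix.isUnit_iff_isUnit_det _).mpr (isUnit_iff_ne_zero.mpr h2)
  exact ⟨X, by rw [hX, h1]⟩

/-- The matrices of a representation. -/
theorem exists_glHom {G : Type*} [Group G] {M : Type*} [AddCommGroup M] [Module ℂ M]
    (ρ : Representation ℂ G M) (T : M ≃ₗ[ℂ] (Fin N → ℂ)) :
    ∃ A : G →* GL (Fin N) ℂ, ∀ g m, (A g : Matrix (Fin N) (Fin N) ℂ) *ᵥ T m = T (ρ g m) := by
  have hA : ∀ w, ∃ g : GL (Fin N) ℂ, ∀ x,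
      (g : Matrix (Fin N) (Fin N) ℂ) *ᵥ x = T (ρ w (T.symm x)) := by
    intro w
    exact exists_gl ((T.symm.trans (LinearEquiv.ofBijective (ρ w)
      ⟨fun x y hxy => by
        have := congrArg (ρ w⁻¹) hxy
        simpa only [← Module.End.mul_apply, ← map_mul, inv_mul_cancel, map_one,
          Module.End.one_apply] using this, surjective_representation ρ _⟩)).trans T)
  choose A hA using hA
  refine ⟨MonoidHom.mk' A fun w w' => gl_ext fun x => ?_, fun g m => ?_⟩
  · rw [hA, Units.val_mul, ← Matrix.mulVec_mulVec, hA, hA, T.symm_apply_apply,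
      ← Module.End.mul_apply, ← map_mul]
  · exact (hA g _).trans (by rw [T.symm_apply_apply])

end MatrixForms

/-! ### Parameters of unitary groups as conjugate-dual representations -/

section Unitary

universe u v

variable {k : Type u} [NontriviallyNormedField k] {κ : LocalKind} {σ : k ≃+* k}
  {Ω : Type v} [Field Ω] [Algebra k Ω]

/-- The L-group `L` is an extension of `GL_N(ℂ)` by `Gal(k/k₀)`, where the nontrivial element acts
by the pinned outer involution. -/
structure LGroupData.IsUnitary (L : LGroupData σ Ω) : Prop where
  incl_bijective : Function.Bijective L.incl
  finite : FiniteDimensional (fixedField σ) L.K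
  act_of_ne : ∀ γ ≠ 1, ∀ x, L.incl (L.act γ x) = glInvolutionFun L.N (L.incl x)
  gal_mul : ∀ a b : L.K ≃ₐ[fixedField σ] L.K, a ≠ 1 → b ≠ 1 → a * b = 1
  std_eq : ∀ x : overBase L.K L.act, L.std x = L.incl x.1.left
  restrict_eq_one_iff : ∀ g : AbsGal σ Ω,
    AlgEquiv.restrictNormalHom L.K g = 1 ↔ g ∈ galOver σ Ω

namespace LGroupData.IsUnitary

variable {L : LGroupData σ Ω}

theorem left_mul_of_eq {x : L.LG} (h : x.right = 1) (y : L.LG) :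
    L.incl (x * y).left = L.incl x.left * L.incl y.left := by
  rw [SemidirectProduct.mul_left, h, map_one, map_mul]
  rfl

/-- The Gram matrix of the conjugate-duality defined by a parameter. -/
noncomputable def gram (φ : LParam κ L) (s : WD₀ σ Ω κ) : GL (Fin L.N) ℂ :=
  (L.incl (φ.toHom s).left * altGL L.N)⁻¹

/-- `WD(k)` and `s` generate `WD(k₀)`, because products of two elements outside `WD(k)` lie in
`WD(k)`. -/
theorem hom_ext (hσ : ∀ x, σ (σ x) = x) {s : WD₀ σ Ω κ} (hs : s ∉ WD κ σ Ω) {K : Type*} [Group K]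
    {f f' : WD₀ σ Ω κ →* K} (h : ∀ τ : WD κ σ Ω, f τ = f' τ) (h' : f s = f' s) : f = f' := by
  refine MonoidHom.ext fun w => ?_
  by_cases hw : w ∈ WD κ σ Ω
  · exact h ⟨w, hw⟩
  · have hws : w * s ∈ WD κ σ Ω := by
      show WD₀.toGal σ Ω κ (w * s) ∈ galOver σ Ω
      rw [map_mul]
      exact mul_mem_galOver hσ hw hs
    have := h ⟨w * s, hws⟩
    simp only [map_mul, h'] at this
    exact mul_right_cancel this

variable (D : L.IsUnitary)

include D

theorem isStandard : L.IsStandard where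
  std_eq x _ := D.std_eq x
  incl_injective := D.incl_bijective.1
  finite := D.finite

theorem left_mul_of_ne {x : L.LG} (h : x.right ≠ 1) (y : L.LG) :
    L.incl (x * y).left = L.incl x.left * glInvolutionFun L.N (L.incl y.left) := by
  rw [SemidirectProduct.mul_left, map_mul, D.act_of_ne _ h]

theorem ext {x y : L.LG} (h1 : L.incl x.left = L.incl y.left) (h2 : x.right = y.right) : x = y :=
  SemidirectProduct.ext (D.incl_bijective.1 h1) h2

variable (φ φ' : LParam κ L)

theorem right_eq_one_iff {w : WD₀ σ Ω κ} : (φ.toHom w).right = 1 ↔ w ∈ WD κ σ Ω := by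
  rw [φ.right_eq]
  exact D.restrict_eq_one_iff _

theorem rep_apply (w : WD κ σ Ω) (x : Fin L.N → ℂ) :
    φ.rep w x = (L.incl (φ.toHom w).left : Matrix (Fin L.N) (Fin L.N) ℂ) *ᵥ x := by
  have h1 : φ.rep w x =
    (L.std ⟨φ.toHom w, φ.mem_overBase w⟩ : Matrix (Fin L.N) (Fin L.N) ℂ) *ᵥ x := rfl
  rw [h1, D.std_eq]

theorem isWDRep_rep [IsSepClosure k Ω] (hk : IsLocalField κ k) (hσ : ∀ x, σ (σ x) = x)
    (hc : Continuous σ) : IsWDRep κ φ.rep :=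
  (isAdmissible_iff_isWDRep hk hσ hc D.isStandard φ.right_eq).mp φ.admissible

/-- From `φ(s τ s⁻¹) φ(s) = φ(s) φ(τ)` and the twisted action of `φ(s)` one gets `g_{sτs⁻¹} = X⁻¹
ᵗg_τ⁻¹ X`, where `X = (g_s J)⁻¹`. -/
theorem conj_left (hσ : ∀ x, σ (σ x) = x) {s : WD₀ σ Ω κ} (hs : s ∉ WD κ σ Ω) (τ : WD κ σ Ω) :
    (invTranspose L.N (L.incl (φ.toHom τ).left))⁻¹ * gram φ s *
      L.incl (φ.toHom (s * τ * s⁻¹)).left = gram φ s := by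
  have h1 := left_mul_of_eq ((D.right_eq_one_iff φ).mpr (conj_mem_WD hσ s τ)) (φ.toHom s)
  rw [← map_mul, inv_mul_cancel_right, map_mul,
    D.left_mul_of_ne (mt (D.right_eq_one_iff φ).mp hs)] at h1
  rw [eq_comm, ← eq_mul_inv_iff_mul_eq] at h1
  rw [h1, gram, glInvolutionFun]
  group

/-- From `g_{s²} = g_s J ᵗg_s⁻¹ J⁻¹` and `ᵗJ⁻¹ = J`; the discrepancy between `X g_{s²}` and `ᵗX` is
the sign `J²`. -/
theorem sq_left {s : WD₀ σ Ω κ} (hs : s ∉ WD κ σ Ω) :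
    (invTranspose L.N (gram φ s))⁻¹ =
      gram φ s * L.incl (φ.toHom (s * s)).left * (altGL L.N * altGL L.N) := by
  rw [map_mul, D.left_mul_of_ne (mt (D.right_eq_one_iff φ).mp hs), gram, glInvolutionFun,
    invTranspose_inv, invTranspose_mul, invTranspose_altGL]
  group

theorem isConjDualForm_rep (hσ : ∀ x, σ (σ x) = x) {s : WD₀ σ Ω κ} (hs : s ∉ WD κ σ Ω) :
    IsConjDualForm hσ s φ.rep ((-1) ^ (L.N + 1))
      (matForm (gram φ s : Matrix (Fin L.N) (Fin L.N) ℂ)) := by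
  refine ⟨matForm_nondegenerate (gram φ s).isUnit, fun τ m n => ?_, fun m n => ?_⟩
  · rw [D.rep_apply, D.rep_apply]
    exact (matForm_gl_mulVec_eq_iff _ _ _ _).mpr (D.conj_left φ hσ hs τ) m n
  · rw [D.rep_apply]
    exact (matForm_gl_swap_iff _ _).mpr (D.sq_left φ hs) m n

variable {φ φ'}

/-- Equivalent conjugate-dual representations are isometric. -/
theorem exists_isometry (hσ : ∀ x, σ (σ x) = x) {s : WD₀ σ Ω κ} (hs : s ∉ WD κ σ Ω)
    {M : Type*} [AddCommGroup M] [Module ℂ M] {ρ : Representation ℂ (WD κ σ Ω) M}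
    (he : Nonempty (φ.rep.Equiv ρ)) {B : M →ₗ[ℂ] M →ₗ[ℂ] ℂ}
    (hB : IsConjDualForm hσ s ρ ((-1) ^ (L.N + 1)) B) :
    ∃ T : (Fin L.N → ℂ) ≃ₗ[ℂ] M,
      (∀ m n, B (T m) (T n) = matForm (gram φ s : Matrix (Fin L.N) (Fin L.N) ℂ) m n) ∧
      ∀ τ m, T (φ.rep τ m) = ρ τ (T m) := by
  obtain ⟨e⟩ := he
  have hT : ∀ τ m, e.toLinearEquiv (φ.rep τ m) = ρ τ (e.toLinearEquiv m) := fun τ m =>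
    LinearMap.congr_fun (e.isIntertwining' τ) m
  have hφ := D.isConjDualForm_rep φ hσ hs
  exact exists_isometry_of_equiv e.toLinearEquiv hφ.1 hB.1 (f := fun τ => φ.rep τ)
    (f₁ := fun τ : WD κ σ Ω => φ.rep ⟨s * τ * s⁻¹, conj_mem_WD hσ s τ⟩) (f' := fun τ => ρ τ)
    (f₁' := fun τ : WD κ σ Ω => ρ ⟨s * τ * s⁻¹, conj_mem_WD hσ s τ⟩) hT (fun _ => hT _)
    (fun _ => surjective_representation _ _) hφ.2.1 hB.2.1 _ ⟨s * s, sq_mem_WD hσ s⟩ hφ.2.2 hB.2.2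

/-- An isomorphism that is isometric for the two Gram matrices conjugates `φ` to `φ'` on `WD(k)` by
equivariance and at `s` by isometry. The dual group is all of GL_N(ℂ), so no determinant interferes.
-/
theorem nonempty_equiv_iff_equivalent (hσ : ∀ x, σ (σ x) = x) {s : WD₀ σ Ω κ}
    (hs : s ∉ WD κ σ Ω) : Nonempty (φ.rep.Equiv φ'.rep) ↔ φ.Equivalent φ' := by
  have hr : ∀ w, (φ'.toHom w).right = (φ.toHom w).right := fun w => by
    rw [φ.right_eq, φ'.right_eq]
  constructor
  · intro he
    obtain ⟨T, hT, hTρ⟩ := D.exists_isometry hσ hs he (D.isConjDualForm_rep φ' hσ hs)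
    obtain ⟨A, hA⟩ := exists_gl T
    obtain ⟨c, rfl⟩ := D.incl_bijective.2 A
    have h1 := (matForm_gl_mulVec_eq_iff (gram φ' s) (gram φ s) (L.incl c) (L.incl c)).mp
      fun m n => by rw [hA, hA, hT]
    refine ⟨c, fun w => ?_⟩
    have : φ'.toHom = (MulAut.conj (SemidirectProduct.inl c)).toMonoidHom.comp φ.toHom := by
      refine hom_ext hσ hs (fun τ => D.ext ?_ ?_) (D.ext ?_ ?_)
      · show _ = L.incl (SemidirectProduct.inl c * φ.toHom τ * (SemidirectProduct.inl c)⁻¹).left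
        have h2 : (φ.toHom τ).right = 1 := (D.right_eq_one_iff φ).mpr τ.2
        rw [left_mul_of_eq (by rw [SemidirectProduct.mul_right, h2, SemidirectProduct.right_inl,
          one_mul]), left_mul_of_eq (SemidirectProduct.right_inl c), ← map_inv,
          SemidirectProduct.left_inl, SemidirectProduct.left_inl, map_inv, eq_mul_inv_iff_mul_eq]
        refine gl_ext fun x => ?_
        rw [Units.val_mul, Units.val_mul, ← Matrix.mulVec_mulVec, ← Matrix.mulVec_mulVec, hA, hA,
          ← D.rep_apply, ← D.rep_apply, hTρ]
      · show _ = (SemidirectProduct.inl c * φ.toHom τ * (SemidirectProduct.inl c)⁻¹).right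
        rw [hr, ← map_inv, SemidirectProduct.mul_right, SemidirectProduct.mul_right,
          SemidirectProduct.right_inl, SemidirectProduct.right_inl, one_mul, mul_one]
      · show _ = L.incl (SemidirectProduct.inl c * φ.toHom s * (SemidirectProduct.inl c)⁻¹).left
        have h2 : (φ.toHom s).right ≠ 1 := mt (D.right_eq_one_iff φ).mp hs
        rw [D.left_mul_of_ne (by rwa [SemidirectProduct.mul_right, SemidirectProduct.right_inl,
          one_mul]), left_mul_of_eq (SemidirectProduct.right_inl c), ← map_inv,
          SemidirectProduct.left_inl, SemidirectProduct.left_inl, map_inv, glInvolutionFun,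
          invTranspose_inv]
        have h3 : gram φ' s = invTranspose L.N (L.incl c) * gram φ s * (L.incl c)⁻¹ := by
          rw [← h1]
          group
        have h4 : L.incl (φ'.toHom s).left = (gram φ' s)⁻¹ * (altGL L.N)⁻¹ := by
          rw [gram]
          group
        rw [h4, h3, gram]
        group
      · show _ = (SemidirectProduct.inl c * φ.toHom s * (SemidirectProduct.inl c)⁻¹).right
        rw [hr, ← map_inv, SemidirectProduct.mul_right, SemidirectProduct.mul_right,
          SemidirectProduct.right_inl, SemidirectProduct.right_inl, one_mul, mul_one]
    rw [this]
    rfl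
  · rintro ⟨c, hc⟩
    refine ⟨Representation.Equiv.mk (glEquiv _ (L.incl c)) fun τ => LinearMap.ext fun m => ?_⟩
    show (L.incl c : Matrix (Fin L.N) (Fin L.N) ℂ) *ᵥ (φ.rep τ m) =
      φ'.rep τ ((L.incl c : Matrix (Fin L.N) (Fin L.N) ℂ) *ᵥ m)
    have h2 : (φ.toHom τ).right = 1 := (D.right_eq_one_iff φ).mpr τ.2
    have h3 : L.incl (φ'.toHom τ).left * L.incl c = L.incl c * L.incl (φ.toHom τ).left := by
      have h4 : φ'.toHom τ * SemidirectProduct.inl c = SemidirectProduct.inl c * φ.toHom τ := by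
        rw [hc, inv_mul_cancel_right]
      have h5 : L.incl (φ'.toHom τ * SemidirectProduct.inl c).left =
          L.incl (SemidirectProduct.inl c * φ.toHom τ).left := by rw [h4]
      rwa [left_mul_of_eq ((hr _).trans h2), left_mul_of_eq (SemidirectProduct.right_inl c),
        SemidirectProduct.left_inl] at h5
    rw [D.rep_apply, D.rep_apply, Matrix.mulVec_mulVec, Matrix.mulVec_mulVec, ← Units.val_mul,
      ← Units.val_mul, h3]

/-- Commuting with `φ(WD(k))` is commuting with the representation, and commuting with `φ(s)` is
preserving the form. -/
theorem centralizerIso (hσ : ∀ x, σ (σ x) = x) {s : WD₀ σ Ω κ} (hs : s ∉ WD κ σ Ω)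
    {M : Type*} [AddCommGroup M] [Module ℂ M] {ρ : Representation ℂ (WD κ σ Ω) M}
    (he : Nonempty (φ.rep.Equiv ρ)) {B : M →ₗ[ℂ] M →ₗ[ℂ] ℂ}
    (hB : IsConjDualForm hσ s ρ ((-1) ^ (L.N + 1)) B) :
    CentralizerIso φ (centralizerC ρ B) := by
  obtain ⟨T, hT, hTρ⟩ := D.exists_isometry hσ hs he hB
  refine centralizerIso_of D.incl_bijective.1 φ _ T fun g a hga => ?_
  obtain ⟨c, rfl⟩ := D.incl_bijective.2 g
  have h1 : a ∈ autForm B ↔ (invTranspose L.N (L.incl c))⁻¹ * gram φ s * L.incl c = gram φ s := by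
    rw [← matForm_gl_mulVec_eq_iff]
    constructor
    · intro h m n
      rw [← hT, ← hT, ← hga, ← hga]
      exact h _ _
    · intro h m n
      rw [← T.apply_symm_apply m, ← T.apply_symm_apply n, hga, hga, hT, hT, h]
  have h2 : ∀ τ : WD κ σ Ω, (∀ m, a (ρ τ m) = ρ τ (a m)) ↔
      φ.toHom τ * SemidirectProduct.inl c = SemidirectProduct.inl c * φ.toHom τ := by
    intro τ
    have hr : (φ.toHom τ).right = 1 := (D.right_eq_one_iff φ).mpr τ.2
    have h3 : φ.toHom τ * SemidirectProduct.inl c = SemidirectProduct.inl c * φ.toHom τ ↔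
        L.incl (φ.toHom τ).left * L.incl c = L.incl c * L.incl (φ.toHom τ).left := by
      have e1 := left_mul_of_eq hr (SemidirectProduct.inl c)
      have e2 := left_mul_of_eq (SemidirectProduct.right_inl (φ := L.act) (n := c)) (φ.toHom τ)
      rw [SemidirectProduct.left_inl] at e1 e2
      rw [← e1, ← e2]
      refine ⟨fun h => by rw [h], fun h => D.ext h ?_⟩
      rw [SemidirectProduct.mul_right, SemidirectProduct.mul_right, hr]
      rfl
    rw [h3]
    constructor
    · refine fun h => gl_ext fun x => T.injective ?_
      rw [Units.val_mul, Units.val_mul, ← Matrix.mulVec_mulVec, ← Matrix.mulVec_mulVec, ← hga,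
        ← D.rep_apply φ τ, ← D.rep_apply φ τ, hTρ, hTρ, h, hga]
    · intro h m
      rw [← T.apply_symm_apply m, hga, ← hTρ, ← hTρ, hga, D.rep_apply, D.rep_apply,
        Matrix.mulVec_mulVec, Matrix.mulVec_mulVec, ← Units.val_mul, ← Units.val_mul, h]
  have h3 : a ∈ autForm B ↔
      φ.toHom s * SemidirectProduct.inl c = SemidirectProduct.inl c * φ.toHom s := by
    rw [h1]
    have hr : (φ.toHom s).right ≠ 1 := mt (D.right_eq_one_iff φ).mp hs
    have e1 := D.left_mul_of_ne hr (SemidirectProduct.inl c)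
    have e2 := left_mul_of_eq (SemidirectProduct.right_inl (φ := L.act) (n := c)) (φ.toHom s)
    rw [SemidirectProduct.left_inl] at e1 e2
    have e3 : φ.toHom s * SemidirectProduct.inl c = SemidirectProduct.inl c * φ.toHom s ↔
        L.incl (φ.toHom s).left * glInvolutionFun L.N (L.incl c) =
          L.incl c * L.incl (φ.toHom s).left := by
      rw [← e1, ← e2]
      refine ⟨fun h => by rw [h], fun h => D.ext h ?_⟩
      rw [SemidirectProduct.mul_right, SemidirectProduct.mul_right, SemidirectProduct.right_inl,
        one_mul, mul_one]
    rw [e3, gram, glInvolutionFun]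
    generalize L.incl (φ.toHom s).left = g
    generalize altGL L.N = j
    generalize invTranspose L.N (L.incl c) = d
    generalize L.incl c = c
    constructor
    · intro h
      have : (g * j)⁻¹ * c = d * (g * j)⁻¹ := by
        rwa [mul_assoc, inv_mul_eq_iff_eq_mul] at h
      calc g * (j * d * j⁻¹) = (g * j) * (d * (g * j)⁻¹) * g := by group
        _ = c * g := by rw [← this]; group
    · intro h
      calc d⁻¹ * (g * j)⁻¹ * c = d⁻¹ * (g * j)⁻¹ * (c * g) * g⁻¹ := by group
        _ = (g * j)⁻¹ := by rw [← h]; group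
  have h4 : a ∈ centralizerC ρ B ↔ c ∈ φ.centralizer := by
    have hl : a ∈ centralizerC ρ B ↔ a ∈ autForm B ∧ ∀ τ m, a (ρ τ m) = ρ τ (a m) := Iff.rfl
    have hr : c ∈ φ.centralizer ↔
        ∀ w, φ.toHom w * SemidirectProduct.inl c = SemidirectProduct.inl c * φ.toHom w := by
      show SemidirectProduct.inl c ∈ Subgroup.centralizer _ ↔ _
      rw [Subgroup.mem_centralizer_iff, Set.forall_mem_range]
    rw [hl, hr, h3]
    constructor
    · rintro ⟨ha, hb⟩ w
      have : (MulAut.conj (SemidirectProduct.inl c : L.LG)).toMonoidHom.comp φ.toHom = φ.toHom := by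
        refine hom_ext hσ hs (fun τ => ?_) ?_
        · exact mul_inv_eq_iff_eq_mul.mpr ((h2 τ).mp (hb τ)).symm
        · exact mul_inv_eq_iff_eq_mul.mpr ha.symm
      exact (mul_inv_eq_iff_eq_mul.mp (DFunLike.congr_fun this w)).symm
    · exact fun h => ⟨h s, fun τ => (h2 τ).mpr (h τ)⟩
  rw [h4]
  refine ⟨fun h => ⟨c, h, rfl⟩, ?_⟩
  rintro ⟨c', h, hc'⟩
  rwa [← D.incl_bijective.1 hc']

/-- Parameters correspond to conjugate-dual representations. -/
theorem exists_param [IsSepClosure k Ω] (hk : IsLocalField κ k) (hσ : ∀ x, σ (σ x) = x)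
    (hc : Continuous σ) {s : WD₀ σ Ω κ} (hs : s ∉ WD κ σ Ω)
    {M : Type*} [AddCommGroup M] [Module ℂ M] {ρ : Representation ℂ (WD κ σ Ω) M}
    (hρ : IsWDRep κ ρ) {B : M →ₗ[ℂ] M →ₗ[ℂ] ℂ}
    (hB : IsConjDualForm hσ s ρ ((-1) ^ (L.N + 1)) B) (T : M ≃ₗ[ℂ] (Fin L.N → ℂ)) :
    ∃ φ : LParam κ L, ∀ τ m, T (ρ τ m) = φ.rep τ (T m) := by
  obtain ⟨A, hA⟩ := exists_glHom ρ T
  have hnd : (B.compl₁₂ T.symm.toLinearMap T.symm.toLinearMap).Nondegenerate := by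
    refine ⟨fun m hm => T.symm.map_eq_zero_iff.mp (hB.1.1 _ fun y => ?_),
      fun m hm => T.symm.map_eq_zero_iff.mp (hB.1.2 _ fun y => ?_)⟩
    · rw [← T.symm_apply_apply y]
      exact hm _
    · rw [← T.symm_apply_apply y]
      exact hm _
  obtain ⟨X, hX⟩ := exists_gl_matForm hnd
  have hXB : ∀ m n, matForm (X : Matrix (Fin L.N) (Fin L.N) ℂ) (T m) (T n) = B m n := by
    intro m n
    rw [hX]
    show B (T.symm (T m)) (T.symm (T n)) = _
    rw [T.symm_apply_apply, T.symm_apply_apply]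
  have h1 : ∀ τ : WD κ σ Ω, (invTranspose L.N (A τ))⁻¹ * X *
      A ⟨s * τ * s⁻¹, conj_mem_WD hσ s τ⟩ = X := by
    intro τ
    refine (matForm_gl_mulVec_eq_iff _ _ _ _).mp fun m n => ?_
    rw [← T.apply_symm_apply m, ← T.apply_symm_apply n, hA, hA, hXB, hXB, hB.2.1]
  have h2 : (invTranspose L.N X)⁻¹ = X * A ⟨s * s, sq_mem_WD hσ s⟩ * (altGL L.N * altGL L.N) := by
    refine (matForm_gl_swap_iff _ _).mp fun m n => ?_
    rw [← T.apply_symm_apply m, ← T.apply_symm_apply n, hA, hXB, hXB, hB.2.2]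
  let ι := MulEquiv.ofBijective L.incl D.incl_bijective
  have hι : ∀ g, L.incl (ι.symm g) = g := ι.apply_symm_apply
  let γ : WD₀ σ Ω κ →* (L.K ≃ₐ[fixedField σ] L.K) :=
    (AlgEquiv.restrictNormalHom L.K).comp (WD₀.toGal σ Ω κ)
  have hγ : ∀ w, γ w = 1 ↔ w ∈ WD κ σ Ω := fun w => D.restrict_eq_one_iff _
  -- The value at `s` is forced: the Gram matrix `(g_s J)⁻¹` has to be `X`.
  let t : L.LG := ⟨ι.symm (X⁻¹ * (altGL L.N)⁻¹), γ s⟩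
  have htr : t.right ≠ 1 := mt (hγ s).mp hs
  have htl : L.incl t.left = X⁻¹ * (altGL L.N)⁻¹ := hι _
  let F : WD κ σ Ω →* L.LG := SemidirectProduct.inl.comp (ι.symm.toMonoidHom.comp A)
  have hFr : ∀ τ, (F τ).right = 1 := fun _ => rfl
  have hFl : ∀ τ, L.incl (F τ).left = A τ := fun τ => hι _
  have hmul : ∀ x y : WD₀ σ Ω κ, x ∉ WD κ σ Ω → y ∉ WD κ σ Ω → x * y ∈ WD κ σ Ω := by
    intro x y hx hy
    show WD₀.toGal σ Ω κ (x * y) ∈ galOver σ Ω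
    rw [map_mul]
    exact mul_mem_galOver hσ hx hy
  obtain ⟨f, hf1, hf2⟩ := exists_hom_extension hmul hs (conj_mem_WD hσ s) (sq_mem_WD hσ s) F t
    (fun τ => D.ext (by
      rw [D.left_mul_of_ne htr, left_mul_of_eq (hFr _), hFl, hFl, htl, glInvolutionFun]
      have := h1 τ
      generalize A ⟨s * τ * s⁻¹, conj_mem_WD hσ s τ⟩ = a at this ⊢
      have ha : a = X⁻¹ * invTranspose L.N (A τ) * X := by
        rw [mul_assoc, inv_mul_eq_iff_eq_mul] at this
        rw [mul_assoc, ← this]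
        group
      rw [ha]
      group) (by
      rw [SemidirectProduct.mul_right, SemidirectProduct.mul_right, hFr, hFr, one_mul, mul_one]))
    -- The relation at `s²` is the symmetry `h2` of the form; the Galois components cancel because
    -- the quotient has order at most two.
    (D.ext (by
      rw [D.left_mul_of_ne htr, hFl, htl, glInvolutionFun, invTranspose_mul, invTranspose_inv,
        invTranspose_inv, invTranspose_altGL, h2]
      group) (by
      rw [SemidirectProduct.mul_right, hFr]
      exact D.gal_mul _ _ htr htr))
  have hr : ∀ w, (f w).right = AlgEquiv.restrictNormalHom L.K (WD₀.toGal σ Ω κ w) := by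
    intro w
    show _ = γ w
    by_cases hw : w ∈ WD κ σ Ω
    · rw [hf1 ⟨w, hw⟩, hFr, (hγ w).mpr hw]
    · have hs' : s⁻¹ ∉ WD κ σ Ω := fun h => hs ((WD κ σ Ω).inv_mem_iff.mp h)
      have := hf2 ⟨w * s⁻¹, hmul w s⁻¹ hw hs'⟩
      rw [inv_mul_cancel_right] at this
      rw [this, SemidirectProduct.mul_right, hFr, one_mul]
      show γ s = γ w
      have h3 := (hγ _).mpr (hmul w s⁻¹ hw hs')
      rw [map_mul, map_inv, mul_inv_eq_one] at h3
      exact h3.symm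
  have hequiv : ∀ τ m, T (ρ τ m) = homRep hr τ (T m) := by
    intro τ m
    rw [homRep_apply, D.std_eq]
    show _ = (L.incl (f τ).left : Matrix (Fin L.N) (Fin L.N) ℂ) *ᵥ T m
    rw [hf1, hFl, hA]
  exact ⟨⟨f, (isAdmissible_iff_isWDRep hk hσ hc D.isStandard hr).mpr
    (isWDRep_conj T hequiv hρ), hr⟩, hequiv⟩

theorem exists_rep_equiv_iff [IsSepClosure k Ω] (hk : IsLocalField κ k) (hσ : ∀ x, σ (σ x) = x)
    (hc : Continuous σ) {s : WD₀ σ Ω κ} (hs : s ∉ WD κ σ Ω)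
    {M : Type*} [AddCommGroup M] [Module ℂ M] [FiniteDimensional ℂ M]
    (ρ : Representation ℂ (WD κ σ Ω) M) :
    (∃ φ : LParam κ L, Nonempty (φ.rep.Equiv ρ)) ↔
      IsWDRep κ ρ ∧ (∃ B, IsConjDualForm hσ s ρ ((-1) ^ (L.N + 1)) B) ∧ finrank ℂ M = L.N := by
  constructor
  · rintro ⟨φ, ⟨e⟩⟩
    let T := e.toLinearEquiv
    have hT : ∀ τ m, T (φ.rep τ m) = ρ τ (T m) := fun τ m =>
      LinearMap.congr_fun (e.isIntertwining' τ) m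
    have hTs : ∀ τ m, T.symm (ρ τ m) = φ.rep τ (T.symm m) := fun τ m => by
      rw [LinearEquiv.symm_apply_eq, hT, T.apply_symm_apply]
    refine ⟨isWDRep_conj T hT (D.isWDRep_rep φ hk hσ hc), ?_, ?_⟩
    · obtain ⟨h1, h2, h3⟩ := D.isConjDualForm_rep φ hσ hs
      refine ⟨(matForm (gram φ s : Matrix (Fin L.N) (Fin L.N) ℂ)).compl₁₂ T.symm.toLinearMap
        T.symm.toLinearMap, ⟨fun m hm => ?_, fun m hm => ?_⟩, fun τ m n => ?_, fun m n => ?_⟩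
      · refine T.symm.map_eq_zero_iff.mp (h1.1 _ fun y => ?_)
        rw [← T.symm_apply_apply y]
        exact hm _
      · refine T.symm.map_eq_zero_iff.mp (h1.2 _ fun y => ?_)
        rw [← T.symm_apply_apply y]
        exact hm _
      · show matForm (gram φ s : Matrix (Fin L.N) (Fin L.N) ℂ) (T.symm (ρ τ m)) (T.symm (ρ _ n)) =
          matForm (gram φ s : Matrix (Fin L.N) (Fin L.N) ℂ) (T.symm m) (T.symm n)
        rw [hTs, hTs, h2]
      · show matForm (gram φ s : Matrix (Fin L.N) (Fin L.N) ℂ) (T.symm n) (T.symm m) =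
          _ * matForm (gram φ s : Matrix (Fin L.N) (Fin L.N) ℂ) (T.symm m) (T.symm (ρ _ n))
        rw [hTs, h3]
    · rw [← T.finrank_eq, finrank_fin_fun]
  · rintro ⟨hρ, ⟨B, hB⟩, hd⟩
    let T : M ≃ₗ[ℂ] (Fin L.N → ℂ) := LinearEquiv.ofFinrankEq _ _ (by rw [hd, finrank_fin_fun])
    obtain ⟨φ, hφ⟩ := D.exists_param hk hσ hc hs hρ hB T
    refine ⟨φ, ⟨Representation.Equiv.mk T.symm fun τ => LinearMap.ext fun m => ?_⟩⟩
    show T.symm (φ.rep τ m) = ρ τ (T.symm m)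
    rw [LinearEquiv.symm_apply_eq, hφ, T.apply_symm_apply]

end LGroupData.IsUnitary

end Unitary

/-! ### The L-group of a unitary group and the main theorem -/

section UnitaryGroup

universe u v w

variable {k : Type u} [NontriviallyNormedField k] {κ : LocalKind} {σ : k ≃+* k}
  (Ω : Type v) [Field Ω] [Algebra k Ω]

theorem finiteDimensional_baseField (hσ : ∀ x, σ (σ x) = x) :
    FiniteDimensional (fixedField σ) (baseField σ Ω) := by
  classical
  have hk : FiniteDimensional (fixedField σ) k := by
    by_cases h : ∃ y, σ y ≠ y
    · obtain ⟨y, hy⟩ := h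
      have hy0 : y - σ y ≠ 0 := sub_ne_zero.mpr fun h => hy h.symm
      refine ⟨⟨{1, y}, eq_top_iff.mpr fun x _ => ?_⟩⟩
      have hinv : ∀ z, σ (z - σ z) = -(z - σ z) := fun z => by rw [map_sub, hσ, neg_sub]
      -- Applying `σ` to `x = d + c y` and subtracting determines `c`; numerator and denominator
      -- both change sign under `σ`.
      let c : fixedField σ := ⟨(x - σ x) / (y - σ y), by
        rw [mem_fixedField, map_div₀, hinv, hinv, neg_div_neg_eq]⟩
      let d : fixedField σ := ⟨x - c * y, by
        have hc : σ c = c := c.2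
        rw [mem_fixedField, map_sub, map_mul, hc]
        have : (c : k) * (y - σ y) = x - σ x := div_mul_cancel₀ _ hy0
        linear_combination this⟩
      have hx : x = d • (1 : k) + c • y := by
        show x = (x - c * y) * 1 + c * y
        ring
      rw [hx]
      refine add_mem (Submodule.smul_mem _ _ (Submodule.subset_span ?_))
        (Submodule.smul_mem _ _ (Submodule.subset_span ?_)) <;> simp
    · push Not at h
      refine ⟨⟨{1}, eq_top_iff.mpr fun x _ => ?_⟩⟩
      have hx : x = (⟨x, h x⟩ : fixedField σ) • (1 : k) := (mul_one x).symm
      rw [hx]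
      exact Submodule.smul_mem _ _ (Submodule.subset_span (by simp))
  exact LinearEquiv.finiteDimensional
    (AlgEquiv.ofInjectiveField (IsScalarTower.toAlgHom (fixedField σ) k Ω)).toLinearEquiv

theorem lgroupU_isUnitary [IsSepClosure k Ω] (hσ : ∀ x, σ (σ x) = x) (n : ℕ) :
    (lgroupU Ω hσ n).IsUnitary := by
  have hnormal := baseField_normal Ω hσ
  have hact : ∀ γ : (baseField σ Ω ≃ₐ[fixedField σ] baseField σ Ω), γ ≠ 1 →
      ∀ g : GL (Fin n) ℂ, homOfInvolution (baseField_gal Ω hσ) (glInvolution n)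
        (glInvolution_mul_self n) γ g = glInvolutionFun n g := by
    intro γ hγ g
    rw [homOfInvolution_of_ne _ _ _ hγ]
    rfl
  have hres : ∀ g : AbsGal σ Ω, AlgEquiv.restrictNormalHom (baseField σ Ω) g = 1 ↔
      g ∈ galOver σ Ω := by
    intro g
    constructor
    · intro h x
      have := congrArg Subtype.val (DFunLike.congr_fun h ⟨algebraMap k Ω x, x, rfl⟩)
      rwa [AlgEquiv.restrictNormalHom_apply] at this
    · intro h
      ext1 z
      obtain ⟨x, hx⟩ := z.2
      refine Subtype.ext ?_
      rw [AlgEquiv.restrictNormalHom_apply]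
      show g z = z
      rw [← hx]
      exact h x
  exact
    { incl_bijective := Function.bijective_id
      finite := finiteDimensional_baseField Ω hσ
      act_of_ne := hact
      gal_mul := baseField_gal Ω hσ
      std_eq := fun _ => rfl
      restrict_eq_one_iff := hres }

variable {Ω} [IsSepClosure k Ω]

/-- Parameters of `U(V)`, `dim V = n`. -/
theorem parameters_U (hk : IsLocalField κ k) (hσ : ∀ x, σ (σ x) = x) (hc : Continuous σ) (n : ℕ)
    (s : WD₀ σ Ω κ) (hs : s ∉ WD κ σ Ω) :
    (∀ (M : Type w) [AddCommGroup M] [Module ℂ M] [FiniteDimensional ℂ M]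
        (ρ : Representation ℂ (WD κ σ Ω) M),
        (∃ φ : LParam κ (lgroupU Ω hσ n), Nonempty (φ.rep.Equiv ρ)) ↔
          IsWDRep κ ρ ∧ (Odd n → IsConjOrthogonal hσ s ρ) ∧ (Even n → IsConjSymplectic hσ s ρ) ∧
            finrank ℂ M = n) ∧
      (∀ φ φ' : LParam κ (lgroupU Ω hσ n),
        Nonempty (φ.rep.Equiv φ'.rep) ↔ φ.Equivalent φ') ∧
      (∀ (φ : LParam κ (lgroupU Ω hσ n))
        (M : Type w) [AddCommGroup M] [Module ℂ M] [FiniteDimensional ℂ M]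
        (ρ : Representation ℂ (WD κ σ Ω) M), Nonempty (φ.rep.Equiv ρ) →
        ∀ B, IsConjDualForm hσ s ρ ((-1) ^ (n + 1)) B → CentralizerIso φ (centralizerC ρ B)) := by
  have D := lgroupU_isUnitary Ω hσ n
  refine ⟨fun M _ _ _ ρ => ?_, fun φ φ' => D.nonempty_equiv_iff_equivalent hσ hs,
    fun φ M _ _ _ ρ he B hB => D.centralizerIso hσ hs he hB⟩
  have hsign : (∃ B, IsConjDualForm hσ s ρ ((-1) ^ (n + 1)) B) ↔
      (Odd n → IsConjOrthogonal hσ s ρ) ∧ (Even n → IsConjSymplectic hσ s ρ) := by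
    rcases Nat.even_or_odd n with hn | hn
    · rw [hn.add_one.neg_one_pow]
      exact ⟨fun h => ⟨fun h' => absurd hn (Nat.not_even_iff_odd.mpr h'), fun _ => h⟩,
        fun h => h.2 hn⟩
    · rw [hn.add_one.neg_one_pow]
      exact ⟨fun h => ⟨fun _ => h, fun h' => absurd h' (Nat.not_even_iff_odd.mpr hn)⟩,
        fun h => h.1 hn⟩
  refine (D.exists_rep_equiv_iff hk hσ hc hs ρ).trans (and_congr_right fun _ => ?_)
  rw [← and_assoc]
  exact and_congr hsign Iff.rfl

end UnitaryGroup

end ClassicalPar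

universe u v w x

open ClassicalPar Module in
theorem theoremT
    -- a local field `k` of characteristic `≠ 2`, with involution `σ` and separable closure `Ω`
    (κ : LocalKind) (k : Type u) [NontriviallyNormedField k] (hk : IsLocalField κ k)
    (h2 : (2 : k) ≠ 0) (σ : k ≃+* k) (hσ : ∀ y, σ (σ y) = y) (hσc : Continuous σ)
    (Ω : Type v) [Field Ω] [Algebra k Ω] [IsSepClosure k Ω]
    -- a space `V` with a non-degenerate `ε`-symmetric `σ`-sesquilinear form
    (V : Type x) [AddCommGroup V] [Module k V] [FiniteDimensional k V]
    (ε : k) (hε : ε = 1 ∨ ε = -1) (form : V →ₗ[k] V →ₛₗ[(σ : k →+* k)] k)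
    (hform : form.Nondegenerate) (hsymm : ∀ y z, form y z = ε * σ (form z y)) (n : ℕ) :
    -- `G = Sp(V)`, `dim V = 2n`
    (σ = RingEquiv.refl k → ε = -1 → finrank k V = 2 * n →
      (∀ (M : Type w) [AddCommGroup M] [Module ℂ M] [FiniteDimensional ℂ M]
        (ρ : Representation ℂ (WD κ σ Ω) M),
        (∃ φ : LParam κ (lgroupSp σ Ω n), Nonempty (φ.rep.Equiv ρ)) ↔
          IsWDRep κ ρ ∧ IsOrthogonal ρ ∧ finrank ℂ M = 2 * n + 1 ∧
            ∀ τ, LinearMap.det (ρ τ) = 1) ∧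
      (∀ φ φ' : LParam κ (lgroupSp σ Ω n),
        Nonempty (φ.rep.Equiv φ'.rep) ↔ φ.Equivalent φ') ∧
      (∀ φ : LParam κ (lgroupSp σ Ω n), ¬ OrthogonalSummandsEven φ.rep) ∧
      (∀ (φ : LParam κ (lgroupSp σ Ω n))
        (M : Type w) [AddCommGroup M] [Module ℂ M] [FiniteDimensional ℂ M]
        (ρ : Representation ℂ (WD κ σ Ω) M), Nonempty (φ.rep.Equiv ρ) →
        ∀ B, IsSelfDualForm ρ 1 B → CentralizerIso φ (centralizerCPlus ρ B))) ∧
    -- `G = SO(V)`, `dim V = 2n + 1`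
    (σ = RingEquiv.refl k → ε = 1 → finrank k V = 2 * n + 1 →
      (∀ (M : Type w) [AddCommGroup M] [Module ℂ M] [FiniteDimensional ℂ M]
        (ρ : Representation ℂ (WD κ σ Ω) M),
        (∃ φ : LParam κ (lgroupSOOdd σ Ω n), Nonempty (φ.rep.Equiv ρ)) ↔
          IsWDRep κ ρ ∧ IsSymplectic ρ ∧ finrank ℂ M = 2 * n) ∧
      (∀ φ φ' : LParam κ (lgroupSOOdd σ Ω n),
        Nonempty (φ.rep.Equiv φ'.rep) ↔ φ.Equivalent φ') ∧
      (∀ (φ : LParam κ (lgroupSOOdd σ Ω n))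
        (M : Type w) [AddCommGroup M] [Module ℂ M] [FiniteDimensional ℂ M]
        (ρ : Representation ℂ (WD κ σ Ω) M), Nonempty (φ.rep.Equiv ρ) →
        ∀ B, IsSelfDualForm ρ (-1) B → CentralizerIso φ (centralizerCPlus ρ B))) ∧
    -- `G = SO(V)`, `dim V = 2n`, `disc V = d`
    (σ = RingEquiv.refl k → ε = 1 → finrank k V = 2 * n →
      ∀ d : fixedField σ, IsDiscriminant form n d →
      (∀ (M : Type w) [AddCommGroup M] [Module ℂ M] [FiniteDimensional ℂ M]
        (ρ : Representation ℂ (WD κ σ Ω) M),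
        (∃ φ : LParam κ (lgroupSOEven Ω n d), Nonempty (φ.rep.Equiv ρ)) ↔
          IsWDRep κ ρ ∧ IsOrthogonal ρ ∧ finrank ℂ M = 2 * n ∧
            ∀ τ, LinearMap.det (ρ τ) = discChar Ω (d : k) (WD₀.toGal σ Ω κ τ)) ∧
      (∀ φ φ' : LParam κ (lgroupSOEven Ω n d),
        φ.Equivalent φ' → Nonempty (φ.rep.Equiv φ'.rep)) ∧
      (∀ φ : LParam κ (lgroupSOEven Ω n d),
        (¬ (0 < n ∧ OrthogonalSummandsEven φ.rep) →
          ∀ φ' : LParam κ (lgroupSOEven Ω n d),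
            Nonempty (φ.rep.Equiv φ'.rep) → φ.Equivalent φ') ∧
        (0 < n ∧ OrthogonalSummandsEven φ.rep →
          ∃ φ' : LParam κ (lgroupSOEven Ω n d),
            Nonempty (φ.rep.Equiv φ'.rep) ∧ ¬ φ.Equivalent φ' ∧
            ∀ φ'' : LParam κ (lgroupSOEven Ω n d), Nonempty (φ.rep.Equiv φ''.rep) →
              φ.Equivalent φ'' ∨ φ'.Equivalent φ'')) ∧
      (∀ (φ : LParam κ (lgroupSOEven Ω n d))
        (M : Type w) [AddCommGroup M] [Module ℂ M] [FiniteDimensional ℂ M]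
        (ρ : Representation ℂ (WD κ σ Ω) M), Nonempty (φ.rep.Equiv ρ) →
        ∀ B, IsSelfDualForm ρ 1 B → CentralizerIso φ (centralizerCPlus ρ B))) ∧
    -- `G = U(V)`, `dim V = n`; here `s` generates `WD(k₀)/WD(k)`
    (σ ≠ RingEquiv.refl k → finrank k V = n →
      ∀ s : WD₀ σ Ω κ, s ∉ WD κ σ Ω →
      (∀ (M : Type w) [AddCommGroup M] [Module ℂ M] [FiniteDimensional ℂ M]
        (ρ : Representation ℂ (WD κ σ Ω) M),
        (∃ φ : LParam κ (lgroupU Ω hσ n), Nonempty (φ.rep.Equiv ρ)) ↔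
          IsWDRep κ ρ ∧ (Odd n → IsConjOrthogonal hσ s ρ) ∧ (Even n → IsConjSymplectic hσ s ρ) ∧
            finrank ℂ M = n) ∧
      (∀ φ φ' : LParam κ (lgroupU Ω hσ n),
        Nonempty (φ.rep.Equiv φ'.rep) ↔ φ.Equivalent φ') ∧
      (∀ (φ : LParam κ (lgroupU Ω hσ n))
        (M : Type w) [AddCommGroup M] [Module ℂ M] [FiniteDimensional ℂ M]
        (ρ : Representation ℂ (WD κ σ Ω) M), Nonempty (φ.rep.Equiv ρ) →
        ∀ B, IsConjDualForm hσ s ρ ((-1) ^ (n + 1)) B → CentralizerIso φ (centralizerC ρ B))) := by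
  refine ⟨?_, ?_, ?_, fun _ _ s hs => parameters_U hk hσ hσc n s hs⟩
  · rintro rfl - -
    exact parameters_Sp hk n
  · rintro rfl - -
    exact parameters_SOOdd hk n
  · rintro rfl - - d ⟨b, hd⟩
    -- For `n = 0` the discriminant is an empty determinant, hence 1.
    refine parameters_SOEven hk n d fun hn => ?_
    subst hn
    rw [hd]
    simp
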